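/- **Setting.** Let $\kappa,\tau\in\mathbb R$. Let $\mathrm{sn}_\kappa$ and $\mathrm{cs}_\kappa$ be the generalized sine and cosine ($\frac{\sin(\sqrt\kappa r)}{\sqrt\kappa}$, $r$, $\frac{\sinh(\sqrt{-\kappa}r)}{\sqrt{-\kappa}}$, respectively $\cos(\sqrt\kappa r)$, $1$, $\cosh(\sqrt{-\kappa}r)$, for $\kappa>0$, $\kappa=0$, $\kappa<0$), $\mathrm{ct}_\kappa=\mathrm{cs}_\kappa/\mathrm{sn}_\kappa$, and $I_\kappa=(0,\pi/\sqrt\kappa)$ for $\kappa>0$, $I_\kappa=(0,\infty)$ for $\kappa\le0$. The space $\mathbb E(\kappa,\tau)$ (including $\mathbb R^3$ and $\mathbb S^3(\kappa)$) is described, off the axis $r=0$ (and, for $\kappa>0$, off the second axis $r=\pi/\sqrt\kappa$ and after passing to the fibrewise universal covering), by $I_\kappa\times(\mathbb R/2\pi\mathbb Z)\times\mathbb R\ni(r,\theta,z)$ with the metric $$g=dr^2+\mathrm{sn}_\kappa(r)^2d\theta^2+\bigl(4\tau\,\mathrm{sn}_\kappa(\tfrac r2)^2d\theta-dz\bigr)^2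 .$$ A screw motion of pitch $a\in\mathbb R$ is $(r,\theta,z)\mapsto(r,\theta+\varphi,z+a\varphi)$, $\varphi\in\mathbb R$. Its orbit space has coordinates $r$ and $h=z-a\theta$ and carries the quotient metric $g_a$. A regular curve in the orbit space (the profile curve) generates a screw motion invariant surface of pitch $a$; these generated surfaces are the invariant surfaces considered. For a unit-speed profile curve let $\sigma$ be the angle from $\partial_r$ to the tangent vector. The energy is $$J=\tfrac{2H}{\kappa}\bigl(\mathrm{cs}_\kappa(r)-1\bigr)+\mathrm{sn}_\kappa(r)\sin\sigma\quad(\kappa\ne0),\qquad J=-Hr^2+r\sin\sigma\quad(\kappa=0).$$ **Theorem.** Let $H>0$ with $4H^2+\kappa>0$. Put $J_{\max}=(\sqrt{4H^2+\kappa}-2H)/\kappa$ for $\kappa\neq0$, $J_{\max}=\frac1{4H}$ for $\kappa=0$, and let $\mathcal I=(-\infty,J_{\max}]$ if $\kappa\le0$, $\mathcal I=[-\frac{2H}\kappa,J_{\max}]$ if $\kappa>0$. For every pitch $a\in\mathbb R$ and every $J\in\mathcal I$ there is a smooth unit-speed profile curve $\gamma_{a,J}=(r,h,\sigma)$, defined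 on an open interval, of constant energy $J$, generating an invariant surface $\Sigma_{a,J}$ of pitch $a$ and constant mean curvature $H$ (for a suitable unit normal), such that for every $a$: * (Continuity.) $(J,t)\mapsto\gamma_{a,J}(t)$ is continuous on the set of all $(J,t)$ with $J\in\mathcal I$ and $t$ in the domain of $\gamma_{a,J}$. * (Parametrization.) If $\Sigma_{a,J'}$ is a vertical translate of $\Sigma_{a,J}$, then $J=J'$. * (Exhaustion.) For each regular $C^2$ curve $c=(r,h)$ on an open interval that generates an invariant surface of pitch $a$ and constant mean curvature $H$, $c$ is, up to a vertical translation and a regular reparametrization, a part of $\gamma_{a,J}$ for some $J\in\mathcal I$; or else $\kappa>0$ and the same holds, for the pitch $\tilde a=\frac{4\tau}\kappa-a$ in place of $a$, for the curve $(\frac\pi{\sqrt\kappa}-r,-h)$ obtained by exchanging the two axes. * (Boundedness.) Each $\Sigma_{a,J}$ is cylindrically bounded: there is $R\in I_\kappa$ with $r\le R$ on $\Sigma_{a,J}$. The geometry of $\Sigma_{a,J}$ depends on $J$ as follows. 1. $J=J_{\max}$: the profile curve is a whole vertical line, and the surface is the vertical round cylinder $\{r=r_0\}$, where $r_0$ is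 the unique element of $I_\kappa$ with $\mathrm{ct}_\kappa(r_0)=2H$. 2. $0<J<J_{\max}$ (unduloid type): the profile curve is defined on $\mathbb R$, $h$ is strictly increasing, $r$ and $\sigma$ are periodic with a common period and $r$ is not constant. The surface is an embedded cylinder if $a=0$ and an immersed plane if $a\ne0$. 3. $J=0$ (sphere type): the profile curve is an open arc with $h$ strictly increasing; it extends to an embedded closed arc whose two end points, and no other points, lie on the axis $r=0$. The surface is homeomorphic to a doubly punctured sphere if $a=0$ and is an immersed incomplete strip if $a\ne0$. 4. $J\in\mathcal I$, $J<0$: the profile curve is defined on $\mathbb R$, $\sigma$ is strictly increasing, and $r$, $h'$ and $\sigma\ (\mathrm{mod}\ 2\pi)$ are periodic with a common period $P>0$, in which $\sigma$ increases by $2\pi$. The vertical period $\Delta=h(\sigma+2\pi)-h(\sigma)$ is constant. * $\Delta>0$ (nodoid type I): the surface is an immersed cylinder if $a=0$ and an immersed plane if $a\neq0$. * $\Delta=0$ (tube): the profile curve is a simple loop of period $P$; the surface is an embedded torus if $a=0$ and an immersed cylinder if $a\neq0$. * $\Delta<0$ (nodoid type II): the surface is an immersed cylinder if $a=0$ and an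 immersed plane if $a\neq0$. Here an immersed plane, strip, cylinder or torus is the image of a smooth immersion of that surface which is equivariant under the screw motions of pitch $a$ and whose lift to the coordinates $(r,\theta,z)$ with $\theta\in\mathbb R$ is, modulo the identifications of the parameter plane that define the surface, injective on a dense set. -/

import Mathlib

open Real Set Filter Topology
open scoped ContDiff

noncomputable section

/-! ### Generalized trigonometric functions -/

/-- The generalized sine of curvature `κ`. -/
def snK (κ r : ℝ) : ℝ :=
  if 0 < κ then sin (√κ * r) / √κ else if κ = 0 then r else sinh (√(-κ) * r) / √(-κ)

/-- The generalized cosine of curvature `κ`. -/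
def csK (κ r : ℝ) : ℝ :=
  if 0 < κ then cos (√κ * r) else if κ = 0 then 1 else cosh (√(-κ) * r)

/-- The generalized cotangent of curvature `κ`. -/
def ctK (κ r : ℝ) : ℝ := csK κ r / snK κ r

/-- The interval of admissible radii: `(0, π/√κ)` for `κ > 0` and `(0, ∞)` for `κ ≤ 0`. -/
def radii (κ : ℝ) : Set ℝ := if 0 < κ then Ioo 0 (π / √κ) else Ioi 0

/-! ### The ambient space `E(κ,τ)` in geodesic polar coordinates -/

/-- Points `(r, θ, z)` with `θ` modulo `2π`; the regular part of (the fibrewise universal covering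
of) `E(κ,τ)` consists of those with `r ∈ radii κ`. -/
abbrev Pt : Type := ℝ × Real.Angle × ℝ

/-- Lifted coordinates `(r, θ, z)` with `θ ∈ ℝ`; also tangent vectors in these coordinates. -/
abbrev Coord : Type := ℝ × ℝ × ℝ

/-- Reduction of the angular coordinate modulo `2π`. -/
def toPt (p : Coord) : Pt := (p.1, (p.2.1 : Real.Angle), p.2.2)

/-- The Riemannian metric `dr² + sn(r)² dθ² + (4τ sn(r/2)² dθ - dz)²` at the point `p`,
applied to the tangent vectors `v`, `w`. -/
def gE (κ τ : ℝ) (p v w : Coord) : ℝ :=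
  v.1 * w.1 + snK κ p.1 ^ 2 * (v.2.1 * w.2.1)
    + (4 * τ * snK κ (p.1 / 2) ^ 2 * v.2.1 - v.2.2)
      * (4 * τ * snK κ (p.1 / 2) ^ 2 * w.2.1 - w.2.2)

/-- Derivative at `p`, in direction `u`, of the function `g(v, w)` for coordinate-constant vector
fields `v`, `w`. -/
def dgE (κ τ : ℝ) (p u v w : Coord) : ℝ := fderiv ℝ (fun q => gE κ τ q v w) p u

/-- Christoffel symbol of the first kind `g(∇_u v, w)` of the Levi-Civita connection, for
coordinate-constant vector fields (Koszul formula). -/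
def christoffelE (κ τ : ℝ) (p u v w : Coord) : ℝ :=
  (dgE κ τ p u v w + dgE κ τ p v u w - dgE κ τ p w u v) / 2

/-- First partial derivative of a parametrized surface in parameter direction `e`. -/
def partialX (X : ℝ × ℝ → Coord) (e : ℝ × ℝ) (p : ℝ × ℝ) : Coord := fderiv ℝ X p e

/-- Second fundamental form `g(∇_{∂_e} ∂_f X, n)` of a parametrized surface `X` in the
normal direction `n`. -/
def secondForm (κ τ : ℝ) (X : ℝ × ℝ → Coord) (n : Coord) (e f p : ℝ × ℝ) : ℝ :=
  gE κ τ (X p) (partialX (partialX X f) e p) n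
    + christoffelE κ τ (X p) (partialX X e p) (partialX X f p) n

/-- First fundamental form of a parametrized surface. -/
def firstForm (κ τ : ℝ) (X : ℝ × ℝ → Coord) (e f p : ℝ × ℝ) : ℝ :=
  gE κ τ (X p) (partialX X e p) (partialX X f p)

/-- The parametrized surface `X : U → E(κ,τ)` has constant mean curvature `H` with respect to one
of its continuous unit normal fields `n`. As usual `2H` is the trace of the second fundamental
form with respect to the first, i.e. `2H (EG - F²) = EN - 2FM + GL`. -/
def HasCMC (κ τ H : ℝ) (U : Set (ℝ × ℝ)) (X : ℝ × ℝ → Coord) : Prop :=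
  ∃ n : ℝ × ℝ → Coord, ContinuousOn n U ∧ ∀ p ∈ U,
    gE κ τ (X p) (n p) (n p) = 1 ∧
    gE κ τ (X p) (partialX X (1, 0) p) (n p) = 0 ∧
    gE κ τ (X p) (partialX X (0, 1) p) (n p) = 0 ∧
    firstForm κ τ X (1, 0) (1, 0) p * secondForm κ τ X (n p) (0, 1) (0, 1) p
      - 2 * firstForm κ τ X (1, 0) (0, 1) p * secondForm κ τ X (n p) (1, 0) (0, 1) p
      + firstForm κ τ X (0, 1) (0, 1) p * secondForm κ τ X (n p) (1, 0) (1, 0) p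
    = 2 * H * (firstForm κ τ X (1, 0) (1, 0) p * firstForm κ τ X (0, 1) (0, 1) p
      - firstForm κ τ X (1, 0) (0, 1) p ^ 2)

/-! ### Screw motions and the surfaces generated by curves -/

/-- The screw motion of pitch `a` by the angle `φ`. -/
def screw (a φ : ℝ) (x : Pt) : Pt := (x.1, x.2.1 + (φ : Real.Angle), x.2.2 + a * φ)

/-- Vertical translation by `v`. -/
def vertShift (v : ℝ) (x : Pt) : Pt := (x.1, x.2.1, x.2.2 + v)

/-- The surface generated under the screw motions of pitch `a` by the curve `c = (r, h)` in the
orbit space with invariant coordinates `r` and `h = z - aθ`, in lifted coordinates. -/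
def screwParam (a : ℝ) (c : ℝ → ℝ × ℝ) (p : ℝ × ℝ) : Coord :=
  ((c p.1).1, p.2, (c p.1).2 + a * p.2)

/-- The quotient metric on the orbit space at radius `r`: the ambient inner product of
the components orthogonal to the Killing field `∂_θ + a ∂_z` of the lifts of `v = (v_r, v_h)` and
`w = (w_r, w_h)`. -/
def gOrbit (κ τ a r : ℝ) (v w : ℝ × ℝ) : ℝ :=
  gE κ τ (r, 0, 0) (v.1, 0, v.2) (w.1, 0, w.2)
    - gE κ τ (r, 0, 0) (v.1, 0, v.2) (0, 1, a) * gE κ τ (r, 0, 0) (w.1, 0, w.2) (0, 1, a)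
      / gE κ τ (r, 0, 0) (0, 1, a) (0, 1, a)

/-- A curve `(r, h)` in the orbit space with angle function `σ`, on the parameter set `dom`
(values outside `dom` are irrelevant). -/
structure ProfileCurve where
  dom : Set ℝ
  r : ℝ → ℝ
  h : ℝ → ℝ
  σ : ℝ → ℝ

/-- The underlying curve in the orbit space. -/
def ProfileCurve.curve (γ : ProfileCurve) (t : ℝ) : ℝ × ℝ := (γ.r t, γ.h t)

/-- The screw motion surface of pitch `a` generated by `γ`. -/
def ProfileCurve.surface (γ : ProfileCurve) (a : ℝ) : Set Pt :=
  {x | ∃ t ∈ γ.dom, ∃ φ : ℝ, x = screw a φ (γ.r t, 0, γ.h t)}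

/-- The energy. -/
def energy (κ H r σ : ℝ) : ℝ :=
  if κ = 0 then -H * r ^ 2 + r * sin σ
  else 2 * H / κ * (csK κ r - 1) + snK κ r * sin σ

/-- The maximal energy, with its limit value at `κ = 0`. -/
def Jmax (κ H : ℝ) : ℝ :=
  if κ = 0 then 1 / (4 * H) else (√(4 * H ^ 2 + κ) - 2 * H) / κ

/-- The parameter interval of the family. -/
def energyRange (κ H : ℝ) : Set ℝ :=
  if 0 < κ then Icc (-(2 * H / κ)) (Jmax κ H) else Iic (Jmax κ H)

/-- `γ` is a smooth unit-speed curve in the orbit space of the screw motions of pitch `a`, `σ` is a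
smooth choice of the angle from `∂_r` to `γ'`, the generated surface has constant mean
curvature `H`, and the energy is constantly `J`. -/
structure IsProfile (κ τ a H J : ℝ) (γ : ProfileCurve) : Prop where
  dom_open : IsOpen γ.dom
  dom_conn : γ.dom.OrdConnected
  dom_nonempty : γ.dom.Nonempty
  smooth_r : ContDiffOn ℝ ∞ γ.r γ.dom
  smooth_h : ContDiffOn ℝ ∞ γ.h γ.dom
  smooth_σ : ContDiffOn ℝ ∞ γ.σ γ.dom
  radius_mem : ∀ t ∈ γ.dom, γ.r t ∈ radii κ
  unit_speed : ∀ t ∈ γ.dom,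
    gOrbit κ τ a (γ.r t) (deriv γ.r t, deriv γ.h t) (deriv γ.r t, deriv γ.h t) = 1
  cos_angle : ∀ t ∈ γ.dom,
    cos (γ.σ t) = gOrbit κ τ a (γ.r t) (1, 0) (deriv γ.r t, deriv γ.h t)
  sin_angle : ∀ t ∈ γ.dom,
    sin (γ.σ t) = gOrbit κ τ a (γ.r t) (0, 1) (deriv γ.r t, deriv γ.h t)
      / √(gOrbit κ τ a (γ.r t) (0, 1) (0, 1))
  cmc : HasCMC κ τ H (γ.dom ×ˢ univ) (screwParam a γ.curve)
  energy_eq : ∀ t ∈ γ.dom, energy κ H (γ.r t) (γ.σ t) = J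

/-- The curve `c` on `K` is, up to a vertical translation, a regular reparametrization of a part
of `γ`. -/
def IsPieceOf (c : ℝ → ℝ × ℝ) (K : Set ℝ) (γ : ProfileCurve) : Prop :=
  ∃ (v : ℝ) (φ : ℝ → ℝ), MapsTo φ K γ.dom ∧ ContDiffOn ℝ 2 φ K ∧ (∀ s ∈ K, deriv φ s ≠ 0) ∧
    ∀ s ∈ K, c s = (γ.r (φ s), γ.h (φ s) + v)

/-- For `κ > 0`, the exchange of the two axes `r = 0` and `r = π/√κ`. It is induced by
the isometry `(r, θ, z) ↦ (π/√κ - r, θ, 4τθ/κ - z)` in lifted coordinates, which takes screw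
motions of pitch `a` to screw motions of pitch `4τ/κ - a`. -/
def swapAxes (κ : ℝ) (c : ℝ → ℝ × ℝ) (s : ℝ) : ℝ × ℝ := (π / √κ - (c s).1, -(c s).2)

/-! ### Topological types of invariant surfaces -/

/-- `f : N → E(κ,τ)` is a smooth immersion with image `S`, where `N` carries the smooth structure
for which `q : ℝ² → N` is a covering, and `f` is equivariant: shifting the second parameter
corresponds to the screw motions of pitch `a`. The lift of `f` to the coordinates with `θ ∈ ℝ`
is moreover injective at a dense set of points of `N`, so that `N` cannot be replaced by a proper
covering of `N`. -/
structure IsInvariantImmersion (a : ℝ) {N : Type} (q : ℝ × ℝ → N) (f : N → Pt) (S : Set Pt) :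
    Prop where
  smooth_lift : ∃ F : ℝ × ℝ → Coord, ContDiff ℝ ∞ F ∧
    (∀ p, Function.Injective (fderiv ℝ F p)) ∧ (∀ p, f (q p) = toPt (F p)) ∧
    Dense {p | ∀ p', F p' = F p → q p' = q p}
  equivariant : ∀ s φ ψ : ℝ, f (q (s, φ + ψ)) = screw a ψ (f (q (s, φ)))
  range_eq : range f = S

/-- Image of an invariant immersion of the plane `ℝ × ℝ`. -/
def IsImmersedPlane (a : ℝ) (S : Set Pt) : Prop :=
  ∃ f : ℝ × ℝ → Pt, IsInvariantImmersion a (fun p => p) f S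

/-- Image of an invariant immersion of the cylinder `ℝ × S¹`, with the circles as orbits. -/
def IsImmersedCylinder (a : ℝ) (S : Set Pt) : Prop :=
  ∃ f : ℝ × Real.Angle → Pt,
    IsInvariantImmersion a (fun p => (p.1, (p.2 : Real.Angle))) f S

/-- Image of an invariant immersion of the cylinder `ℝ × S¹`, with the circles as orbits, which is
a topological embedding. -/
def IsEmbeddedCylinder (a : ℝ) (S : Set Pt) : Prop :=
  ∃ f : ℝ × Real.Angle → Pt,
    IsInvariantImmersion a (fun p => (p.1, (p.2 : Real.Angle))) f S ∧ IsEmbedding f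

/-- Image of an invariant immersion of the cylinder `S¹ × ℝ`, with the lines as orbits. -/
def IsImmersedTubularCylinder (a : ℝ) (S : Set Pt) : Prop :=
  ∃ f : Real.Angle × ℝ → Pt,
    IsInvariantImmersion a (fun p => ((p.1 : Real.Angle), p.2)) f S

/-- Image of an invariant immersion of the torus `S¹ × S¹` which is an embedding. -/
def IsEmbeddedTorus (a : ℝ) (S : Set Pt) : Prop :=
  ∃ f : Real.Angle × Real.Angle → Pt,
    IsInvariantImmersion a (fun p => ((p.1 : Real.Angle), (p.2 : Real.Angle))) f S ∧ IsEmbedding f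

/-- The pullback metric under the immersion `F : U → E(κ,τ)` is incomplete: some curve in
`U` leaves every compact subset of `U` and has finite length. -/
def IsIncomplete (κ τ : ℝ) (U : Set (ℝ × ℝ)) (F : ℝ × ℝ → Coord) : Prop :=
  ∃ c : ℝ → ℝ × ℝ, ContDiffOn ℝ 1 c (Ioo 0 1) ∧ MapsTo c (Ioo 0 1) U ∧
    (∀ K ⊆ U, IsCompact K → ∀ᶠ t in 𝓝[<] (1 : ℝ), c t ∉ K) ∧
    MeasureTheory.IntegrableOn
      (fun t => √(gE κ τ (F (c t)) (deriv (fun s => F (c s)) t) (deriv (fun s => F (c s)) t)))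
      (Ioo 0 1)

/-- Image of an invariant immersion of an open strip `(-T, T) × ℝ` whose induced metric is
incomplete. The lift of the immersion to the coordinates with `θ ∈ ℝ` is injective. -/
def IsImmersedIncompleteStrip (κ τ a : ℝ) (S : Set Pt) : Prop :=
  ∃ (T : ℝ) (F : ℝ × ℝ → Coord), 0 < T ∧ ContDiffOn ℝ ∞ F (Ioo (-T) T ×ˢ univ) ∧
    (∀ p ∈ Ioo (-T) T ×ˢ (univ : Set ℝ), Function.Injective (fderiv ℝ F p)) ∧
    InjOn F (Ioo (-T) T ×ˢ univ) ∧
    (∀ s ∈ Ioo (-T) T, ∀ φ ψ : ℝ, toPt (F (s, φ + ψ)) = screw a ψ (toPt (F (s, φ)))) ∧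
    (fun p => toPt (F p)) '' (Ioo (-T) T ×ˢ univ) = S ∧
    IsIncomplete κ τ (Ioo (-T) T ×ˢ univ) F

/-- The round unit sphere without its north and south pole. -/
def twicePuncturedSphere : Set (EuclideanSpace ℝ (Fin 3)) :=
  {x | ‖x‖ = 1 ∧ x ≠ EuclideanSpace.single 2 1 ∧ x ≠ -EuclideanSpace.single 2 1}

/-! ### The six types -/

/-- Vertical round cylinder of radius `arcct(2H)`: the profile curve is a whole vertical line. -/
def IsVerticalCylinder (κ a H : ℝ) (γ : ProfileCurve) : Prop :=
  ∃ r₀ ∈ radii κ, ctK κ r₀ = 2 * H ∧ (∀ x ∈ radii κ, ctK κ x = 2 * H → x = r₀) ∧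
    γ.dom = univ ∧ (∀ t, γ.r t = r₀) ∧ Function.Surjective γ.h ∧
    γ.surface a = {x | x.1 = r₀}

/-- Unduloid type. -/
structure IsUnduloidType (a : ℝ) (γ : ProfileCurve) : Prop where
  dom_eq : γ.dom = univ
  h_strictMono : StrictMono γ.h
  periodic : ∃ P > 0, Function.Periodic γ.r P ∧ Function.Periodic γ.σ P
  r_not_const : ∃ t, γ.r t ≠ γ.r 0
  topology_rotational : a = 0 → IsEmbeddedCylinder a (γ.surface a)
  topology_screw : a ≠ 0 → IsImmersedPlane a (γ.surface a)

/-- Sphere type. The profile curve extends to an embedded closed arc whose two end points,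
and no others, lie on the axis `r = 0`. -/
structure IsSphereType (κ τ a : ℝ) (γ : ProfileCurve) : Prop where
  semicircle : ∃ T > 0, γ.dom = Ioo (-T) T ∧ ∃ e : ℝ → ℝ × ℝ,
    ContinuousOn e (Icc (-T) T) ∧ InjOn e (Icc (-T) T) ∧ EqOn e γ.curve (Ioo (-T) T) ∧
    (e (-T)).1 = 0 ∧ (e T).1 = 0 ∧ ∀ t ∈ Ioo (-T) T, 0 < (e t).1
  h_strictMono : StrictMonoOn γ.h γ.dom
  topology_rotational : a = 0 → Nonempty (γ.surface a ≃ₜ twicePuncturedSphere)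
  topology_screw : a ≠ 0 → IsImmersedIncompleteStrip κ τ a (γ.surface a)

/-- The common properties of the profile curves of negative energy: `σ` is strictly increasing, and
`r`, `h'` and `σ` modulo `2π` are periodic, `P` being the time in which `σ` increases by
`2π`; the vertical period `h(σ + 2π) - h(σ)` is `Δ`. -/
structure IsRollingProfile (γ : ProfileCurve) (P Δ : ℝ) : Prop where
  dom_eq : γ.dom = univ
  σ_strictMono : StrictMono γ.σ
  period_pos : 0 < P
  r_periodic : Function.Periodic γ.r P
  dh_periodic : Function.Periodic (deriv γ.h) P
  σ_step : ∀ t, γ.σ (t + P) = γ.σ t + 2 * π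
  vertical_period : ∀ s t, γ.σ s = γ.σ t + 2 * π → γ.h s - γ.h t = Δ

/-- The topology of nodoid type surfaces. -/
structure HasNodoidTopology (a : ℝ) (γ : ProfileCurve) : Prop where
  topology_rotational : a = 0 → IsImmersedCylinder a (γ.surface a)
  topology_screw : a ≠ 0 → IsImmersedPlane a (γ.surface a)

/-- Tubes: the profile curve of period `P` is a simple loop; the surface is a torus or a
cylinder. -/
structure IsTube (a : ℝ) (γ : ProfileCurve) (P : ℝ) : Prop where
  simple_loop : ∀ s t, γ.curve s = γ.curve t ↔ ∃ m : ℤ, s - t = m * P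
  topology_rotational : a = 0 → IsEmbeddedTorus a (γ.surface a)
  topology_screw : a ≠ 0 → IsImmersedTubularCylinder a (γ.surface a)

end

/-! ### Generalized trigonometry -/

/-! The problem becomes linear in the versed radius `y = versK κ r = 2 sn(r/2)²`, the primitive of
`sn` vanishing on the axis: for every sign of `κ`, `cs = 1 - κy` and `sn² = y(2 - κy)`. The quotient
metric is `dr² + (sn²/ξ²) dh²`, where `ξ` is the norm of the Killing field `∂_θ + a ∂_z`. For a
unit-speed profile curve put `X = sn r cos σ` and `Z = sn r sin σ`. Mean curvature `H` then amounts
to `y' = X`, `X' = 1 - κy - 2HZ`, `Z' = 2Hy'`, `h' = ξZ/sn²`, under the constraint `X² + Z² = sn²`.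
Pitch and `τ` enter only through `ξ`, hence only in the height.

The equation for `Z` integrates to `Z = J + 2Hy`, which is conservation of energy. What remains is
the oscillator `y'' = 1 - 2HJ - ω²y` with `ω² = 4H² + κ > 0`, so `y = M + A cos ωt`, and the
constraint fixes `A`. Height and angle are obtained by quadrature. `isProfile_family` verifies that
these formulas give profile curves of mean curvature `H`. Conversely, `exists_isReducedCurve`
derives the linear system from the mean curvature equation of an arbitrary curve, and
`IsReducedCurve.isPieceOf` integrates it: `(ω(y - M), X)` runs on a circle, and its polar angle
supplies the reparametrization.

The constraint forces `J ≤ Jmax`. For `κ > 0` the exchange of the axes sends `y` to `2/κ - y` and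
`J` to `-4H/κ - J`, so that energies with `2H + κJ ≥ 0` suffice.

The types follow from `Z = J + 2Hy`. At `Jmax` the amplitude vanishes. For `0 < J < Jmax` one has `Z
> 0`, so `h` increases and `σ` stays in `(0, π)`. For `J = 0` the solution reaches the axis, but the
factor `y` of `Z` cancels that of `sn²`, so the height extends continuously. For `J < 0` the
numerator `(2H + κJ)y - J` of `σ'` is positive; `σ` gains exactly `2π` per period because `X` has a
single zero strictly inside `(0, P)`. Since `r` is even and `h` is odd, a multiple point `s' ≠ s`
satisfies `s' = s + kP` or `s' = -s + kP`. If `Δ ≠ 0`, the first is impossible and the second forces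
`2h(s) = kΔ`, a countable set of heights, whence dense injectivity. If `Δ = 0`, Rolle's theorem
shows that `h` vanishes only at multiples of `P/2`, and the loop is simple. -/

theorem trig_cases (κ : ℝ) :
    (∃ w : ℝ, 0 < w ∧ κ = w ^ 2 ∧ 0 < κ ∧ √κ = w) ∨ κ = 0 ∨
      (∃ w : ℝ, 0 < w ∧ κ = -w ^ 2 ∧ κ < 0 ∧ √(-κ) = w) := by
  rcases lt_trichotomy κ 0 with h | h | h
  · exact Or.inr (Or.inr ⟨√(-κ), Real.sqrt_pos.2 (by linarith), by
      rw [Real.sq_sqrt (by linarith)]; ring, h, rfl⟩)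
  · exact Or.inr (Or.inl h)
  · exact Or.inl ⟨√κ, Real.sqrt_pos.2 h, by rw [Real.sq_sqrt h.le], h, rfl⟩

theorem snK_of_pos {κ : ℝ} (h : 0 < κ) : snK κ = fun r => sin (√κ * r) / √κ := by
  funext r; simp [snK, h]
theorem snK_zero : snK 0 = fun r => r := by
  funext r; simp [snK]
theorem snK_of_neg {κ : ℝ} (h : κ < 0) : snK κ = fun r => sinh (√(-κ) * r) / √(-κ) := by
  funext r; simp [snK, h.not_gt, h.ne]
theorem csK_of_pos {κ : ℝ} (h : 0 < κ) : csK κ = fun r => cos (√κ * r) := by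
  funext r; simp [csK, h]
theorem csK_zero : csK 0 = fun _ => 1 := by
  funext r; simp [csK]
theorem csK_of_neg {κ : ℝ} (h : κ < 0) : csK κ = fun r => cosh (√(-κ) * r) := by
  funext r; simp [csK, h.not_gt, h.ne]

theorem contDiff_snK (κ : ℝ) {n : WithTop ℕ∞} : ContDiff ℝ n (snK κ) := by
  rcases trig_cases κ with ⟨w, -, -, h, -⟩ | rfl | ⟨w, -, -, h, -⟩
  · rw [snK_of_pos h]; exact (Real.contDiff_sin.comp (contDiff_const.mul contDiff_id)).div_const _
  · rw [snK_zero]; exact contDiff_id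
  · rw [snK_of_neg h]; exact (Real.contDiff_sinh.comp (contDiff_const.mul contDiff_id)).div_const _

theorem hasDerivAt_snK (κ r : ℝ) : HasDerivAt (snK κ) (csK κ r) r := by
  rcases trig_cases κ with ⟨w, h0, -, h, h1⟩ | rfl | ⟨w, h0, -, h, h1⟩
  · rw [snK_of_pos h, csK_of_pos h, h1]
    have := (((hasDerivAt_id r).const_mul w).sin).div_const w
    exact this.congr_deriv (by simp only [id]; field_simp)
  · rw [snK_zero, csK_zero]; exact hasDerivAt_id r
  · rw [snK_of_neg h, csK_of_neg h, h1]
    have := (((hasDerivAt_id r).const_mul w).sinh).div_const w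
    exact this.congr_deriv (by simp only [id]; field_simp)

theorem csK_sq (κ r : ℝ) : csK κ r ^ 2 = 1 - κ * snK κ r ^ 2 := by
  rcases trig_cases κ with ⟨w, h0, hk, h, h1⟩ | rfl | ⟨w, h0, hk, h, h1⟩
  · rw [snK_of_pos h, csK_of_pos h, h1]
    simp only [Real.cos_sq']; rw [hk]; field_simp
  · simp [csK_zero]
  · rw [snK_of_neg h, csK_of_neg h, h1]
    simp only [Real.cosh_sq]; rw [hk]; field_simp; ring

theorem snK_two_mul (κ r : ℝ) : snK κ (2 * r) = 2 * snK κ r * csK κ r := by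
  rcases trig_cases κ with ⟨w, h0, hk, h, h1⟩ | rfl | ⟨w, h0, hk, h, h1⟩
  · rw [snK_of_pos h, csK_of_pos h, h1]
    simp only []
    rw [show w * (2 * r) = 2 * (w * r) by ring, Real.sin_two_mul]; ring
  · simp [csK_zero, snK_zero]
  · rw [snK_of_neg h, csK_of_neg h, h1]
    simp only []
    rw [show w * (2 * r) = 2 * (w * r) by ring, Real.sinh_two_mul]; ring

theorem csK_two_mul (κ r : ℝ) : csK κ (2 * r) = 1 - 2 * κ * snK κ r ^ 2 := by
  rcases trig_cases κ with ⟨w, h0, hk, h, h1⟩ | rfl | ⟨w, h0, hk, h, h1⟩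
  · rw [snK_of_pos h, csK_of_pos h, h1]
    simp only []
    rw [show w * (2 * r) = 2 * (w * r) by ring, Real.cos_two_mul, Real.cos_sq', hk]
    field_simp; ring
  · simp [csK_zero]
  · rw [snK_of_neg h, csK_of_neg h, h1]
    simp only []
    rw [show w * (2 * r) = 2 * (w * r) by ring, Real.cosh_two_mul, Real.cosh_sq, hk]
    field_simp; ring

/-! ### The versed radius and its inverse. -/

/-- The generalized versed sine `2 sn(r/2)²`, a primitive of `sn`. -/
noncomputable def versK (κ r : ℝ) : ℝ := 2 * snK κ (r / 2) ^ 2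

theorem csK_eq (κ r : ℝ) : csK κ r = 1 - κ * versK κ r := by
  have := csK_two_mul κ (r / 2)
  rw [show 2 * (r / 2) = r by ring] at this
  rw [this, versK]; ring

theorem snK_sq (κ r : ℝ) : snK κ r ^ 2 = versK κ r * (2 - κ * versK κ r) := by
  have := snK_two_mul κ (r / 2)
  rw [show 2 * (r / 2) = r by ring] at this
  rw [this, mul_pow, csK_sq, versK]; ring

theorem hasDerivAt_versK (κ r : ℝ) : HasDerivAt (versK κ) (snK κ r) r := by
  have h := ((((hasDerivAt_snK κ (r / 2)).comp r ((hasDerivAt_id r).div_const 2))).pow 2).const_mul 2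
  have := snK_two_mul κ (r / 2)
  rw [show 2 * (r / 2) = r by ring] at this
  refine h.congr_deriv ?_
  rw [this]; simp only [Function.comp, id]; push_cast; ring

theorem contDiff_versK (κ : ℝ) {n : WithTop ℕ∞} : ContDiff ℝ n (versK κ) :=
  contDiff_const.mul (((contDiff_snK κ).comp (contDiff_id.div_const 2)).pow 2)

theorem snK_pos {κ r : ℝ} (hr : r ∈ radii κ) : 0 < snK κ r := by
  rcases trig_cases κ with ⟨w, h0, hk, h, h1⟩ | rfl | ⟨w, h0, hk, h, h1⟩
  · rw [snK_of_pos h, h1]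
    simp only [radii, h, if_true, mem_Ioo, h1] at hr
    refine div_pos (Real.sin_pos_of_pos_of_lt_pi (mul_pos h0 hr.1) ?_) h0
    have := (lt_div_iff₀ h0).1 hr.2
    linarith [mul_comm r w]
  · rw [snK_zero]; simpa [radii] using hr
  · rw [snK_of_neg h, h1]
    simp only [radii, h.not_gt, if_false, mem_Ioi] at hr
    exact div_pos (Real.sinh_pos_iff.2 (mul_pos h0 hr)) h0

theorem radii_pos {κ r : ℝ} (hr : r ∈ radii κ) : 0 < r := by
  unfold radii at hr; split_ifs at hr
  · exact hr.1
  · exact hr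

theorem ordConnected_radii (κ : ℝ) : (radii κ).OrdConnected := by
  unfold radii; split_ifs
  · exact ordConnected_Ioo
  · exact ordConnected_Ioi

/-- The values of `versK κ` on `radii κ`. -/
def versRange (κ : ℝ) : Set ℝ := {y | 0 < y ∧ 0 < 2 - κ * y}

theorem versK_mem {κ r : ℝ} (hr : r ∈ radii κ) : versK κ r ∈ versRange κ := by
  have h1 := snK_sq κ r
  have h2 : 0 < snK κ r ^ 2 := pow_pos (snK_pos hr) 2
  have h3 : 0 ≤ versK κ r := by unfold versK; positivity
  rw [h1] at h2
  have h4 : 0 < versK κ r := h3.lt_of_ne (by rintro h; rw [← h] at h2; simp at h2)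
  exact ⟨h4, (pos_iff_pos_of_mul_pos h2).1 h4⟩

theorem strictMonoOn_versK (κ : ℝ) : StrictMonoOn (versK κ) (radii κ) := by
  refine strictMonoOn_of_deriv_pos (ordConnected_radii κ).convex
    (contDiff_versK κ (n := 1)).continuous.continuousOn fun x hx => ?_
  rw [(hasDerivAt_versK κ x).deriv]
  exact snK_pos (interior_subset hx)

/-- The inverse function of `versK κ`. -/
noncomputable def arcversK (κ y : ℝ) : ℝ :=
  if 0 < κ then 2 * arcsin (√κ * √(y / 2)) / √κ
  else if κ = 0 then 2 * √(y / 2) else 2 * arsinh (√(-κ) * √(y / 2)) / √(-κ)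

theorem arcversK_zero (κ : ℝ) : arcversK κ 0 = 0 := by
  unfold arcversK; split_ifs <;> simp

/-- The totalized `√` and `arcsin` are continuous on all of `ℝ`, so no restriction to `versRange κ`
is needed. In particular continuity holds at `0`, where differentiability fails; this carries the
sphere type profiles up to the axis. -/
theorem continuous_arcversK (κ : ℝ) : Continuous (arcversK κ) := by
  unfold arcversK
  split_ifs
  · fun_prop
  · fun_prop
  · exact (continuous_const.mul (Real.continuous_arsinh.comp (by fun_prop))).div_const _

theorem arcversK_aux {κ w y : ℝ} (h0 : 0 < w) (hk : κ = w ^ 2) (hy : y ∈ versRange κ) :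
    0 < w * √(y / 2) ∧ w * √(y / 2) < 1 := by
  have h1 := hy.1
  have h2 := hy.2
  refine ⟨by positivity, ?_⟩
  have : (w * √(y / 2)) ^ 2 < 1 := by
    rw [mul_pow, Real.sq_sqrt (by positivity), ← hk]; linarith
  exact (sq_lt_one_iff₀ (by positivity)).1 this

theorem arcversK_mem {κ y : ℝ} (hy : y ∈ versRange κ) : arcversK κ y ∈ radii κ := by
  have hy0 := hy.1
  rcases trig_cases κ with ⟨w, h0, hk, h, h1⟩ | rfl | ⟨w, h0, hk, h, h1⟩
  · obtain ⟨ha, hb⟩ := arcversK_aux h0 hk hy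
    simp only [arcversK, radii, h, if_true, h1, mem_Ioo]
    refine ⟨div_pos (mul_pos two_pos (Real.arcsin_pos.2 ha)) h0, ?_⟩
    have := Real.arcsin_lt_pi_div_two.2 hb
    exact div_lt_div_of_pos_right (by linarith) h0
  · simp only [arcversK, radii, lt_irrefl, if_false, if_true, mem_Ioi]; positivity
  · simp only [arcversK, radii, h.not_gt, if_false, h.ne, mem_Ioi, h1]
    exact div_pos (mul_pos two_pos (Real.arsinh_pos_iff.2 (by positivity))) h0

theorem versK_arcversK {κ y : ℝ} (hy : y ∈ versRange κ) : versK κ (arcversK κ y) = y := by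
  have hy0 := hy.1
  have hs : √(y / 2) ^ 2 = y / 2 := Real.sq_sqrt (by positivity)
  suffices snK κ (arcversK κ y / 2) = √(y / 2) by rw [versK, this, hs]; ring
  rcases trig_cases κ with ⟨w, h0, hk, h, h1⟩ | rfl | ⟨w, h0, hk, h, h1⟩
  · obtain ⟨ha, hb⟩ := arcversK_aux h0 hk hy
    rw [snK_of_pos h]
    simp only [arcversK, h, if_true, h1]
    rw [show w * (2 * arcsin (w * √(y / 2)) / w / 2) = arcsin (w * √(y / 2)) by field_simp,
      Real.sin_arcsin (by linarith) hb.le]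
    field_simp
  · simp [arcversK, snK_zero]
  · rw [snK_of_neg h]
    simp only [arcversK, h.not_gt, if_false, h.ne, h1]
    rw [show w * (2 * arsinh (w * √(y / 2)) / w / 2) = arsinh (w * √(y / 2)) by field_simp,
      Real.sinh_arsinh]
    field_simp

theorem arcversK_versK {κ r : ℝ} (hr : r ∈ radii κ) : arcversK κ (versK κ r) = r :=
  (strictMonoOn_versK κ).injOn (arcversK_mem (versK_mem hr)) hr (versK_arcversK (versK_mem hr))

theorem contDiffAt_arcversK {κ y : ℝ} (hy : y ∈ versRange κ) {n : WithTop ℕ∞} :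
    ContDiffAt ℝ n (arcversK κ) y := by
  have hy0 := hy.1
  have hq : ContDiffAt ℝ n (fun y : ℝ => √(y / 2)) y :=
    (contDiffAt_id.div_const 2).sqrt (by simp only [id]; positivity)
  rcases trig_cases κ with ⟨w, h0, hk, h, h1⟩ | rfl | ⟨w, h0, hk, h, h1⟩
  · obtain ⟨ha, hb⟩ := arcversK_aux h0 hk hy
    have : arcversK κ = fun y => 2 * arcsin (w * √(y / 2)) / w := by
      funext y; simp [arcversK, h, h1]
    rw [this]
    have h3 : ContDiffAt ℝ n arcsin (w * √(y / 2)) :=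
      Real.contDiffAt_arcsin (by linarith) hb.ne
    exact (contDiffAt_const.mul
      (ContDiffAt.comp y (f := fun y : ℝ => w * √(y / 2)) h3 (contDiffAt_const.mul hq))).div_const _
  · have : arcversK 0 = fun y => 2 * √(y / 2) := by funext y; simp [arcversK]
    rw [this]; exact contDiffAt_const.mul hq
  · have : arcversK κ = fun y => 2 * arsinh (w * √(y / 2)) / w := by
      funext y; simp [arcversK, h.not_gt, h.ne, h1]
    rw [this]
    exact (contDiffAt_const.mul
      (ContDiffAt.comp y (f := fun y : ℝ => w * √(y / 2)) Real.contDiff_arsinh.contDiffAt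
        (contDiffAt_const.mul hq))).div_const _

theorem hasDerivAt_arcversK {κ y : ℝ} (hy : y ∈ versRange κ) :
    HasDerivAt (arcversK κ) (snK κ (arcversK κ y))⁻¹ y := by
  have hopen : ∀ᶠ z in 𝓝 y, versK κ (arcversK κ z) = z := by
    have h1 : ∀ᶠ z in 𝓝 y, 0 < z := lt_mem_nhds hy.1
    have h2 : ∀ᶠ z in 𝓝 y, 0 < 2 - κ * z :=
      ((by fun_prop : Continuous fun z : ℝ => 2 - κ * z).tendsto y).eventually (lt_mem_nhds hy.2)
    filter_upwards [h1, h2] with z a b using versK_arcversK ⟨a, b⟩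
  exact HasDerivAt.of_local_left_inverse (continuous_arcversK κ).continuousAt
    (hasDerivAt_versK κ _) (snK_pos (arcversK_mem hy)).ne' hopen

/-- In the versed radius the cases `κ = 0` and `κ ≠ 0` of the energy merge into `Z - 2Hy`. -/
theorem energy_eq_versK (κ H r σ : ℝ) :
    energy κ H r σ = -(2 * H * versK κ r) + snK κ r * sin σ := by
  unfold energy
  split_ifs with h
  · subst h; simp only [versK, snK_zero]; ring
  · rw [csK_eq]; field_simp; ring

/-! ### The exchange of the two axes -/

theorem versK_swap {κ : ℝ} (h : 0 < κ) (r : ℝ) : versK κ (π / √κ - r) = 2 / κ - versK κ r := by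
  have h1 := csK_eq κ (π / √κ - r)
  have h2 := csK_eq κ r
  have h3 : csK κ (π / √κ - r) = - csK κ r := by
    have : √κ ≠ 0 := (Real.sqrt_pos.2 h).ne'
    rw [csK_of_pos h]; simp only []
    rw [mul_sub, mul_div_cancel₀ _ this, Real.cos_pi_sub]
  rw [h3, h2] at h1
  rw [eq_sub_iff_add_eq, eq_div_iff h.ne']
  linarith

theorem swap_mem {κ r : ℝ} (h : 0 < κ) (hr : r ∈ radii κ) : π / √κ - r ∈ radii κ := by
  simp only [radii, h, if_true, mem_Ioo] at hr ⊢
  constructor <;> linarith [hr.1, hr.2]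

theorem snK_eq_sqrt {κ r : ℝ} (hr : r ∈ radii κ) :
    snK κ r = √(versK κ r * (2 - κ * versK κ r)) := by
  rw [← snK_sq, Real.sqrt_sq (snK_pos hr).le]

/-- Inserting `cs = 2H sn` into `cs² + κ sn² = 1` determines `sn > 0` and hence `cs > 0`; then `sn²
= y(1 + cs)` determines the versed radius. -/
theorem ctK_eq_two_mul_unique {κ H r₀ x : ℝ} (hr₀ : r₀ ∈ radii κ) (hx : x ∈ radii κ)
    (hH : 0 < H) (h₀ : ctK κ r₀ = 2 * H) (h : ctK κ x = 2 * H) : x = r₀ := by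
  have key : ∀ y ∈ radii κ, ctK κ y = 2 * H →
      csK κ y = 2 * H * snK κ y ∧ snK κ y ^ 2 * (4 * H ^ 2 + κ) = 1 := by
    intro y hy h
    have hp := snK_pos hy
    have h1 : csK κ y = 2 * H * snK κ y := by
      rw [ctK, div_eq_iff hp.ne'] at h; exact h
    have := csK_sq κ y
    rw [h1] at this
    exact ⟨h1, by linarith⟩
  obtain ⟨a1, a2⟩ := key _ hr₀ h₀
  obtain ⟨b1, b2⟩ := key _ hx h
  have hp := snK_pos hr₀
  have hq := snK_pos hx
  have hne : 4 * H ^ 2 + κ ≠ 0 := by rintro h; rw [h] at a2; simp at a2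
  have hs : snK κ x = snK κ r₀ := by
    have : snK κ x ^ 2 = snK κ r₀ ^ 2 := mul_right_cancel₀ hne (b2.trans a2.symm)
    exact (sq_eq_sq₀ hq.le hp.le).1 this
  refine (strictMonoOn_versK κ).injOn hx hr₀ ?_
  have c1 := snK_sq κ x
  have c2 := snK_sq κ r₀
  have d1 := csK_eq κ x
  have d2 := csK_eq κ r₀
  have e : csK κ x = csK κ r₀ := by rw [a1, b1, hs]
  have f : 0 < csK κ r₀ := by rw [a1]; positivity
  have g1 : snK κ r₀ ^ 2 = versK κ x * (1 + csK κ r₀) := by rw [← hs, c1, ← e, d1]; ring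
  have g2 : snK κ r₀ ^ 2 = versK κ r₀ * (1 + csK κ r₀) := by rw [c2, d2]; ring
  have h1 : 1 + csK κ r₀ ≠ 0 := by positivity
  exact mul_right_cancel₀ h1 (g1.symm.trans g2)

/-! ### Primitives on open intervals and parametric primitives -/

theorem eq_of_hasDerivAt_zero {U : Set ℝ} (hc : U.OrdConnected) {f : ℝ → ℝ}
    (hf : ∀ t ∈ U, HasDerivAt f 0 t) {s t : ℝ} (hs : s ∈ U) (ht : t ∈ U) : f s = f t := by
  have := hc.convex.norm_image_sub_le_of_norm_hasDerivWithin_le (C := 0)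
    (fun x hx => (hf x hx).hasDerivWithinAt) (by simp) ht hs
  rw [zero_mul] at this
  exact sub_eq_zero.1 (norm_le_zero_iff.1 this)

theorem intervalIntegrable_of_mem {U : Set ℝ} (hc : U.OrdConnected) {f : ℝ → ℝ}
    (hf : ContinuousOn f U) {s t : ℝ} (hs : s ∈ U) (ht : t ∈ U) :
    IntervalIntegrable f MeasureTheory.volume s t :=
  (hf.mono (hc.uIcc_subset hs ht)).intervalIntegrable

theorem hasDerivAt_primitive {U : Set ℝ} (hU : IsOpen U) (hc : U.OrdConnected) {f : ℝ → ℝ}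
    (hf : ContinuousOn f U) {s t : ℝ} (hs : s ∈ U) (ht : t ∈ U) :
    HasDerivAt (fun t => ∫ x in s..t, f x) (f t) t :=
  intervalIntegral.integral_hasDerivAt_right (intervalIntegrable_of_mem hc hf hs ht)
    (hf.stronglyMeasurableAtFilter hU t ht) (hf.continuousAt (hU.mem_nhds ht))

theorem contDiffOn_primitive {U : Set ℝ} (hU : IsOpen U) (hc : U.OrdConnected) {f : ℝ → ℝ}
    (hf : ContDiffOn ℝ ∞ f U) {s : ℝ} (hs : s ∈ U) :
    ContDiffOn ℝ ∞ (fun t => ∫ x in s..t, f x) U := by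
  have h := fun t ht => hasDerivAt_primitive hU hc hf.continuousOn hs (t := t) ht
  rw [contDiffOn_infty_iff_deriv_of_isOpen hU]
  exact ⟨fun t ht => (h t ht).differentiableAt.differentiableWithinAt,
    hf.congr fun t ht => (h t ht).deriv⟩

/-- The denominator may vanish elsewhere, as it does outside the domain at energy zero. By the tube
lemma it exceeds some `ε > 0` near the compact segment of integration, so locally `D` can be
replaced by `max ε D`, for which the integrand is continuous everywhere. -/
theorem continuousAt_parametric_primitive {N D : ℝ → ℝ → ℝ} (hN : Continuous N.uncurry)
    (hD : Continuous D.uncurry) {J₀ t₀ : ℝ} (hpos : ∀ s ∈ uIcc 0 t₀, 0 < D J₀ s) :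
    ContinuousAt (fun x : ℝ × ℝ => ∫ s in (0 : ℝ)..x.2, N x.1 s / D x.1 s) (J₀, t₀) := by
  obtain ⟨m, hm, hmin⟩ := isCompact_uIcc.exists_isMinOn (nonempty_uIcc (a := (0 : ℝ)) (b := t₀))
    (hD.comp (Continuous.prodMk_right J₀)).continuousOn
  set ε := D J₀ m / 2 with hε
  have hε0 : 0 < ε := half_pos (hpos m hm)
  have hopen : IsOpen {x : ℝ × ℝ | ε < D.uncurry x} := isOpen_lt continuous_const hD
  obtain ⟨u, v, hu, hv, hJu, htv, huv⟩ := generalized_tube_lemma (isCompact_singleton (x := J₀))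
    (isCompact_uIcc (a := (0 : ℝ)) (b := t₀)) hopen (by
      rintro ⟨J, s⟩ ⟨hJ, hs⟩
      obtain rfl : J = J₀ := hJ
      have : D J m ≤ D J s := hmin hs
      show ε < D J s
      linarith)
  have hcont : Continuous
      (fun x : ℝ × ℝ => ∫ s in (0 : ℝ)..x.2, N x.1 s / max ε (D x.1 s)) := by
    refine intervalIntegral.continuous_parametric_primitive_of_continuous
      (f := fun J s => N J s / max ε (D J s)) (hN.div (continuous_const.max hD) fun x => ?_)
    exact (hε0.trans_le (le_max_left _ _)).ne'
  refine hcont.continuousAt.congr ?_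
  obtain ⟨δ, hδ, hball⟩ := Metric.isOpen_iff.1 hv t₀ (htv right_mem_uIcc)
  filter_upwards [prod_mem_nhds (hu.mem_nhds (hJu rfl)) (Metric.ball_mem_nhds t₀ hδ)]
  rintro ⟨J, t⟩ ⟨hJ, ht⟩
  refine intervalIntegral.integral_congr fun s hs => ?_
  have hsv : s ∈ v := by
    rcases uIcc_subset_uIcc_union_uIcc (b := t₀) hs with h | h
    · exact htv h
    · refine hball ?_
      rw [Metric.mem_ball, Real.dist_eq]
      rw [Metric.mem_ball, Real.dist_eq] at ht
      exact (abs_sub_left_of_mem_uIcc h).trans_lt ht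
  have : ε < D J s := huv (mk_mem_prod hJ hsv)
  simp only [max_eq_right this.le]

theorem hasDerivAt_div_sqrt {A D : ℝ → ℝ} {A' g t : ℝ} (hD : HasDerivAt D (2 * g) t)
    (hpos : 0 < D t) (hA : HasDerivAt A A' t) (h : A' * D t = A t * g) :
    HasDerivAt (fun t => A t / √(D t)) 0 t := by
  have hs := Real.sqrt_pos.2 hpos
  refine (hA.div (hD.sqrt hpos.ne') hs.ne').congr_deriv ?_
  have h2 : √(D t) ^ 2 = D t := Real.sq_sqrt hpos.le
  rw [div_eq_zero_iff]; left
  refine mul_right_cancel₀ hs.ne' ?_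
  field_simp
  rw [h2]; linarith

/-! ### The explicit solution of the reduced equations -/

/-- The frequency of the solutions. -/
noncomputable def freq (κ H : ℝ) : ℝ := √(4 * H ^ 2 + κ)

/-- The mean value of the versed radius. -/
noncomputable def versMean (κ H J : ℝ) : ℝ := (1 - 2 * H * J) / (4 * H ^ 2 + κ)

/-- The amplitude of the versed radius. -/
noncomputable def versAmp (κ H J : ℝ) : ℝ :=
  √((1 - 2 * H * J) ^ 2 - (4 * H ^ 2 + κ) * J ^ 2) / (4 * H ^ 2 + κ)

/-- The versed radius as a function of arc length. -/
noncomputable def versSol (κ H J t : ℝ) : ℝ :=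
  versMean κ H J + versAmp κ H J * cos (freq κ H * t)

/-- The derivative of `versSol`. -/
noncomputable def versSol' (κ H J t : ℝ) : ℝ :=
  -(versAmp κ H J * freq κ H * sin (freq κ H * t))

/-- The square of `sn r` along the solution. -/
noncomputable def snSq (κ H J t : ℝ) : ℝ := versSol κ H J t * (2 - κ * versSol κ H J t)

/-- The height momentum `sn r sin σ` along the solution. -/
noncomputable def momentum (κ H J t : ℝ) : ℝ := J + 2 * H * versSol κ H J t

/-- The domain of the solution of energy `J`. -/
def solDom (κ H J : ℝ) : Set ℝ :=
  if J = 0 then Ioo (-(π / freq κ H)) (π / freq κ H) else univ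

/-- Numerator of the derivative of the angle. -/
noncomputable def angleNum (κ H J t : ℝ) : ℝ := (2 * H + κ * J) * versSol κ H J t - J

/-- Numerator of the derivative of the height. -/
noncomputable def heightNum (κ τ a H J t : ℝ) : ℝ :=
  √(snSq κ H J t + (2 * τ * versSol κ H J t - a) ^ 2) * momentum κ H J t

/-- The profile curve of pitch `a` and energy `J`. -/
noncomputable def family (κ τ H a J : ℝ) : ProfileCurve where
  dom := solDom κ H J
  r t := arcversK κ (versSol κ H J t)
  h t := ∫ s in (0 : ℝ)..t, heightNum κ τ a H J s / snSq κ H J s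
  -- At parameter `0` the derivative of the versed radius vanishes and `momentum` is positive, so
  -- the tangent points upwards: the initial angle is `π / 2`.
  σ t := π / 2 + ∫ s in (0 : ℝ)..t, angleNum κ H J s / snSq κ H J s

/-! ### Admissible energies, amplitude and regularity of the explicit solution. -/

theorem freq_pos {κ H : ℝ} (hs : 0 < 4 * H ^ 2 + κ) : 0 < freq κ H := Real.sqrt_pos.2 hs

theorem freq_sq {κ H : ℝ} (hs : 0 < 4 * H ^ 2 + κ) : freq κ H ^ 2 = 4 * H ^ 2 + κ :=
  Real.sq_sqrt hs.le

/-- Rationalizing with `κ = (ω - 2H)(ω + 2H)`, `ω = freq κ H`, removes the case distinction at `κ =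
0`. -/
theorem Jmax_eq {κ H : ℝ} (hH : 0 < H) (hs : 0 < 4 * H ^ 2 + κ) :
    Jmax κ H = 1 / (freq κ H + 2 * H) := by
  have h0 := freq_pos hs
  unfold Jmax
  split_ifs with h
  · subst h
    have : freq 0 H = 2 * H := by
      rw [freq, add_zero, show 4 * H ^ 2 = (2 * H) ^ 2 by ring, Real.sqrt_sq (by positivity)]
    rw [this]; ring
  · change (freq κ H - 2 * H) / κ = _
    rw [div_eq_div_iff h (by positivity)]
    linear_combination freq_sq hs

theorem Jmax_pos {κ H : ℝ} (hH : 0 < H) (hs : 0 < 4 * H ^ 2 + κ) : 0 < Jmax κ H := by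
  have := freq_pos hs
  rw [Jmax_eq hH hs]; positivity

/-- A description uniform in `κ`. For `κ ≤ 0` the second inequality is automatic, because `κJ ≥ κ
Jmax = ω - 2H`. -/
theorem mem_energyRange_iff {κ H J : ℝ} (hH : 0 < H) (hs : 0 < 4 * H ^ 2 + κ) :
    J ∈ energyRange κ H ↔ J ≤ Jmax κ H ∧ 0 ≤ 2 * H + κ * J := by
  have hJ := Jmax_pos hH hs
  unfold energyRange
  split_ifs with h
  · rw [mem_Icc, and_comm, ← neg_div, div_le_iff₀ h]
    constructor <;> rintro ⟨a, b⟩ <;> exact ⟨a, by linarith [mul_comm κ J]⟩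
  · refine ⟨fun h1 => ⟨h1, ?_⟩, fun h1 => h1.1⟩
    have h1 : J ≤ Jmax κ H := h1
    have h2 : κ * Jmax κ H ≤ κ * J := mul_le_mul_of_nonpos_left h1 (not_lt.1 h)
    have h0 := freq_pos hs
    have h3 : κ * Jmax κ H = freq κ H - 2 * H := by
      rw [Jmax_eq hH hs, mul_one_div, div_eq_iff (by positivity)]
      linear_combination -freq_sq hs
    linarith

theorem freq_mul_le {κ H J : ℝ} (hH : 0 < H) (hs : 0 < 4 * H ^ 2 + κ) (hJ : J ≤ Jmax κ H) :
    freq κ H * J ≤ 1 - 2 * H * J := by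
  have h0 := freq_pos hs
  rw [Jmax_eq hH hs, le_div_iff₀ (by positivity)] at hJ
  linarith

theorem freq_mul_lt {κ H J : ℝ} (hH : 0 < H) (hs : 0 < 4 * H ^ 2 + κ) (hJ : J < Jmax κ H) :
    freq κ H * J < 1 - 2 * H * J := by
  have h0 := freq_pos hs
  rw [Jmax_eq hH hs, lt_div_iff₀ (by positivity)] at hJ
  linarith

/-- This and `freq_mul_le` give the signs of the two factors of the discriminant `(1 - 2HJ)² -
ω²J²`. Here `(1 + J(ω - 2H))(ω + 2H) = ω + (2H + κJ)` is positive. -/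
theorem neg_freq_mul_lt {κ H J : ℝ} (hH : 0 < H) (hs : 0 < 4 * H ^ 2 + κ)
    (hJ : J ∈ energyRange κ H) : -(freq κ H * J) < 1 - 2 * H * J := by
  have h0 := freq_pos hs
  have hJ' := (mem_energyRange_iff hH hs).1 hJ
  have h3 : κ = (freq κ H - 2 * H) * (freq κ H + 2 * H) := by linear_combination -freq_sq hs
  have h4 := hJ'.2
  rw [h3] at h4
  have h5 : 0 < (1 + J * (freq κ H - 2 * H)) * (freq κ H + 2 * H) := by linarith
  linarith [pos_of_mul_pos_left h5 (by positivity)]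

theorem discr_nonneg {κ H J : ℝ} (hH : 0 < H) (hs : 0 < 4 * H ^ 2 + κ)
    (hJ : J ∈ energyRange κ H) : 0 ≤ (1 - 2 * H * J) ^ 2 - (4 * H ^ 2 + κ) * J ^ 2 := by
  have h1 := freq_mul_le hH hs ((mem_energyRange_iff hH hs).1 hJ).1
  have h2 := neg_freq_mul_lt hH hs hJ
  have := mul_nonneg (sub_nonneg.2 h1) (sub_nonneg.2 h2.le)
  rw [← freq_sq hs]; linarith

theorem versAmp_nonneg {κ H J : ℝ} (hs : 0 < 4 * H ^ 2 + κ) : 0 ≤ versAmp κ H J := by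
  unfold versAmp; positivity

theorem versAmp_pos {κ H J : ℝ} (hH : 0 < H) (hs : 0 < 4 * H ^ 2 + κ)
    (hJ : J ∈ energyRange κ H) (hJm : J < Jmax κ H) : 0 < versAmp κ H J := by
  have h1 := freq_mul_lt hH hs hJm
  have h2 := neg_freq_mul_lt hH hs hJ
  have := mul_pos (sub_pos.2 h1) (sub_pos.2 h2)
  refine div_pos (Real.sqrt_pos.2 ?_) hs
  rw [← freq_sq hs]; linarith

theorem versAmp_Jmax {κ H : ℝ} (hH : 0 < H) (hs : 0 < 4 * H ^ 2 + κ) :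
    versAmp κ H (Jmax κ H) = 0 := by
  have h0 := freq_pos hs
  have h1 : 1 - 2 * H * Jmax κ H = freq κ H * Jmax κ H := by
    rw [Jmax_eq hH hs]; field_simp; ring
  rw [versAmp, h1, mul_pow, freq_sq hs]; simp

theorem versAmp_sq {κ H J : ℝ} (hH : 0 < H) (hs : 0 < 4 * H ^ 2 + κ)
    (hJ : J ∈ energyRange κ H) :
    versAmp κ H J ^ 2 * (4 * H ^ 2 + κ) ^ 2
      = (1 - 2 * H * J) ^ 2 - (4 * H ^ 2 + κ) * J ^ 2 := by
  rw [versAmp, div_pow, Real.sq_sqrt (discr_nonneg hH hs hJ), div_mul_cancel₀ _ (by positivity)]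

theorem versMean_mul {κ H J : ℝ} (hs : 0 < 4 * H ^ 2 + κ) :
    versMean κ H J * (4 * H ^ 2 + κ) = 1 - 2 * H * J := by
  rw [versMean, div_mul_cancel₀ _ hs.ne']

theorem versMean_pos {κ H J : ℝ} (hH : 0 < H) (hs : 0 < 4 * H ^ 2 + κ)
    (hJ : J ∈ energyRange κ H) : 0 < versMean κ H J := by
  have h1 := freq_mul_le hH hs ((mem_energyRange_iff hH hs).1 hJ).1
  have h2 := neg_freq_mul_lt hH hs hJ
  exact div_pos (by linarith) hs

theorem versAmp_le_versMean {κ H J : ℝ} (hH : 0 < H) (hs : 0 < 4 * H ^ 2 + κ)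
    (hJ : J ∈ energyRange κ H) : versAmp κ H J ≤ versMean κ H J := by
  refine div_le_div_of_nonneg_right (Real.sqrt_le_iff.2 ⟨?_, ?_⟩) hs.le
  · have := versMean_pos hH hs hJ
    have := versMean_mul (J := J) hs
    rw [← this]; positivity
  · have : 0 ≤ (4 * H ^ 2 + κ) * J ^ 2 := by positivity
    linarith

/-- The constraint `X² + Z² = sn²`, which expresses unit speed. The amplitude is chosen to satisfy
it, namely `A²ω² = M²ω² - J²`. -/
theorem snSq_eq {κ H J : ℝ} (hH : 0 < H) (hs : 0 < 4 * H ^ 2 + κ)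
    (hJ : J ∈ energyRange κ H) (t : ℝ) :
    snSq κ H J t = versSol' κ H J t ^ 2 + momentum κ H J t ^ 2 := by
  have h1 := versAmp_sq hH hs hJ
  have h2 := versMean_mul (J := J) hs
  have h3 := freq_sq hs
  have h4 := Real.sin_sq (freq κ H * t)
  simp only [snSq, versSol', momentum, versSol, neg_sq, mul_pow, h3, h4]
  set c := cos (freq κ H * t)
  set m := versMean κ H J
  set A := versAmp κ H J
  have h5 : A ^ 2 * (4 * H ^ 2 + κ) = m ^ 2 * (4 * H ^ 2 + κ) - J ^ 2 := by
    refine mul_right_cancel₀ hs.ne' ?_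
    linear_combination h1 - (m * (4 * H ^ 2 + κ) + 1 - 2 * H * J) * h2
  linear_combination (-1) * h5 - 2 * (m + A * c) * h2

theorem continuous_versSol (κ H : ℝ) : Continuous (versSol κ H).uncurry := by
  unfold Function.uncurry versSol versMean versAmp; fun_prop

theorem continuous_snSq (κ H : ℝ) : Continuous (snSq κ H).uncurry := by
  have := continuous_versSol κ H
  exact this.mul (continuous_const.sub (continuous_const.mul this))

theorem contDiff_versSol (κ H J : ℝ) {n : WithTop ℕ∞} : ContDiff ℝ n (versSol κ H J) := by
  unfold versSol; fun_prop

theorem contDiff_snSq (κ H J : ℝ) {n : WithTop ℕ∞} : ContDiff ℝ n (snSq κ H J) :=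
  (contDiff_versSol κ H J).mul (contDiff_const.sub (contDiff_const.mul (contDiff_versSol κ H J)))

theorem contDiff_momentum (κ H J : ℝ) {n : WithTop ℕ∞} : ContDiff ℝ n (momentum κ H J) :=
  contDiff_const.add (contDiff_const.mul (contDiff_versSol κ H J))

theorem hasDerivAt_versSol (κ H J t : ℝ) :
    HasDerivAt (versSol κ H J) (versSol' κ H J t) t := by
  have h := ((((hasDerivAt_id t).const_mul (freq κ H)).cos).const_mul (versAmp κ H J)).const_add
    (versMean κ H J)
  exact h.congr_deriv (by simp only [versSol', id]; ring)

/-- The oscillator equation, written with `momentum` so that it is the equation for `X` in the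
reduced system. -/
theorem hasDerivAt_versSol' {κ H : ℝ} (hs : 0 < 4 * H ^ 2 + κ) (J t : ℝ) :
    HasDerivAt (versSol' κ H J) (1 - κ * versSol κ H J t - 2 * H * momentum κ H J t) t := by
  have h := ((((hasDerivAt_id t).const_mul (freq κ H)).sin).const_mul
    (versAmp κ H J * freq κ H)).neg
  refine h.congr_deriv ?_
  have h2 := versMean_mul (J := J) hs
  have h3 := freq_sq hs
  simp only [momentum, versSol, id]
  linear_combination h2 - versAmp κ H J * cos (freq κ H * t) * h3

theorem hasDerivAt_momentum (κ H J t : ℝ) :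
    HasDerivAt (momentum κ H J) (2 * H * versSol' κ H J t) t :=
  ((hasDerivAt_versSol κ H J t).const_mul (2 * H)).const_add J

theorem hasDerivAt_snSq (κ H J t : ℝ) :
    HasDerivAt (snSq κ H J) (2 * ((1 - κ * versSol κ H J t) * versSol' κ H J t)) t := by
  have h := hasDerivAt_versSol κ H J t
  exact (h.mul ((h.const_mul κ).const_sub 2)).congr_deriv (by ring)

/-! ### The domain -/

theorem isOpen_solDom (κ H J : ℝ) : IsOpen (solDom κ H J) := by
  unfold solDom; split_ifs
  · exact isOpen_Ioo
  · exact isOpen_univ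

theorem ordConnected_solDom (κ H J : ℝ) : (solDom κ H J).OrdConnected := by
  unfold solDom; split_ifs
  · exact ordConnected_Ioo
  · exact ordConnected_univ

theorem zero_mem_solDom {κ H : ℝ} (hs : 0 < 4 * H ^ 2 + κ) (J : ℝ) : 0 ∈ solDom κ H J := by
  have := div_pos Real.pi_pos (freq_pos hs)
  unfold solDom; split_ifs
  · exact ⟨by linarith, this⟩
  · trivial

theorem solDom_of_ne {κ H J : ℝ} (hJ : J ≠ 0) : solDom κ H J = univ := by simp [solDom, hJ]

theorem versSol_nonneg {κ H J : ℝ} (hH : 0 < H) (hs : 0 < 4 * H ^ 2 + κ)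
    (hJ : J ∈ energyRange κ H) (t : ℝ) : 0 ≤ versSol κ H J t := by
  have h1 := versAmp_le_versMean hH hs hJ
  have h2 := versAmp_nonneg (J := J) hs
  have h3 := Real.neg_one_le_cos (freq κ H * t)
  unfold versSol
  nlinarith

theorem versMean_zero (κ H : ℝ) : versMean κ H 0 = 1 / (4 * H ^ 2 + κ) := by simp [versMean]

theorem versAmp_zero (κ H : ℝ) : versAmp κ H 0 = 1 / (4 * H ^ 2 + κ) := by simp [versAmp]

theorem zero_mem_energyRange {κ H : ℝ} (hH : 0 < H) (hs : 0 < 4 * H ^ 2 + κ) :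
    0 ∈ energyRange κ H :=
  (mem_energyRange_iff hH hs).2 ⟨(Jmax_pos hH hs).le, by simp; positivity⟩

theorem Jmax_mem_energyRange {κ H : ℝ} (hH : 0 < H) (hs : 0 < 4 * H ^ 2 + κ) :
    Jmax κ H ∈ energyRange κ H := by
  refine (mem_energyRange_iff hH hs).2 ⟨le_rfl, ?_⟩
  have h0 := freq_pos hs
  have h3 : κ * Jmax κ H = freq κ H - 2 * H := by
    rw [Jmax_eq hH hs, mul_one_div, div_eq_iff (by positivity)]
    linear_combination -freq_sq hs
  linarith

/-- The solution misses the second axis. If `κy = 2`, then `sn = 0` and the constraint gives `Z =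
0`, whereas `κZ = κJ + 4H ≥ 2H > 0`. -/
theorem two_sub_versSol_pos {κ H J : ℝ} (hH : 0 < H) (hs : 0 < 4 * H ^ 2 + κ)
    (hJ : J ∈ energyRange κ H) (t : ℝ) : 0 < 2 - κ * versSol κ H J t := by
  have h0 := versSol_nonneg hH hs hJ t
  rcases h0.eq_or_lt with h | h
  · rw [← h]; norm_num
  have h1 := snSq_eq hH hs hJ t
  rw [snSq] at h1
  have h2 : 0 ≤ 2 - κ * versSol κ H J t :=
    nonneg_of_mul_nonneg_right (h1 ▸ by positivity) h
  refine h2.lt_of_ne fun h3 => ?_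
  rw [← h3, mul_zero] at h1
  have h4 : momentum κ H J t = 0 := by
    have : momentum κ H J t ^ 2 = 0 := by nlinarith [sq_nonneg (versSol' κ H J t)]
    exact pow_eq_zero_iff (two_ne_zero) |>.1 this
  have h5 := ((mem_energyRange_iff hH hs).1 hJ).2
  have h6 : κ * momentum κ H J t = 0 := by rw [h4, mul_zero]
  rw [momentum] at h6
  nlinarith

/-- On the axis `Z = J` and `sn = 0`, so the constraint leaves only `J = 0`. There `y = (2/ω²)
cos²(ωt/2)`, which is positive on the chosen domain. -/
theorem versSol_pos {κ H J : ℝ} (hH : 0 < H) (hs : 0 < 4 * H ^ 2 + κ)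
    (hJ : J ∈ energyRange κ H) {t : ℝ} (ht : t ∈ solDom κ H J) : 0 < versSol κ H J t := by
  refine (versSol_nonneg hH hs hJ t).lt_of_ne fun h => ?_
  have h1 := snSq_eq hH hs hJ t
  rw [snSq, ← h, zero_mul, momentum, ← h] at h1
  have hJ0 : J = 0 := by
    have : J ^ 2 = 0 := by nlinarith [sq_nonneg (versSol' κ H J t), sq_nonneg J]
    exact pow_eq_zero_iff (two_ne_zero) |>.1 this
  subst hJ0
  rw [solDom, if_pos rfl] at ht
  have hf := freq_pos hs
  have h2 : freq κ H * t = 2 * (freq κ H * t / 2) := by ring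
  have h3 : 0 < cos (freq κ H * t / 2) := by
    have h4 := (lt_div_iff₀ hf).1 ht.2
    have h5 := ht.1
    rw [← neg_div, div_lt_iff₀ hf] at h5
    exact Real.cos_pos_of_mem_Ioo ⟨by linarith [mul_comm t (freq κ H)],
      by linarith [mul_comm t (freq κ H)]⟩
  rw [versSol, versMean_zero, versAmp_zero, h2, Real.cos_two_mul] at h
  have h6 : 0 < 1 / (4 * H ^ 2 + κ) := by positivity
  have h7 : 0 < 1 / (4 * H ^ 2 + κ) * cos (freq κ H * t / 2) ^ 2 := by positivity
  linarith

theorem versSol_mem {κ H J : ℝ} (hH : 0 < H) (hs : 0 < 4 * H ^ 2 + κ)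
    (hJ : J ∈ energyRange κ H) {t : ℝ} (ht : t ∈ solDom κ H J) :
    versSol κ H J t ∈ versRange κ :=
  ⟨versSol_pos hH hs hJ ht, two_sub_versSol_pos hH hs hJ t⟩

theorem snSq_pos {κ H J : ℝ} (hH : 0 < H) (hs : 0 < 4 * H ^ 2 + κ)
    (hJ : J ∈ energyRange κ H) {t : ℝ} (ht : t ∈ solDom κ H J) : 0 < snSq κ H J t :=
  mul_pos (versSol_pos hH hs hJ ht) (two_sub_versSol_pos hH hs hJ t)

/-! ### The family -/

/-- The norm of the Killing field along the solution. -/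
noncomputable def killing (κ τ a H J t : ℝ) : ℝ :=
  √(snSq κ H J t + (2 * τ * versSol κ H J t - a) ^ 2)

section family

variable {κ H J : ℝ}

theorem family_r_mem (hH : 0 < H) (hs : 0 < 4 * H ^ 2 + κ) (hJ : J ∈ energyRange κ H)
    (τ a : ℝ) {t : ℝ} (ht : t ∈ solDom κ H J) : (family κ τ H a J).r t ∈ radii κ :=
  arcversK_mem (versSol_mem hH hs hJ ht)

theorem versK_family_r (hH : 0 < H) (hs : 0 < 4 * H ^ 2 + κ) (hJ : J ∈ energyRange κ H)
    (τ a : ℝ) {t : ℝ} (ht : t ∈ solDom κ H J) :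
    versK κ ((family κ τ H a J).r t) = versSol κ H J t :=
  versK_arcversK (versSol_mem hH hs hJ ht)

theorem snK_family_r (hH : 0 < H) (hs : 0 < 4 * H ^ 2 + κ) (hJ : J ∈ energyRange κ H)
    (τ a : ℝ) {t : ℝ} (ht : t ∈ solDom κ H J) :
    snK κ ((family κ τ H a J).r t) = √(snSq κ H J t) := by
  rw [snK_eq_sqrt (family_r_mem hH hs hJ τ a ht), versK_family_r hH hs hJ τ a ht]; rfl

theorem hasDerivAt_family_r (hH : 0 < H) (hs : 0 < 4 * H ^ 2 + κ) (hJ : J ∈ energyRange κ H)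
    (τ a : ℝ) {t : ℝ} (ht : t ∈ solDom κ H J) :
    HasDerivAt (family κ τ H a J).r (versSol' κ H J t / √(snSq κ H J t)) t := by
  have h := (hasDerivAt_arcversK (versSol_mem hH hs hJ ht)).comp t (hasDerivAt_versSol κ H J t)
  refine h.congr_deriv ?_
  rw [← snK_family_r hH hs hJ τ a ht, div_eq_inv_mul]; rfl

theorem contDiffOn_family_r (hH : 0 < H) (hs : 0 < 4 * H ^ 2 + κ) (hJ : J ∈ energyRange κ H)
    (τ a : ℝ) : ContDiffOn ℝ ∞ (family κ τ H a J).r (solDom κ H J) := fun t ht =>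
  (ContDiffAt.comp t (contDiffAt_arcversK (versSol_mem hH hs hJ ht))
    (contDiff_versSol κ H J).contDiffAt).contDiffWithinAt

theorem contDiffOn_angleRate (hH : 0 < H) (hs : 0 < 4 * H ^ 2 + κ) (hJ : J ∈ energyRange κ H) :
    ContDiffOn ℝ ∞ (fun t => angleNum κ H J t / snSq κ H J t) (solDom κ H J) :=
  ((contDiff_const.mul (contDiff_versSol κ H J)).sub contDiff_const).contDiffOn.div
    (contDiff_snSq κ H J).contDiffOn fun _ ht => (snSq_pos hH hs hJ ht).ne'

theorem contDiffOn_killing (hH : 0 < H) (hs : 0 < 4 * H ^ 2 + κ) (hJ : J ∈ energyRange κ H)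
    (τ a : ℝ) : ContDiffOn ℝ ∞ (killing κ τ a H J) (solDom κ H J) := by
  refine ContDiffOn.sqrt (f := fun t => snSq κ H J t + (2 * τ * versSol κ H J t - a) ^ 2)
    ((contDiff_snSq κ H J).add (((contDiff_const.mul (contDiff_versSol κ H J)).sub
    contDiff_const).pow 2)).contDiffOn fun t ht => ?_
  have := snSq_pos hH hs hJ ht
  positivity

theorem contDiffOn_heightRate (hH : 0 < H) (hs : 0 < 4 * H ^ 2 + κ) (hJ : J ∈ energyRange κ H)
    (τ a : ℝ) :
    ContDiffOn ℝ ∞ (fun t => heightNum κ τ a H J t / snSq κ H J t) (solDom κ H J) :=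
  ((contDiffOn_killing hH hs hJ τ a).mul (contDiff_momentum κ H J).contDiffOn).div
    (contDiff_snSq κ H J).contDiffOn fun _ ht => (snSq_pos hH hs hJ ht).ne'

theorem contDiffOn_family_h (hH : 0 < H) (hs : 0 < 4 * H ^ 2 + κ) (hJ : J ∈ energyRange κ H)
    (τ a : ℝ) : ContDiffOn ℝ ∞ (family κ τ H a J).h (solDom κ H J) :=
  contDiffOn_primitive (isOpen_solDom κ H J) (ordConnected_solDom κ H J)
    (contDiffOn_heightRate hH hs hJ τ a) (zero_mem_solDom hs J)

theorem contDiffOn_family_σ (hH : 0 < H) (hs : 0 < 4 * H ^ 2 + κ) (hJ : J ∈ energyRange κ H)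
    (τ a : ℝ) : ContDiffOn ℝ ∞ (family κ τ H a J).σ (solDom κ H J) :=
  contDiffOn_const.add (contDiffOn_primitive (isOpen_solDom κ H J) (ordConnected_solDom κ H J)
    (contDiffOn_angleRate hH hs hJ) (zero_mem_solDom hs J))

theorem hasDerivAt_family_h (hH : 0 < H) (hs : 0 < 4 * H ^ 2 + κ) (hJ : J ∈ energyRange κ H)
    (τ a : ℝ) {t : ℝ} (ht : t ∈ solDom κ H J) :
    HasDerivAt (family κ τ H a J).h (killing κ τ a H J t * momentum κ H J t / snSq κ H J t) t :=
  hasDerivAt_primitive (isOpen_solDom κ H J) (ordConnected_solDom κ H J)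
    (contDiffOn_heightRate hH hs hJ τ a).continuousOn (zero_mem_solDom hs J) ht

theorem hasDerivAt_family_σ (hH : 0 < H) (hs : 0 < 4 * H ^ 2 + κ) (hJ : J ∈ energyRange κ H)
    (τ a : ℝ) {t : ℝ} (ht : t ∈ solDom κ H J) :
    HasDerivAt (family κ τ H a J).σ (angleNum κ H J t / snSq κ H J t) t :=
  (hasDerivAt_primitive (isOpen_solDom κ H J) (ordConnected_solDom κ H J)
    (contDiffOn_angleRate hH hs hJ).continuousOn (zero_mem_solDom hs J) ht).const_add _

/-- The value is `(2H + κJ)/ω² + 2HA`. The first term is nonnegative and the amplitude `A` is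
positive below `Jmax`; at `Jmax` the energy itself is positive. -/
theorem momentum_zero_pos (hH : 0 < H) (hs : 0 < 4 * H ^ 2 + κ) (hJ : J ∈ energyRange κ H) :
    0 < momentum κ H J 0 := by
  have h1 := ((mem_energyRange_iff hH hs).1 hJ)
  have h2 := versMean_mul (J := J) hs
  have h3 := versAmp_nonneg (J := J) hs
  have h4 : (J + 2 * H * versMean κ H J) * (4 * H ^ 2 + κ) = 2 * H + κ * J := by
    linear_combination 2 * H * h2
  have h7 : momentum κ H J 0 = J + 2 * H * versMean κ H J + 2 * H * versAmp κ H J := by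
    simp [momentum, versSol]; ring
  have h5 : 0 ≤ J + 2 * H * versMean κ H J := nonneg_of_mul_nonneg_left (h4 ▸ h1.2) hs
  rcases h1.1.eq_or_lt with h | h
  · have := Jmax_pos hH hs
    have h6 := versMean_pos hH hs hJ
    have h8 : 0 < J := h ▸ this
    rw [h7]
    positivity
  · have := versAmp_pos hH hs hJ h
    rw [h7]; positivity

/-- The integrand defining `σ` is `(XZ' - ZX')/(X² + Z²)`, the rate of the argument of `(X, Z)`.
Hence the unit vector `(X, Z)/sn`, rotated back by `σ`, is constant, and its value is read off at
parameter `0`. -/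
theorem family_angle (hH : 0 < H) (hs : 0 < 4 * H ^ 2 + κ) (hJ : J ∈ energyRange κ H)
    (τ a : ℝ) {t : ℝ} (ht : t ∈ solDom κ H J) :
    √(snSq κ H J t) * cos ((family κ τ H a J).σ t) = versSol' κ H J t ∧
      √(snSq κ H J t) * sin ((family κ τ H a J).σ t) = momentum κ H J t := by
  set σ := (family κ τ H a J).σ with hσ
  have hN : ∀ s, angleNum κ H J s
      = 2 * H * snSq κ H J s - (1 - κ * versSol κ H J s) * momentum κ H J s := fun s => by
    simp only [angleNum, snSq, momentum]; ring
  have hA : ∀ s ∈ solDom κ H J,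
      HasDerivAt (fun s => (versSol' κ H J s * cos (σ s) + momentum κ H J s * sin (σ s))
        / √(snSq κ H J s)) 0 s := by
    intro s hs'
    have e1 := hasDerivAt_versSol' hs J s
    have e2 := hasDerivAt_momentum κ H J s
    have e3 := hasDerivAt_family_σ hH hs hJ τ a hs'
    have e5 := snSq_pos hH hs hJ hs'
    refine hasDerivAt_div_sqrt (hasDerivAt_snSq κ H J s) e5
      ((e1.mul e3.cos).add (e2.mul e3.sin)) ?_
    have e6 := snSq_eq hH hs hJ s
    rw [hN]
    generalize snSq κ H J s = D at *
    field_simp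
    rw [e6]; ring
  have hB : ∀ s ∈ solDom κ H J,
      HasDerivAt (fun s => (momentum κ H J s * cos (σ s) - versSol' κ H J s * sin (σ s))
        / √(snSq κ H J s)) 0 s := by
    intro s hs'
    have e1 := hasDerivAt_versSol' hs J s
    have e2 := hasDerivAt_momentum κ H J s
    have e3 := hasDerivAt_family_σ hH hs hJ τ a hs'
    have e5 := snSq_pos hH hs hJ hs'
    refine hasDerivAt_div_sqrt (hasDerivAt_snSq κ H J s) e5
      ((e2.mul e3.cos).sub (e1.mul e3.sin)) ?_
    have e6 := snSq_eq hH hs hJ s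
    rw [hN]
    generalize snSq κ H J s = D at *
    field_simp
    rw [e6]; ring
  have h0 := zero_mem_solDom hs J
  have hA' := eq_of_hasDerivAt_zero (ordConnected_solDom κ H J) hA ht h0
  have hB' := eq_of_hasDerivAt_zero (ordConnected_solDom κ H J) hB ht h0
  have hσ0 : σ 0 = π / 2 := by simp [hσ, family]
  have hu0 : versSol' κ H J 0 = 0 := by simp [versSol']
  have hv0 := momentum_zero_pos hH hs hJ
  have hD0 : √(snSq κ H J 0) = momentum κ H J 0 := by
    rw [snSq_eq hH hs hJ 0, hu0, zero_pow two_ne_zero, zero_add, Real.sqrt_sq hv0.le]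
  have hD := Real.sqrt_pos.2 (snSq_pos hH hs hJ ht)
  simp only [hσ0, hu0, hD0, Real.cos_pi_div_two, Real.sin_pi_div_two, mul_zero, mul_one, zero_add,
    sub_zero, zero_div, div_self hv0.ne'] at hA' hB'
  rw [div_eq_one_iff_eq hD.ne'] at hA'
  rw [div_eq_zero_iff, or_iff_left hD.ne'] at hB'
  have hcs := Real.sin_sq_add_cos_sq (σ t)
  rw [← hA']
  constructor
  · linear_combination sin (σ t) * hB' + versSol' κ H J t * hcs
  · linear_combination -cos (σ t) * hB' + momentum κ H J t * hcs

end family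

/-- The domain jumps at `J = 0`, so no uniform bound on the integrands is available; positivity of
`snSq` on the segment from `0` to `t` is enough for `continuousAt_parametric_primitive`. -/
theorem continuousOn_family (κ τ a H : ℝ) (hH : 0 < H) (hs : 0 < 4 * H ^ 2 + κ) : ContinuousOn
    (fun x : ℝ × ℝ => ((family κ τ H a x.1).r x.2, (family κ τ H a x.1).h x.2,
      (family κ τ H a x.1).σ x.2))
    {x : ℝ × ℝ | x.1 ∈ energyRange κ H ∧ x.2 ∈ (family κ τ H a x.1).dom} := by
  rintro ⟨J, t⟩ ⟨hJ, ht⟩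
  have hc1 := continuous_versSol κ H
  have hc2 := continuous_snSq κ H
  have hpos : ∀ s ∈ uIcc 0 t, 0 < snSq κ H J s := fun s h =>
    snSq_pos hH hs hJ ((ordConnected_solDom κ H J).uIcc_subset (zero_mem_solDom hs J) ht h)
  refine ContinuousAt.continuousWithinAt (ContinuousAt.prodMk ?_ (ContinuousAt.prodMk ?_ ?_))
  · exact ((continuous_arcversK κ).comp hc1).continuousAt
  · refine continuousAt_parametric_primitive (N := fun J t => heightNum κ τ a H J t) ?_ hc2 hpos
    exact (Real.continuous_sqrt.comp (hc2.add (((continuous_const.mul hc1).sub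
      continuous_const).pow 2))).mul (continuous_fst.add (continuous_const.mul hc1))
  · refine continuousAt_const.add
      (continuousAt_parametric_primitive (N := fun J t => angleNum κ H J t) ?_ hc2 hpos)
    exact ((continuous_const.add (continuous_const.mul continuous_fst)).mul hc1).sub
      continuous_fst

/-! ### The metric and its derivatives -/

theorem gE_eq (κ τ : ℝ) (p v w : Coord) :
    gE κ τ p v w = v.1 * w.1 + snK κ p.1 ^ 2 * (v.2.1 * w.2.1)
      + (2 * τ * versK κ p.1 * v.2.1 - v.2.2) * (2 * τ * versK κ p.1 * w.2.1 - w.2.2) := by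
  unfold gE versK; ring

theorem dgE_eq (κ τ : ℝ) (p u v w : Coord) :
    dgE κ τ p u v w = u.1 * (2 * snK κ p.1 * csK κ p.1 * (v.2.1 * w.2.1)
      + 2 * τ * snK κ p.1 * (v.2.1 * (2 * τ * versK κ p.1 * w.2.1 - w.2.2)
        + (2 * τ * versK κ p.1 * v.2.1 - v.2.2) * w.2.1)) := by
  have h : HasDerivAt (fun r => v.1 * w.1 + snK κ r ^ 2 * (v.2.1 * w.2.1)
      + (2 * τ * versK κ r * v.2.1 - v.2.2) * (2 * τ * versK κ r * w.2.1 - w.2.2))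
      (2 * snK κ p.1 * csK κ p.1 * (v.2.1 * w.2.1)
      + 2 * τ * snK κ p.1 * (v.2.1 * (2 * τ * versK κ p.1 * w.2.1 - w.2.2)
        + (2 * τ * versK κ p.1 * v.2.1 - v.2.2) * w.2.1)) p.1 := by
    have h1 := hasDerivAt_snK κ p.1
    have h2 := (hasDerivAt_versK κ p.1).const_mul (2 * τ)
    refine ((((h1.pow 2).mul_const (v.2.1 * w.2.1)).const_add (v.1 * w.1)).add
      (((h2.mul_const v.2.1).sub_const v.2.2).mul
        ((h2.mul_const w.2.1).sub_const w.2.2))).congr_deriv ?_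
    push_cast; ring
  have h' := h.comp_hasFDerivAt p (hasFDerivAt_fst (𝕜 := ℝ) (p := p))
  have e : (fun q : Coord => gE κ τ q v w) = (fun r => v.1 * w.1 + snK κ r ^ 2 * (v.2.1 * w.2.1)
      + (2 * τ * versK κ r * v.2.1 - v.2.2) * (2 * τ * versK κ r * w.2.1 - w.2.2))
      ∘ Prod.fst := by
    funext q; rw [gE_eq]; rfl
  rw [dgE, e, h'.fderiv]
  simp only [smul_apply, ContinuousLinearMap.coe_fst', smul_eq_mul]
  ring

theorem gOrbit_eq {κ r : ℝ} (hr : r ∈ radii κ) (τ a : ℝ) (v w : ℝ × ℝ) :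
    gOrbit κ τ a r v w = v.1 * w.1 + snK κ r ^ 2 * (v.2 * w.2)
      / (snK κ r ^ 2 + (2 * τ * versK κ r - a) ^ 2) := by
  have h := snK_pos hr
  have h2 : snK κ r ^ 2 + (2 * τ * versK κ r - a) ^ 2 ≠ 0 := by positivity
  simp only [gOrbit, gE_eq]
  rw [show (0 : ℝ) * 0 + snK κ r ^ 2 * (1 * 1)
    + (2 * τ * versK κ r * 1 - a) * (2 * τ * versK κ r * 1 - a)
    = snK κ r ^ 2 + (2 * τ * versK κ r - a) ^ 2 by ring]
  field_simp
  ring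

/-! ### Derivatives of screw motion surfaces -/

theorem hasFDerivAt_screwParam (a : ℝ) {c : ℝ → ℝ × ℝ} {s p q : ℝ}
    (hr : HasDerivAt (fun s => (c s).1) p s) (hh : HasDerivAt (fun s => (c s).2) q s) (φ : ℝ) :
    HasFDerivAt (screwParam a c)
      ((p • ContinuousLinearMap.fst ℝ ℝ ℝ).prod ((ContinuousLinearMap.snd ℝ ℝ ℝ).prod
        (q • ContinuousLinearMap.fst ℝ ℝ ℝ + a • ContinuousLinearMap.snd ℝ ℝ ℝ))) (s, φ) := by
  have h1 := hr.comp_hasFDerivAt (s, φ) (hasFDerivAt_fst (𝕜 := ℝ) (p := (s, φ)))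
  have h2 := hh.comp_hasFDerivAt (s, φ) (hasFDerivAt_fst (𝕜 := ℝ) (p := (s, φ)))
  have h3 := (hasFDerivAt_snd (𝕜 := ℝ) (E := ℝ) (F := ℝ) (p := (s, φ)))
  exact h1.prodMk (h3.prodMk (h2.add (h3.const_mul a)))

theorem partialX_screwParam (a : ℝ) {c : ℝ → ℝ × ℝ} {s p q : ℝ}
    (hr : HasDerivAt (fun s => (c s).1) p s) (hh : HasDerivAt (fun s => (c s).2) q s)
    (φ : ℝ) (e : ℝ × ℝ) :
    partialX (screwParam a c) e (s, φ) = (p * e.1, e.2, q * e.1 + a * e.2) := by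
  rw [partialX, (hasFDerivAt_screwParam a hr hh φ).fderiv]
  simp

theorem partialX_partialX_screwParam (a : ℝ) {c : ℝ → ℝ × ℝ} {p q : ℝ → ℝ} {s p₁ q₁ : ℝ}
    (hr : ∀ᶠ t in 𝓝 s, HasDerivAt (fun s => (c s).1) (p t) t)
    (hh : ∀ᶠ t in 𝓝 s, HasDerivAt (fun s => (c s).2) (q t) t)
    (hp : HasDerivAt p p₁ s) (hq : HasDerivAt q q₁ s) (φ : ℝ) (e f : ℝ × ℝ) :
    partialX (partialX (screwParam a c) f) e (s, φ) = (p₁ * f.1 * e.1, 0, q₁ * f.1 * e.1) := by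
  have he : partialX (screwParam a c) f =ᶠ[𝓝 (s, φ)]
      fun z => (p z.1 * f.1, f.2, q z.1 * f.1 + a * f.2) := by
    have h1 : ∀ᶠ z : ℝ × ℝ in 𝓝 (s, φ), HasDerivAt (fun s => (c s).1) (p z.1) z.1 :=
      (continuous_fst.tendsto (s, φ)).eventually hr
    have h2 : ∀ᶠ z : ℝ × ℝ in 𝓝 (s, φ), HasDerivAt (fun s => (c s).2) (q z.1) z.1 :=
      (continuous_fst.tendsto (s, φ)).eventually hh
    filter_upwards [h1, h2] with z h1 h2
    exact partialX_screwParam a h1 h2 z.2 f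
  have h1 := (hp.mul_const f.1).comp_hasFDerivAt (s, φ)
    (hasFDerivAt_fst (𝕜 := ℝ) (p := (s, φ)))
  have h2 := ((hq.mul_const f.1).add_const (a * f.2)).comp_hasFDerivAt (s, φ)
    (hasFDerivAt_fst (𝕜 := ℝ) (p := (s, φ)))
  have h3 := h1.prodMk ((hasFDerivAt_const f.2 (s, φ)).prodMk h2)
  rw [partialX, he.fderiv_eq]
  erw [h3.fderiv]
  simp

/-! ### The mean curvature of screw motion surfaces -/

/-- The left-hand side of the mean curvature equation, for the normal direction `n`. -/
noncomputable def cmcLHS (κ τ : ℝ) (X : ℝ × ℝ → Coord) (n : Coord) (p : ℝ × ℝ) : ℝ :=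
  firstForm κ τ X (1, 0) (1, 0) p * secondForm κ τ X n (0, 1) (0, 1) p
      - 2 * firstForm κ τ X (1, 0) (0, 1) p * secondForm κ τ X n (1, 0) (0, 1) p
      + firstForm κ τ X (0, 1) (0, 1) p * secondForm κ τ X n (1, 0) (1, 0) p

/-- Squared norm of the Killing field `∂_θ + a ∂_z`. -/
noncomputable def killSq (κ τ a r : ℝ) : ℝ := snK κ r ^ 2 + (2 * τ * versK κ r - a) ^ 2

/-- Squared area density of a screw motion surface; `p`, `q` are the derivatives of `r`, `h`. -/
noncomputable def areaSq (κ τ a r p q : ℝ) : ℝ := killSq κ τ a r * p ^ 2 + snK κ r ^ 2 * q ^ 2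

/-- Numerator of the mean curvature of a screw motion surface; `p`, `q` and `p₁`, `q₁` are the
first and second derivatives of `r`, `h`. -/
noncomputable def meanNum (κ τ a r p q p₁ q₁ : ℝ) : ℝ :=
  killSq κ τ a r * (p * q₁ * snK κ r + p ^ 2 * q * csK κ r - q * snK κ r * p₁)
    - q * snK κ r * p ^ 2
      * (snK κ r * csK κ r + 2 * τ * snK κ r * (2 * τ * versK κ r - a))
    + areaSq κ τ a r p q * csK κ r * q

/-- The normal vector field of a screw motion surface, up to normalization. -/
noncomputable def normalDir (κ τ a r p q : ℝ) : Coord :=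
  (-q, p * (2 * τ * versK κ r - a) / snK κ r ^ 2,
    p * (2 * τ * versK κ r * (2 * τ * versK κ r - a) / snK κ r ^ 2 + 1))

/-- Every quantity is invariant under the screw motions and linear in the normal, so the mean
curvature equation reduces to an expression in the 2-jet of the profile curve. -/
theorem cmcLHS_screwParam (κ τ a : ℝ) {c : ℝ → ℝ × ℝ} {p q : ℝ → ℝ} {s p₁ q₁ : ℝ}
    (hr : ∀ᶠ t in 𝓝 s, HasDerivAt (fun s => (c s).1) (p t) t)
    (hh : ∀ᶠ t in 𝓝 s, HasDerivAt (fun s => (c s).2) (q t) t)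
    (hp : HasDerivAt p p₁ s) (hq : HasDerivAt q q₁ s) (φ k : ℝ) (hs : (c s).1 ∈ radii κ) :
    cmcLHS κ τ (screwParam a c) (k • normalDir κ τ a (c s).1 (p s) (q s)) (s, φ)
      = k * meanNum κ τ a (c s).1 (p s) (q s) p₁ q₁ / snK κ (c s).1 := by
  have h1 := partialX_screwParam a hr.self_of_nhds hh.self_of_nhds φ
  have h2 := partialX_partialX_screwParam a hr hh hp hq φ
  have hpos := snK_pos hs
  simp only [cmcLHS, firstForm, secondForm, christoffelE, dgE_eq, gE_eq, h1, h2, screwParam,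
    normalDir, meanNum, areaSq, killSq, Prod.smul_fst, Prod.smul_snd, smul_eq_mul]
  field_simp
  ring

theorem firstForm_screwParam (κ τ a : ℝ) {c : ℝ → ℝ × ℝ} {s p q : ℝ}
    (hr : HasDerivAt (fun s => (c s).1) p s) (hh : HasDerivAt (fun s => (c s).2) q s) (φ : ℝ) :
    firstForm κ τ (screwParam a c) (1, 0) (1, 0) (s, φ)
        * firstForm κ τ (screwParam a c) (0, 1) (0, 1) (s, φ)
      - firstForm κ τ (screwParam a c) (1, 0) (0, 1) (s, φ) ^ 2
      = areaSq κ τ a (c s).1 p q := by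
  have h1 := partialX_screwParam a hr hh φ
  simp only [firstForm, gE_eq, h1, screwParam, areaSq, killSq]
  ring

theorem killSq_pos {κ r : ℝ} (hr : r ∈ radii κ) (τ a : ℝ) : 0 < killSq κ τ a r := by
  have := snK_pos hr
  unfold killSq; positivity

theorem areaSq_pos {κ r : ℝ} (hr : r ∈ radii κ) (τ a : ℝ) {p q : ℝ} (h : p ≠ 0 ∨ q ≠ 0) :
    0 < areaSq κ τ a r p q := by
  have h1 := snK_pos hr
  have h2 := killSq_pos hr τ a
  unfold areaSq
  rcases h with h | h <;> positivity

theorem gE_normalDir_self {κ r : ℝ} (hr : r ∈ radii κ) (τ a p q k y z : ℝ) :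
    gE κ τ (r, y, z) (k • normalDir κ τ a r p q) (k • normalDir κ τ a r p q)
      = k ^ 2 * areaSq κ τ a r p q / snK κ r ^ 2 := by
  have hpos := snK_pos hr
  simp only [gE_eq, normalDir, areaSq, killSq, Prod.smul_fst, Prod.smul_snd, smul_eq_mul]
  field_simp
  ring

theorem gE_normalDir_fst {κ r : ℝ} (hr : r ∈ radii κ) (τ a p q k y z : ℝ) :
    gE κ τ (r, y, z) (p, 0, q) (k • normalDir κ τ a r p q) = 0 := by
  have hpos := snK_pos hr
  simp only [gE_eq, normalDir, Prod.smul_fst, Prod.smul_snd, smul_eq_mul]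
  field_simp
  ring

theorem gE_normalDir_snd {κ r : ℝ} (hr : r ∈ radii κ) (τ a p q k y z : ℝ) :
    gE κ τ (r, y, z) (0, 1, a) (k • normalDir κ τ a r p q) = 0 := by
  have hpos := snK_pos hr
  simp only [gE_eq, normalDir, Prod.smul_fst, Prod.smul_snd, smul_eq_mul]
  field_simp
  ring

/-- The factor of a normal vector `n` with respect to `normalDir`. -/
noncomputable def normalFactor (κ τ r p q : ℝ) (n : Coord) : ℝ :=
  -(q * n.1 + p * (2 * τ * versK κ r * n.2.1 - n.2.2)) / (p ^ 2 + q ^ 2)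

/-- With `B = 2τy n₂ - n₃`, the two orthogonality relations read `p n₁ = qB` and `sn² n₂ = -(2τy -
a)B`; they leave one degree of freedom, and dividing by `p² + q²` recovers the factor without a case
split. -/
theorem eq_normalFactor_smul {κ r : ℝ} (hr : r ∈ radii κ) {τ a p q y z : ℝ} {n : Coord}
    (hpq : p ≠ 0 ∨ q ≠ 0) (h1 : gE κ τ (r, y, z) (p, 0, q) n = 0)
    (h2 : gE κ τ (r, y, z) (0, 1, a) n = 0) :
    n = normalFactor κ τ r p q n • normalDir κ τ a r p q := by
  have hpos := snK_pos hr
  have hpq' : p ^ 2 + q ^ 2 ≠ 0 := by rcases hpq with h | h <;> positivity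
  obtain ⟨n1, n2, n3⟩ := n
  simp only [gE_eq] at h1 h2
  simp only [normalFactor, normalDir, Prod.smul_mk, smul_eq_mul, Prod.mk.injEq]
  set A := 2 * τ * versK κ r
  set S := snK κ r
  have e2 : S ^ 2 * n2 = -(A - a) * (A * n2 - n3) := by linear_combination h2
  have e1 : p * n1 = q * (A * n2 - n3) := by linear_combination h1
  have e3 : p * (-(q * n1 + p * (A * n2 - n3)) / (p ^ 2 + q ^ 2)) = -(A * n2 - n3) := by
    field_simp
    linear_combination -q * e1
  have e4 : -(q * n1 + p * (A * n2 - n3)) / (p ^ 2 + q ^ 2) * -q = n1 := by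
    field_simp
    linear_combination -p * e1
  have e5 : n2 = -(A * n2 - n3) * (A - a) / S ^ 2 := by
    field_simp
    linear_combination e2
  refine ⟨e4.symm, ?_, ?_⟩
  · rw [← mul_div_assoc, ← mul_assoc, mul_comm _ p, e3]; exact e5
  · rw [← mul_assoc, mul_comm _ p, e3, mul_add, mul_div_assoc, mul_left_comm, ← mul_div_assoc,
      ← e5]; ring

/-- A curve in the orbit space with mean curvature `H` generates a surface of constant mean
curvature `H`. -/
theorem hasCMC_screwParam {κ τ a H : ℝ} {K : Set ℝ} (hK : IsOpen K) {c : ℝ → ℝ × ℝ}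
    {p q p₁ q₁ : ℝ → ℝ} (hmem : ∀ s ∈ K, (c s).1 ∈ radii κ)
    (hr : ∀ s ∈ K, HasDerivAt (fun s => (c s).1) (p s) s)
    (hh : ∀ s ∈ K, HasDerivAt (fun s => (c s).2) (q s) s)
    (hp : ∀ s ∈ K, HasDerivAt p (p₁ s) s) (hq : ∀ s ∈ K, HasDerivAt q (q₁ s) s)
    (hreg : ∀ s ∈ K, p s ≠ 0 ∨ q s ≠ 0)
    (hmean : ∀ s ∈ K, meanNum κ τ a (c s).1 (p s) (q s) (p₁ s) (q₁ s)
      = 2 * H * √(areaSq κ τ a (c s).1 (p s) (q s)) ^ 3) :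
    HasCMC κ τ H (K ×ˢ univ) (screwParam a c) := by
  have hcr : ContinuousOn (fun s => (c s).1) K := fun s hs => (hr s hs).continuousAt.continuousWithinAt
  have hcp : ContinuousOn p K := fun s hs => (hp s hs).continuousAt.continuousWithinAt
  have hcq : ContinuousOn q K := fun s hs => (hq s hs).continuousAt.continuousWithinAt
  have hsn : ContinuousOn (fun s => snK κ (c s).1) K :=
    (contDiff_snK κ (n := 0)).continuous.comp_continuousOn hcr
  have hvs : ContinuousOn (fun s => versK κ (c s).1) K :=
    (contDiff_versK κ (n := 0)).continuous.comp_continuousOn hcr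
  have hne : ∀ s ∈ K, snK κ (c s).1 ≠ 0 := fun s hs => (snK_pos (hmem s hs)).ne'
  have har : ∀ s ∈ K, 0 < √(areaSq κ τ a (c s).1 (p s) (q s)) := fun s hs =>
    Real.sqrt_pos.2 (areaSq_pos (hmem s hs) τ a (hreg s hs))
  refine ⟨fun z => (snK κ (c z.1).1 / √(areaSq κ τ a (c z.1).1 (p z.1) (q z.1)))
    • normalDir κ τ a (c z.1).1 (p z.1) (q z.1), ?_, ?_⟩
  · have : ContinuousOn (fun s => (snK κ (c s).1 / √(areaSq κ τ a (c s).1 (p s) (q s)))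
        • normalDir κ τ a (c s).1 (p s) (q s)) K := by
      have hsn2 : ∀ s ∈ K, snK κ (c s).1 ^ 2 ≠ 0 := fun s hs => pow_ne_zero 2 (hne s hs)
      refine ContinuousOn.smul (ContinuousOn.div hsn ?_ fun s hs => (har s hs).ne') ?_
      · unfold areaSq killSq
        fun_prop
      · unfold normalDir
        refine hcq.neg.prodMk (ContinuousOn.prodMk ?_ ?_)
        · exact ContinuousOn.div (by fun_prop) (by fun_prop) hsn2
        · refine hcp.mul (ContinuousOn.add (ContinuousOn.div (by fun_prop) (by fun_prop) hsn2)
            continuousOn_const)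
    exact this.comp continuousOn_fst fun z hz => hz.1
  · rintro ⟨s, φ⟩ ⟨hs, -⟩
    have hsn := hne s hs
    have hsa := har s hs
    have hsq : √(areaSq κ τ a (c s).1 (p s) (q s)) ^ 2 = areaSq κ τ a (c s).1 (p s) (q s) :=
      Real.sq_sqrt (areaSq_pos (hmem s hs) τ a (hreg s hs)).le
    refine ⟨?_, ?_, ?_, ?_⟩
    · refine (gE_normalDir_self (hmem s hs) τ a _ _ _ _ _).trans ?_
      rw [div_pow, hsq]
      have := (areaSq_pos (hmem s hs) τ a (hreg s hs)).ne'
      field_simp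
    · rw [partialX_screwParam a (hr s hs) (hh s hs)]
      simp only [mul_one, mul_zero, add_zero]
      exact gE_normalDir_fst (hmem s hs) τ a _ _ _ _ _
    · rw [partialX_screwParam a (hr s hs) (hh s hs)]
      simp only [mul_one, mul_zero, zero_add]
      exact gE_normalDir_snd (hmem s hs) τ a _ _ _ _ _
    · rw [firstForm_screwParam κ τ a (hr s hs) (hh s hs)]
      refine (cmcLHS_screwParam κ τ a (eventually_of_mem (hK.mem_nhds hs) hr)
        (eventually_of_mem (hK.mem_nhds hs) hh) (hp s hs) (hq s hs) φ _ (hmem s hs)).trans ?_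
      rw [hmean s hs]
      nth_rw 3 [← hsq]
      field_simp

/-- A curve in the orbit space generating a surface of constant mean curvature `H` has mean
curvature `H` for one of its orientations. -/
theorem meanNum_of_hasCMC {κ τ a H : ℝ} {K : Set ℝ} (hK : IsOpen K) (hKc : K.OrdConnected)
    {c : ℝ → ℝ × ℝ}
    {p q p₁ q₁ : ℝ → ℝ} (hmem : ∀ s ∈ K, (c s).1 ∈ radii κ)
    (hr : ∀ s ∈ K, HasDerivAt (fun s => (c s).1) (p s) s)
    (hh : ∀ s ∈ K, HasDerivAt (fun s => (c s).2) (q s) s)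
    (hp : ∀ s ∈ K, HasDerivAt p (p₁ s) s) (hq : ∀ s ∈ K, HasDerivAt q (q₁ s) s)
    (hreg : ∀ s ∈ K, p s ≠ 0 ∨ q s ≠ 0)
    (hcmc : HasCMC κ τ H (K ×ˢ univ) (screwParam a c)) :
    ∃ ε : ℝ, ε ^ 2 = 1 ∧ ∀ s ∈ K, ε * meanNum κ τ a (c s).1 (p s) (q s) (p₁ s) (q₁ s)
      = 2 * H * √(areaSq κ τ a (c s).1 (p s) (q s)) ^ 3 := by
  obtain ⟨n, hn, hcmc⟩ := hcmc
  have hcr : ContinuousOn (fun s => (c s).1) K := fun s hs => (hr s hs).continuousAt.continuousWithinAt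
  have hcp : ContinuousOn p K := fun s hs => (hp s hs).continuousAt.continuousWithinAt
  have hcq : ContinuousOn q K := fun s hs => (hq s hs).continuousAt.continuousWithinAt
  have hsn : ContinuousOn (fun s => snK κ (c s).1) K :=
    (contDiff_snK κ (n := 0)).continuous.comp_continuousOn hcr
  have hvs : ContinuousOn (fun s => versK κ (c s).1) K :=
    (contDiff_versK κ (n := 0)).continuous.comp_continuousOn hcr
  have hcn : ContinuousOn (fun s => n (s, 0)) K :=
    hn.comp (by fun_prop) fun s hs => ⟨hs, trivial⟩
  have har : ∀ s ∈ K, 0 < √(areaSq κ τ a (c s).1 (p s) (q s)) := fun s hs =>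
    Real.sqrt_pos.2 (areaSq_pos (hmem s hs) τ a (hreg s hs))
  -- The slice of angle zero suffices, since `meanNum` and `areaSq` depend only on the profile
  -- parameter.
  set k := fun s => normalFactor κ τ (c s).1 (p s) (q s) (n (s, 0)) with hk
  have hnk : ∀ s ∈ K, n (s, 0) = k s • normalDir κ τ a (c s).1 (p s) (q s) := by
    intro s hs
    obtain ⟨-, h2, h3, -⟩ := hcmc (s, 0) ⟨hs, trivial⟩
    rw [partialX_screwParam a (hr s hs) (hh s hs)] at h2 h3
    simp only [mul_one, mul_zero, zero_add, add_zero] at h2 h3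
    exact eq_normalFactor_smul (hmem s hs) (hreg s hs) h2 h3
  have hkc : ContinuousOn k K := by
    simp only [hk, normalFactor]
    have e1 := continuous_fst.comp_continuousOn hcn
    have e2 := (continuous_fst.comp continuous_snd).comp_continuousOn hcn
    have e3 := (continuous_snd.comp continuous_snd).comp_continuousOn hcn
    refine ContinuousOn.div ((hcq.mul e1).add (hcp.mul
      (((continuousOn_const.mul hvs).mul e2).sub e3))).neg (by fun_prop) fun s hs => ?_
    rcases hreg s hs with h | h <;> positivity
  have hgc : ContinuousOn (fun s => snK κ (c s).1 / √(areaSq κ τ a (c s).1 (p s) (q s))) K := by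
    refine ContinuousOn.div hsn ?_ fun s hs => (har s hs).ne'
    unfold areaSq killSq
    fun_prop
  have hsq : EqOn (k ^ 2) ((fun s => snK κ (c s).1 / √(areaSq κ τ a (c s).1 (p s) (q s))) ^ 2)
      K := by
    intro s hs
    obtain ⟨h1, -, -, -⟩ := hcmc (s, 0) ⟨hs, trivial⟩
    rw [hnk s hs] at h1
    have h1 := (gE_normalDir_self (hmem s hs) τ a _ _ _ _ _).symm.trans h1
    have h2 := areaSq_pos (hmem s hs) τ a (hreg s hs)
    have h3 := snK_pos (hmem s hs)
    simp only [Pi.pow_apply, div_pow, Real.sq_sqrt h2.le]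
    rw [eq_div_iff h2.ne', ← div_eq_one_iff_eq (by positivity)]
    exact h1
  have hmain : ∀ ε : ℝ, ε ^ 2 = 1 →
      (∀ s ∈ K, k s = ε * (snK κ (c s).1 / √(areaSq κ τ a (c s).1 (p s) (q s)))) →
      ∀ s ∈ K, ε * meanNum κ τ a (c s).1 (p s) (q s) (p₁ s) (q₁ s)
        = 2 * H * √(areaSq κ τ a (c s).1 (p s) (q s)) ^ 3 := by
    intro ε hε hke s hs
    obtain ⟨-, -, -, h4⟩ := hcmc (s, 0) ⟨hs, trivial⟩
    rw [firstForm_screwParam κ τ a (hr s hs) (hh s hs), hnk s hs] at h4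
    have h5 := (cmcLHS_screwParam κ τ a (eventually_of_mem (hK.mem_nhds hs) hr)
        (eventually_of_mem (hK.mem_nhds hs) hh) (hp s hs) (hq s hs) 0 _ (hmem s hs)).symm.trans h4
    have h2 := areaSq_pos (hmem s hs) τ a (hreg s hs)
    have h3 := snK_pos (hmem s hs)
    have h6 := har s hs
    rw [hke s hs, ← Real.sq_sqrt h2.le] at h5
    simp only [Real.sqrt_sq h6.le] at h5
    field_simp at h5
    linarith
  -- Two continuous functions with equal squares, one without zeros, differ by a global sign on a
  -- connected set; this sign is the orientation `ε`.
  rcases hKc.isPreconnected.eq_or_eq_neg_of_sq_eq hkc hgc hsq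
    (fun {s} hs => (div_pos (snK_pos (hmem s hs)) (har s hs)).ne') with h | h
  · exact ⟨1, by norm_num, hmain 1 (by norm_num) fun s hs => by rw [h hs, one_mul]⟩
  · exact ⟨-1, by norm_num, hmain (-1) (by norm_num) fun s hs => by rw [h hs]; simp⟩

/-! ### The members of the family are profile curves -/

theorem killing_sq {κ H J : ℝ} (hH : 0 < H) (hs : 0 < 4 * H ^ 2 + κ) (hJ : J ∈ energyRange κ H)
    (τ a : ℝ) {t : ℝ} (ht : t ∈ solDom κ H J) :
    killing κ τ a H J t ^ 2 = snSq κ H J t + (2 * τ * versSol κ H J t - a) ^ 2 := by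
  have := snSq_pos hH hs hJ ht
  exact Real.sq_sqrt (by positivity)

theorem killing_pos {κ H J : ℝ} (hH : 0 < H) (hs : 0 < 4 * H ^ 2 + κ) (hJ : J ∈ energyRange κ H)
    (τ a : ℝ) {t : ℝ} (ht : t ∈ solDom κ H J) : 0 < killing κ τ a H J t := by
  have := snSq_pos hH hs hJ ht
  exact Real.sqrt_pos.2 (by positivity)

/-- The mean curvature equation along the family, with `s = sn r`, `c = cs r`, `u = X`, `v = Z`, `B
= 2τy - a` and Killing norm `ξ`. Unit speed makes the area density equal to `ξ`. The terms with `τ`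
cancel, and the remainder uses only `u² + v² = s²`. -/
theorem meanNum_identity {s c B τ u v ξ H : ℝ} (hs : 0 < s) (hξ : 0 < ξ)
    (huv : u ^ 2 + v ^ 2 = s ^ 2) {p q p₁ q₁ : ℝ} (hp : p = u / s) (hq : q = ξ * v / s ^ 2)
    (hp₁ : p₁ = ((c - 2 * H * v) * s - u * (c * u / s)) / s ^ 2)
    (hq₁ : q₁ = (((c * u + 2 * B * τ * u) / ξ * v + ξ * (2 * H * u)) * s ^ 2
      - ξ * v * (2 * (c * u))) / (s ^ 2) ^ 2) :
    ξ ^ 2 * (p * q₁ * s + p ^ 2 * q * c - q * s * p₁) - q * s * p ^ 2 * (s * c + 2 * τ * s * B)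
      + ξ ^ 2 * c * q = 2 * H * ξ ^ 3 := by
  subst hp hq hp₁ hq₁
  field_simp
  have : u ^ 2 = s ^ 2 - v ^ 2 := by linarith
  rw [this]
  ring

theorem isProfile_family {κ τ a H J : ℝ} (hH : 0 < H) (hs : 0 < 4 * H ^ 2 + κ)
    (hJ : J ∈ energyRange κ H) : IsProfile κ τ a H J (family κ τ H a J) := by
  have hvs := fun t ht => versK_family_r hH hs hJ τ a (t := t) ht
  have hsn := fun t ht => snK_family_r hH hs hJ τ a (t := t) ht
  have hmem := fun t ht => family_r_mem hH hs hJ τ a (t := t) ht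
  have hr := fun t ht => hasDerivAt_family_r hH hs hJ τ a (t := t) ht
  have hh := fun t ht => hasDerivAt_family_h hH hs hJ τ a (t := t) ht
  have hD := fun t ht => snSq_pos hH hs hJ (t := t) ht
  have hξ := fun t ht => killing_pos hH hs hJ τ a (t := t) ht
  have hξ2 := fun t ht => killing_sq hH hs hJ τ a (t := t) ht
  have huv := snSq_eq hH hs hJ
  have hsq : ∀ t ∈ solDom κ H J, √(snSq κ H J t) ^ 2 = snSq κ H J t := fun t ht =>
    Real.sq_sqrt (hD t ht).le
  have hs0 : ∀ t ∈ solDom κ H J, 0 < √(snSq κ H J t) := fun t ht => Real.sqrt_pos.2 (hD t ht)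
  have hang := fun t ht => family_angle hH hs hJ τ a (t := t) ht
  have hkill : ∀ t ∈ solDom κ H J,
      snK κ ((family κ τ H a J).r t) ^ 2 + (2 * τ * versK κ ((family κ τ H a J).r t) - a) ^ 2
        = killing κ τ a H J t ^ 2 := fun t ht => by
    rw [hsn t ht, hvs t ht, hsq t ht, hξ2 t ht]
  have horbit : ∀ t ∈ solDom κ H J, ∀ v w : ℝ × ℝ,
      gOrbit κ τ a ((family κ τ H a J).r t) v w
        = v.1 * w.1 + snSq κ H J t * (v.2 * w.2) / killing κ τ a H J t ^ 2 := fun t ht v w => by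
    rw [gOrbit_eq (hmem t ht), hkill t ht, hsn t ht, hsq t ht]
  refine ⟨isOpen_solDom κ H J, ordConnected_solDom κ H J, ⟨0, zero_mem_solDom hs J⟩,
    contDiffOn_family_r hH hs hJ τ a, contDiffOn_family_h hH hs hJ τ a,
    contDiffOn_family_σ hH hs hJ τ a, hmem, ?_, ?_, ?_, ?_, ?_⟩
  · intro t ht
    have h1 := hD t ht
    have h2 := hξ t ht
    rw [horbit t ht, (hr t ht).deriv, (hh t ht).deriv]
    simp only []
    rw [div_mul_div_comm, ← sq, ← sq, hsq t ht]
    have := huv t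
    field_simp
    linarith
  · intro t ht
    rw [horbit t ht, (hr t ht).deriv, ← (hang t ht).1]
    have := hs0 t ht
    simp only []
    field_simp
    ring
  · intro t ht
    have h0 := hs0 t ht
    have h2 := hξ t ht
    have h1 : gOrbit κ τ a ((family κ τ H a J).r t) (0, 1) (0, 1)
        = (√(snSq κ H J t) / killing κ τ a H J t) ^ 2 := by
      rw [horbit t ht, div_pow, hsq t ht]; simp
    rw [h1, Real.sqrt_sq (by positivity), horbit t ht, (hh t ht).deriv, ← (hang t ht).2]
    have := hD t ht
    simp only []
    field_simp
    ring
  · refine hasCMC_screwParam (isOpen_solDom κ H J)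
      (p := fun t => versSol' κ H J t / √(snSq κ H J t))
      (q := fun t => killing κ τ a H J t * momentum κ H J t / snSq κ H J t)
      (p₁ := fun t => ((1 - κ * versSol κ H J t - 2 * H * momentum κ H J t) * √(snSq κ H J t)
        - versSol' κ H J t * ((1 - κ * versSol κ H J t) * versSol' κ H J t / √(snSq κ H J t)))
          / √(snSq κ H J t) ^ 2)
      (q₁ := fun t => ((((1 - κ * versSol κ H J t) * versSol' κ H J t
          + 2 * (2 * τ * versSol κ H J t - a) * τ * versSol' κ H J t) / killing κ τ a H J t
          * momentum κ H J t + killing κ τ a H J t * (2 * H * versSol' κ H J t)) * snSq κ H J t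
        - killing κ τ a H J t * momentum κ H J t
          * (2 * ((1 - κ * versSol κ H J t) * versSol' κ H J t))) / snSq κ H J t ^ 2)
      hmem hr hh ?_ ?_ ?_ ?_
    · intro t ht
      refine ((hasDerivAt_versSol' hs J t).div ((hasDerivAt_snSq κ H J t).sqrt (hD t ht).ne')
        (hs0 t ht).ne').congr_deriv ?_
      have := hs0 t ht
      field_simp
    · intro t ht
      have h1 := hD t ht
      have hk : HasDerivAt (killing κ τ a H J) (((1 - κ * versSol κ H J t) * versSol' κ H J t
          + 2 * (2 * τ * versSol κ H J t - a) * τ * versSol' κ H J t) / killing κ τ a H J t) t := by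
        have h2 := (hasDerivAt_snSq κ H J t).add
          ((((hasDerivAt_versSol κ H J t).const_mul (2 * τ)).sub_const a).pow 2)
        refine (h2.sqrt (by simp only [Pi.add_apply, Pi.pow_apply]; positivity)).congr_deriv ?_
        change _ / (2 * killing κ τ a H J t) = _
        have := hξ t ht
        field_simp
        push_cast
        ring
      exact (hk.mul (hasDerivAt_momentum κ H J t)).div (hasDerivAt_snSq κ H J t) h1.ne'
    · intro t ht
      have h1 := hD t ht
      have h2 := hs0 t ht
      have h3 := hξ t ht
      by_contra! hc
      have h4 : versSol' κ H J t = 0 := by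
        have := hc.1; rw [div_eq_zero_iff] at this; exact this.resolve_right h2.ne'
      have h5 : momentum κ H J t = 0 := by
        have := hc.2
        rw [div_eq_zero_iff] at this
        exact (mul_eq_zero.1 (this.resolve_right h1.ne')).resolve_left h3.ne'
      rw [huv t, h4, h5] at h1
      simp at h1
    · intro t ht
      have h1 := hD t ht
      have h2 := hs0 t ht
      have h3 := hξ t ht
      have e1 : killSq κ τ a ((family κ τ H a J).curve t).1 = killing κ τ a H J t ^ 2 := hkill t ht
      have e2 : snK κ ((family κ τ H a J).curve t).1 = √(snSq κ H J t) := hsn t ht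
      have e3 : versK κ ((family κ τ H a J).curve t).1 = versSol κ H J t := hvs t ht
      have e4 : csK κ ((family κ τ H a J).curve t).1 = 1 - κ * versSol κ H J t := by
        rw [csK_eq, e3]
      have e5 : areaSq κ τ a ((family κ τ H a J).curve t).1
          (versSol' κ H J t / √(snSq κ H J t))
          (killing κ τ a H J t * momentum κ H J t / snSq κ H J t) = killing κ τ a H J t ^ 2 := by
        rw [areaSq, e1, e2, div_pow, hsq t ht]
        have := huv t
        field_simp
        linarith
      rw [meanNum, e5, e1, e2, e3, e4, Real.sqrt_sq h3.le]
      have key := meanNum_identity (c := 1 - κ * versSol κ H J t)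
        (B := 2 * τ * versSol κ H J t - a) (τ := τ) (u := versSol' κ H J t)
        (v := momentum κ H J t) (H := H) h2 h3 (by rw [hsq t ht, huv t]) rfl rfl rfl rfl
      rw [hsq t ht] at key
      rw [hsq t ht]
      exact key
  · intro t ht
    rw [energy_eq_versK, hvs t ht, hsn t ht, (hang t ht).2, momentum]; ring

/-! ### Reduction of the mean curvature equation -/

/-- The reduced first order system for a curve `c` in the orbit space: `v` is the signed speed, and
`X`, `Z` stand for `sn r cos σ`, `sn r sin σ`. -/
structure IsReducedCurve (κ τ a H : ℝ) (K : Set ℝ) (c : ℝ → ℝ × ℝ) (v X Z : ℝ → ℝ) : Prop where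
  radius_mem : ∀ s ∈ K, (c s).1 ∈ radii κ
  speed_smooth : ContDiffOn ℝ 1 v K
  speed_ne : ∀ s ∈ K, v s ≠ 0
  vers_deriv : ∀ s ∈ K, HasDerivAt (fun s => versK κ (c s).1) (v s * X s) s
  X_deriv : ∀ s ∈ K, HasDerivAt X (v s * (1 - κ * versK κ (c s).1 - 2 * H * Z s)) s
  Z_deriv : ∀ s ∈ K, HasDerivAt Z (2 * H * (v s * X s)) s
  height_deriv : ∀ s ∈ K, HasDerivAt (fun s => (c s).2)
    (v s * √(killSq κ τ a (c s).1) * Z s / snK κ (c s).1 ^ 2) s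
  norm_sq : ∀ s ∈ K, X s ^ 2 + Z s ^ 2 = snK κ (c s).1 ^ 2

theorem hasDerivAt_div_sqrt_of_two_mul {A D : ℝ → ℝ} {A' g t : ℝ} (hD : HasDerivAt D (2 * g) t)
    (hpos : 0 < D t) (hA : HasDerivAt A A' t) :
    HasDerivAt (fun t => A t / √(D t)) ((A' * D t - A t * g) / √(D t) ^ 3) t := by
  have hs := Real.sqrt_pos.2 hpos
  refine (hA.div (hD.sqrt hpos.ne') hs.ne').congr_deriv ?_
  have h2 : D t = √(D t) ^ 2 := (Real.sq_sqrt hpos.le).symm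
  generalize √(D t) = S at *
  rw [h2]
  field_simp

/-- The differentiated formula `X = ε s ξ p / S` for a curve of arbitrary speed, `S` being the area
density and `ε S / ξ` the signed speed. The mean curvature equation `εQ = 2HS³` eliminates the
second derivatives. -/
theorem reduced_X_identity {s c T ξ p q p₁ q₁ S ε H Q D : ℝ} (hξ : 0 < ξ) (hS : 0 < S)
    (hD : S ^ 2 = D) (hD' : D = ξ ^ 2 * p ^ 2 + s ^ 2 * q ^ 2) (hε : ε ^ 2 = 1)
    (hQ : Q = ξ ^ 2 * (p * q₁ * s + p ^ 2 * q * c - q * s * p₁) - q * s * p ^ 2 * (s * c + T)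
      + D * c * q) (hQH : ε * Q = 2 * H * S ^ 3) :
    ε * ((((c * p * ξ + s * ((s * c + T) * p / ξ)) * p + s * ξ * p₁) * D - s * ξ * p *
      ((s * c + T) * p * p ^ 2 + ξ ^ 2 * p * p₁ + s * c * p * q ^ 2 + s ^ 2 * q * q₁)) / S ^ 3)
      = ε * S / ξ * (c - 2 * H * (ε * (s ^ 2 * q / S))) := by
  have h1 : ε * S / ξ * (c - 2 * H * (ε * (s ^ 2 * q / S)))
      = (ε * (S ^ 2) ^ 2 * c - ε ^ 2 * (2 * H * S ^ 3) * s ^ 2 * q) / (ξ * S ^ 3) := by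
    field_simp
  rw [h1, ← hQH, hε, hD]
  field_simp
  rw [hQ, hD']
  ring

/-- The flux law `Z' = 2H y'` for `Z = ε s² q / S`; it is the source of the conserved energy. -/
theorem reduced_Z_identity {s c T ξ p q p₁ q₁ S ε H Q D : ℝ} (hS : 0 < S)
    (hD' : D = ξ ^ 2 * p ^ 2 + s ^ 2 * q ^ 2)
    (hQ : Q = ξ ^ 2 * (p * q₁ * s + p ^ 2 * q * c - q * s * p₁) - q * s * p ^ 2 * (s * c + T)
      + D * c * q) (hQH : ε * Q = 2 * H * S ^ 3) :
    ε * (((2 * s * (c * p) * q + s ^ 2 * q₁) * D - s ^ 2 * q *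
      ((s * c + T) * p * p ^ 2 + ξ ^ 2 * p * p₁ + s * c * p * q ^ 2 + s ^ 2 * q * q₁)) / S ^ 3)
      = 2 * H * (s * p) := by
  rw [← mul_div_assoc, div_eq_iff (by positivity)]
  have : 2 * H * (s * p) * S ^ 3 = ε * Q * (s * p) := by rw [hQH]; ring
  rw [this, hQ, hD']
  ring

theorem exists_isReducedCurve {κ τ a H : ℝ} {K : Set ℝ} (hK : IsOpen K) (hKc : K.OrdConnected)
    {c : ℝ → ℝ × ℝ} (hc : ContDiffOn ℝ 2 c K)
    (hreg : ∀ s ∈ K, (c s).1 ∈ radii κ ∧ deriv c s ≠ 0)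
    (hcmc : HasCMC κ τ H (K ×ˢ univ) (screwParam a c)) :
    ∃ v X Z, IsReducedCurve κ τ a H K c v X Z := by
  set r : ℝ → ℝ := fun s => (c s).1 with hrdef
  set h : ℝ → ℝ := fun s => (c s).2 with hhdef
  have hr2 : ContDiffOn ℝ 2 r K := contDiff_fst.comp_contDiffOn hc
  have hh2 : ContDiffOn ℝ 2 h K := contDiff_snd.comp_contDiffOn hc
  have two : (2 : WithTop ℕ∞) = 1 + 1 := by norm_num
  have hp1 : ContDiffOn ℝ 1 (deriv r) K := by
    rw [two, contDiffOn_succ_iff_deriv_of_isOpen hK] at hr2; exact hr2.2.2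
  have hq1 : ContDiffOn ℝ 1 (deriv h) K := by
    rw [two, contDiffOn_succ_iff_deriv_of_isOpen hK] at hh2; exact hh2.2.2
  have hder : ∀ {f : ℝ → ℝ} {n : WithTop ℕ∞}, n ≠ 0 → ContDiffOn ℝ n f K → ∀ s ∈ K,
      HasDerivAt f (deriv f s) s := fun hn hf s hs =>
    ((hf.contDiffAt (hK.mem_nhds hs)).differentiableAt hn).hasDerivAt
  have hr := hder (by norm_num) hr2
  have hh := hder (by norm_num) hh2
  have hp := hder (by norm_num) hp1
  have hq := hder (by norm_num) hq1
  have hmem : ∀ s ∈ K, r s ∈ radii κ := fun s hs => (hreg s hs).1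
  have hpq : ∀ s ∈ K, deriv r s ≠ 0 ∨ deriv h s ≠ 0 := by
    intro s hs
    by_contra! hcon
    have := (hr s hs).prodMk (hh s hs)
    refine (hreg s hs).2 (this.deriv.trans ?_)
    rw [hcon.1, hcon.2]; rfl
  obtain ⟨ε, hε, hmean⟩ := meanNum_of_hasCMC hK hKc hmem hr hh hp hq hpq hcmc
  have hε0 : ε ≠ 0 := by rintro rfl; norm_num at hε
  set D : ℝ → ℝ := fun s => areaSq κ τ a (r s) (deriv r s) (deriv h s) with hDdef
  set k : ℝ → ℝ := fun s => killSq κ τ a (r s) with hkdef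
  have hkpos : ∀ s ∈ K, 0 < k s := fun s hs => killSq_pos (hmem s hs) τ a
  have hDpos : ∀ s ∈ K, 0 < D s := fun s hs => areaSq_pos (hmem s hs) τ a (hpq s hs)
  have hsn : ∀ s ∈ K, HasDerivAt (fun s => snK κ (r s)) (csK κ (r s) * deriv r s) s :=
    fun s hs => (hasDerivAt_snK κ (r s)).comp s (hr s hs)
  have hvs : ∀ s ∈ K, HasDerivAt (fun s => versK κ (r s)) (snK κ (r s) * deriv r s) s :=
    fun s hs => (hasDerivAt_versK κ (r s)).comp s (hr s hs)
  have hkd : ∀ s ∈ K, HasDerivAt k (2 * ((snK κ (r s) * csK κ (r s)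
      + 2 * τ * snK κ (r s) * (2 * τ * versK κ (r s) - a)) * deriv r s)) s := fun s hs => by
    refine (((hsn s hs).pow 2).add ((((hvs s hs).const_mul (2 * τ)).sub_const a).pow 2)).congr_deriv
      ?_
    push_cast; ring
  have hkq : ∀ s ∈ K, √(k s) ^ 2 = k s := fun s hs => Real.sq_sqrt (hkpos s hs).le
  have hk0 : ∀ s ∈ K, 0 < √(k s) := fun s hs => Real.sqrt_pos.2 (hkpos s hs)
  have hDq : ∀ s ∈ K, √(D s) ^ 2 = D s := fun s hs => Real.sq_sqrt (hDpos s hs).le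
  have hD0 : ∀ s ∈ K, 0 < √(D s) := fun s hs => Real.sqrt_pos.2 (hDpos s hs)
  have hDd : ∀ s ∈ K, HasDerivAt D (2 * ((snK κ (r s) * csK κ (r s)
      + 2 * τ * snK κ (r s) * (2 * τ * versK κ (r s) - a)) * deriv r s * deriv r s ^ 2
      + √(k s) ^ 2 * deriv r s * deriv (deriv r) s
      + snK κ (r s) * csK κ (r s) * deriv r s * deriv h s ^ 2
      + snK κ (r s) ^ 2 * deriv h s * deriv (deriv h) s)) s := fun s hs => by
    refine (((hkd s hs).mul ((hp s hs).pow 2)).add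
      (((hsn s hs).pow 2).mul ((hq s hs).pow 2))).congr_deriv ?_
    rw [hkq s hs]
    simp only [Pi.pow_apply]
    push_cast; ring
  have hDeq : ∀ s ∈ K, D s = √(k s) ^ 2 * deriv r s ^ 2 + snK κ (r s) ^ 2 * deriv h s ^ 2 :=
    fun s hs => by rw [hkq s hs]; rfl
  have hQ : ∀ s ∈ K, meanNum κ τ a (r s) (deriv r s) (deriv h s) (deriv (deriv r) s)
      (deriv (deriv h) s) = √(k s) ^ 2 * (deriv r s * deriv (deriv h) s * snK κ (r s)
        + deriv r s ^ 2 * deriv h s * csK κ (r s) - deriv h s * snK κ (r s) * deriv (deriv r) s)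
      - deriv h s * snK κ (r s) * deriv r s ^ 2 * (snK κ (r s) * csK κ (r s)
      + 2 * τ * snK κ (r s) * (2 * τ * versK κ (r s) - a)) + D s * csK κ (r s) * deriv h s :=
    fun s hs => by rw [hkq s hs]; rfl
  have hvX : ∀ s ∈ K, snK κ (r s) * deriv r s = ε * √(D s) / √(k s)
      * (ε * (snK κ (r s) * √(k s) * deriv r s / √(D s))) := fun s hs => by
    have h1 := hk0 s hs
    have h2 := hD0 s hs
    field_simp
    rw [hε]; ring
  -- `√D/√k` is the length of `c'` in the quotient metric. The sign `ε` reverses the direction of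
  -- travel where needed, so that the mean curvature is `H` and not `-H`.
  refine ⟨fun s => ε * √(D s) / √(k s),
    fun s => ε * (snK κ (r s) * √(k s) * deriv r s / √(D s)),
    fun s => ε * (snK κ (r s) ^ 2 * deriv h s / √(D s)), hmem, ?_, ?_, ?_, ?_, ?_, ?_, ?_⟩
  · have hr1 : ContDiffOn ℝ 1 r K := hr2.of_le (by norm_num)
    have hk1 : ContDiffOn ℝ 1 k K :=
      (((contDiff_snK κ).comp_contDiffOn hr1).pow 2).add
        (((contDiffOn_const.mul ((contDiff_versK κ).comp_contDiffOn hr1)).sub contDiffOn_const).pow 2)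
    have hD1 : ContDiffOn ℝ 1 D K := (hk1.mul (hp1.pow 2)).add
      ((((contDiff_snK κ).comp_contDiffOn hr1).pow 2).mul (hq1.pow 2))
    exact (contDiffOn_const.mul (hD1.sqrt fun s hs => (hDpos s hs).ne')).div
      (hk1.sqrt fun s hs => (hkpos s hs).ne') fun s hs => (hk0 s hs).ne'
  · intro s hs
    have h1 := hk0 s hs
    have h2 := hD0 s hs
    positivity
  · intro s hs
    exact (hvs s hs).congr_deriv (hvX s hs)
  · intro s hs
    have h1 := hk0 s hs
    have h2 := hD0 s hs
    have hA := (((hsn s hs).mul ((hkd s hs).sqrt (hkpos s hs).ne')).mul (hp s hs))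
    refine ((hasDerivAt_div_sqrt_of_two_mul (hDd s hs) (hDpos s hs) hA).const_mul ε).congr_deriv ?_
    have key := reduced_X_identity h1 h2 (hDq s hs) (hDeq s hs) hε (hQ s hs) (hmean s hs)
    rw [← csK_eq]
    refine Eq.trans ?_ key
    simp only [Pi.mul_apply]
    rw [mul_div_mul_left _ _ two_ne_zero]
  · intro s hs
    have h2 := hD0 s hs
    have hA := (((hsn s hs).pow 2).mul (hq s hs))
    refine ((hasDerivAt_div_sqrt_of_two_mul (hDd s hs) (hDpos s hs) hA).const_mul ε).congr_deriv ?_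
    have key := reduced_Z_identity h2 (hDeq s hs) (hQ s hs) (hmean s hs)
    rw [← hvX s hs, ← key]
    simp only [Pi.mul_apply, Pi.pow_apply]
    push_cast
    ring
  · intro s hs
    refine (hh s hs).congr_deriv ?_
    have h1 := hk0 s hs
    have h2 := hD0 s hs
    have h3 := snK_pos (hmem s hs)
    change _ = ε * √(D s) / √(k s) * √(k s) * (ε * (snK κ (r s) ^ 2 * deriv h s / √(D s)))
      / snK κ (r s) ^ 2
    field_simp
    rw [hε]; ring
  · intro s hs
    have h2 := hD0 s hs
    change (ε * (snK κ (r s) * √(k s) * deriv r s / √(D s))) ^ 2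
      + (ε * (snK κ (r s) ^ 2 * deriv h s / √(D s))) ^ 2 = snK κ (r s) ^ 2
    rw [mul_pow, mul_pow, hε, div_pow, div_pow, one_mul, one_mul, ← add_div,
      div_eq_iff (by positivity), hDq s hs, hDeq s hs]
    ring

/-- Under `y ↦ 2/κ - y` the function `1 - κy` changes sign, and so does `2τy - a` once `a` becomes
`4τ/κ - a`. Hence `ξ` is preserved and the system is invariant when `X`, `Z` and the height are
negated. -/
theorem IsReducedCurve.swap {κ τ a H : ℝ} {K : Set ℝ} {c : ℝ → ℝ × ℝ} {v X Z : ℝ → ℝ} (hκ : 0 < κ)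
    (h : IsReducedCurve κ τ a H K c v X Z) :
    IsReducedCurve κ τ (4 * τ / κ - a) H K (swapAxes κ c) v (fun s => -X s) (fun s => -Z s) := by
  have hv : ∀ s, versK κ (swapAxes κ c s).1 = 2 / κ - versK κ (c s).1 := fun s => versK_swap hκ _
  have hs : ∀ s, snK κ (swapAxes κ c s).1 ^ 2 = snK κ (c s).1 ^ 2 := fun s => by
    rw [snK_sq, snK_sq, hv]; field_simp; ring
  have hk : ∀ s, killSq κ τ (4 * τ / κ - a) (swapAxes κ c s).1 = killSq κ τ a (c s).1 := fun s => by
    rw [killSq, killSq, hs, hv]; ring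
  refine ⟨fun s hs => swap_mem hκ (h.radius_mem s hs), h.speed_smooth, h.speed_ne, ?_, ?_, ?_, ?_,
    ?_⟩
  · intro s hs
    simp only [hv]
    exact ((h.vers_deriv s hs).const_sub (2 / κ)).congr_deriv (by ring)
  · intro s hs
    refine (h.X_deriv s hs).neg.congr_deriv ?_
    rw [hv]; field_simp; ring
  · intro s hs
    exact (h.Z_deriv s hs).neg.congr_deriv (by ring)
  · intro s hs'
    rw [hk, hs]
    exact (h.height_deriv s hs').neg.congr_deriv (by ring)
  · intro s hs'
    rw [hs, ← h.norm_sq s hs']; ring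

/-! ### Integration of the reduced system and exhaustion. -/

theorem le_Jmax_of_mul_self {κ H J y : ℝ} (hH : 0 < H) (hs : 0 < 4 * H ^ 2 + κ) (hy : 0 < y)
    (h : (J + 2 * H * y) ^ 2 ≤ y * (2 - κ * y)) : J ≤ Jmax κ H := by
  by_contra! hJ
  have h0 := freq_pos hs
  have hJ0 : 0 < J := (Jmax_pos hH hs).trans hJ
  rw [Jmax_eq hH hs, div_lt_iff₀ (by positivity)] at hJ
  have h1 := freq_sq hs
  -- Completing the square in the constraint; above `Jmax` the right-hand side is negative.
  have h2 : (freq κ H * y - J) ^ 2 ≤ 2 * y * (1 - (2 * H + freq κ H) * J) := by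
    have h3 : freq κ H ^ 2 * y ^ 2 = (4 * H ^ 2 + κ) * y ^ 2 := by rw [h1]
    linarith
  nlinarith [sq_nonneg (freq κ H * y - J), mul_pos hy (sub_pos.2 hJ)]

theorem isPieceOf_empty (c : ℝ → ℝ × ℝ) (γ : ProfileCurve) : IsPieceOf c ∅ γ :=
  ⟨0, id, mapsTo_empty _ _, contDiffOn_empty, by simp, by simp⟩

theorem contDiffOn_two_primitive {U : Set ℝ} (hU : IsOpen U) (hc : U.OrdConnected) {f : ℝ → ℝ}
    (hf : ContDiffOn ℝ 1 f U) {s : ℝ} (hs : s ∈ U) (b : ℝ) :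
    ContDiffOn ℝ 2 (fun t => b + ∫ x in s..t, f x) U := by
  have h := fun t ht => (hasDerivAt_primitive hU hc hf.continuousOn hs (t := t) ht).const_add b
  have two : (2 : WithTop ℕ∞) = 1 + 1 := by norm_num
  rw [two, contDiffOn_succ_iff_deriv_of_isOpen hU]
  exact ⟨fun t ht => (h t ht).differentiableAt.differentiableWithinAt, by simp,
    hf.congr fun t ht => (h t ht).deriv⟩

theorem exists_polar (x y : ℝ) : ∃ α : ℝ, -π < α ∧ α ≤ π ∧
    x = √(x ^ 2 + y ^ 2) * cos α ∧ y = √(x ^ 2 + y ^ 2) * sin α := by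
  have h : ‖(⟨x, y⟩ : ℂ)‖ = √(x ^ 2 + y ^ 2) := by
    rw [Complex.norm_def, Complex.normSq_mk]; ring_nf
  refine ⟨Complex.arg ⟨x, y⟩, Complex.neg_pi_lt_arg _, Complex.arg_le_pi _, ?_, ?_⟩
  · rw [← h, Complex.norm_mul_cos_arg]
  · rw [← h, Complex.norm_mul_sin_arg]

theorem versSol_pi_div {κ H t : ℝ}
    (ht : cos (freq κ H * t) = -1) : versSol κ H 0 t = 0 := by
  rw [versSol, versMean_zero, versAmp_zero, ht]; ring

/-- By energy conservation the system is a rotation of `(ω(y - M), X)` with angular velocity `-ωv`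
on a circle of radius `ρ = Aω`. Integrating `v` from the right phase turns `y` into `versSol` of the
new parameter; the heights then have equal derivatives. -/
theorem IsReducedCurve.isPieceOf {κ τ a H J : ℝ} (hH : 0 < H) (hsup : 0 < 4 * H ^ 2 + κ)
    (hJ : J ∈ energyRange κ H) {K : Set ℝ} (hK : IsOpen K) (hKc : K.OrdConnected)
    {c : ℝ → ℝ × ℝ} {v X Z : ℝ → ℝ} (h : IsReducedCurve κ τ a H K c v X Z) {s₀ : ℝ} (hs₀ : s₀ ∈ K)
    (hJs : Z s₀ - 2 * H * versK κ (c s₀).1 = J) : IsPieceOf c K (family κ τ H a J) := by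
  set Y : ℝ → ℝ := fun s => versK κ (c s).1 with hY
  have hf := freq_pos hsup
  have hf2 := freq_sq hsup
  have hm := versMean_mul (J := J) hsup
  have hYpos : ∀ s ∈ K, 0 < Y s := fun s hs => (versK_mem (h.radius_mem s hs)).1
  have hZ : ∀ s ∈ K, Z s = J + 2 * H * Y s := by
    intro s hs
    have := eq_of_hasDerivAt_zero hKc (f := fun s => Z s - 2 * H * Y s) (fun t ht =>
      ((h.Z_deriv t ht).sub ((h.vers_deriv t ht).const_mul (2 * H))).congr_deriv (by ring)) hs hs₀
    rw [hJs] at this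
    linarith
  set M := versMean κ H J
  set ρ := versAmp κ H J * freq κ H with hρ
  have hρ0 : 0 ≤ ρ := mul_nonneg (versAmp_nonneg hsup) hf.le
  have hnorm : ∀ s ∈ K, (freq κ H * (Y s - M)) ^ 2 + X s ^ 2 = ρ ^ 2 := by
    intro s hs
    have h1 := h.norm_sq s hs
    rw [snK_sq, hZ s hs] at h1
    have h2 := versAmp_sq hH hsup hJ
    have h3 : versAmp κ H J ^ 2 * (4 * H ^ 2 + κ) = M ^ 2 * (4 * H ^ 2 + κ) - J ^ 2 := by
      refine mul_right_cancel₀ hsup.ne' ?_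
      linear_combination h2 - (M * (4 * H ^ 2 + κ) + 1 - 2 * H * J) * hm
    rw [hρ, mul_pow, mul_pow, hf2]
    change X s ^ 2 + _ = Y s * (2 - κ * Y s) at h1
    linear_combination h1 - h3 - 2 * Y s * hm
  obtain ⟨α, hα1, hα2, hαx, hαy⟩ := exists_polar (freq κ H * (Y s₀ - M)) (X s₀)
  rw [hnorm s₀ hs₀, Real.sqrt_sq hρ0] at hαx hαy
  -- The phase is `-α/ω` because the derivative `versSol'` carries a minus sine, while `X = ρ sin α`
  -- at `s₀`.
  set φ : ℝ → ℝ := fun s => -α / freq κ H + ∫ x in s₀..s, v x with hφ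
  have hφd : ∀ s ∈ K, HasDerivAt φ (v s) s := fun s hs =>
    (hasDerivAt_primitive hK hKc h.speed_smooth.continuousOn hs₀ hs).const_add _
  have hφ0 : freq κ H * φ s₀ = -α := by
    simp only [hφ, intervalIntegral.integral_same, add_zero]; field_simp
  have hΩφ : ∀ s ∈ K, HasDerivAt (fun s => freq κ H * φ s) (freq κ H * v s) s := fun s hs =>
    (hφd s hs).const_mul _
  have hP : ∀ s ∈ K, HasDerivAt (fun s => freq κ H * (Y s - M)) (freq κ H * (v s * X s)) s :=
    fun s hs => ((h.vers_deriv s hs).sub_const M).const_mul _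
  have hX : ∀ s ∈ K, HasDerivAt X (-(v s * freq κ H * (freq κ H * (Y s - M)))) s := fun s hs => by
    refine (h.X_deriv s hs).congr_deriv ?_
    rw [hZ s hs]
    change v s * (1 - κ * Y s - _) = _
    linear_combination v s * ((Y s - M) * hf2 - hm)
  have hU : ∀ s ∈ K, freq κ H * (Y s - M) * cos (freq κ H * φ s) - X s * sin (freq κ H * φ s)
      = ρ := by
    intro s hs
    have := eq_of_hasDerivAt_zero hKc (f := fun s => freq κ H * (Y s - M) * cos (freq κ H * φ s)
        - X s * sin (freq κ H * φ s)) (fun t ht =>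
      (((hP t ht).mul (hΩφ t ht).cos).sub ((hX t ht).mul (hΩφ t ht).sin)).congr_deriv (by ring))
      hs hs₀
    rw [this, hφ0, Real.cos_neg, Real.sin_neg, hαx, hαy]
    linear_combination ρ * Real.sin_sq_add_cos_sq α
  have hV : ∀ s ∈ K, freq κ H * (Y s - M) * sin (freq κ H * φ s) + X s * cos (freq κ H * φ s)
      = 0 := by
    intro s hs
    have := eq_of_hasDerivAt_zero hKc (f := fun s => freq κ H * (Y s - M) * sin (freq κ H * φ s)
        + X s * cos (freq κ H * φ s)) (fun t ht =>
      (((hP t ht).mul (hΩφ t ht).sin).add ((hX t ht).mul (hΩφ t ht).cos)).congr_deriv (by ring))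
      hs hs₀
    rw [this, hφ0, Real.cos_neg, Real.sin_neg, hαx, hαy]
    ring
  have hYφ : ∀ s ∈ K, Y s = versSol κ H J (φ s) := by
    intro s hs
    have h1 : freq κ H * (Y s - M) = ρ * cos (freq κ H * φ s) := by
      linear_combination cos (freq κ H * φ s) * hU s hs + sin (freq κ H * φ s) * hV s hs
        - freq κ H * (Y s - M) * Real.sin_sq_add_cos_sq (freq κ H * φ s)
    have h2 : Y s - M = versAmp κ H J * cos (freq κ H * φ s) := by
      refine mul_left_cancel₀ hf.ne' ?_
      rw [h1, hρ]; ring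
    rw [versSol]; linarith
  have hdom : MapsTo φ K (solDom κ H J) := by
    by_cases hJ0 : J = 0
    swap
    · rw [solDom_of_ne hJ0]; exact fun _ _ => trivial
    subst hJ0
    rw [solDom, if_pos rfl]
    have hne : ∀ s ∈ K, cos (freq κ H * φ s) ≠ -1 := fun s hs hcos =>
      (hYpos s hs).ne' ((hYφ s hs).trans (versSol_pi_div hcos))
    -- At energy zero `y > 0` keeps `φ` off the points `±π/ω`. Since `α ∈ (-π, π]`, the value at
    -- `s₀` lies between them, and connectedness keeps the whole image there.
    have himg : (φ '' K).OrdConnected := (hKc.isPreconnected.image φ fun s hs =>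
      (hφd s hs).continuousAt.continuousWithinAt).ordConnected
    have hT1 : π / freq κ H ∉ φ '' K := by
      rintro ⟨s, hs, hsT⟩
      refine hne s hs ?_
      rw [hsT, mul_div_cancel₀ _ hf.ne', Real.cos_pi]
    have hT2 : -(π / freq κ H) ∉ φ '' K := by
      rintro ⟨s, hs, hsT⟩
      refine hne s hs ?_
      rw [hsT, mul_neg, mul_div_cancel₀ _ hf.ne', Real.cos_neg, Real.cos_pi]
    have h0 : φ s₀ = -α / freq κ H := by rw [eq_div_iff hf.ne']; linarith
    have hs0T : φ s₀ < π / freq κ H := by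
      rw [h0]; exact div_lt_div_of_pos_right (by linarith) hf
    have hs0T' : -(π / freq κ H) < φ s₀ := by
      refine lt_of_le_of_ne ?_ fun e => hT2 ⟨s₀, hs₀, e.symm⟩
      rw [h0, ← neg_div]; exact div_le_div_of_nonneg_right (by linarith) hf.le
    intro s hs
    constructor
    · by_contra! hcon
      exact hT2 (himg.out (mem_image_of_mem φ hs) (mem_image_of_mem φ hs₀) ⟨hcon, hs0T'.le⟩)
    · by_contra! hcon
      exact hT1 (himg.out (mem_image_of_mem φ hs₀) (mem_image_of_mem φ hs) ⟨hs0T.le, hcon⟩)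
  refine ⟨(c s₀).2 - (family κ τ H a J).h (φ s₀), φ, hdom,
    contDiffOn_two_primitive hK hKc h.speed_smooth hs₀ _,
    fun s hs => (hφd s hs).deriv ▸ h.speed_ne s hs, fun s hs => Prod.ext ?_ ?_⟩
  · change (c s).1 = arcversK κ (versSol κ H J (φ s))
    rw [← hYφ s hs, hY, arcversK_versK (h.radius_mem s hs)]
  · have := eq_of_hasDerivAt_zero hKc (f := fun s => (c s).2 - (family κ τ H a J).h (φ s))
      (fun t ht => by
        refine ((h.height_deriv t ht).sub
          ((hasDerivAt_family_h hH hsup hJ τ a (hdom ht)).comp t (hφd t ht))).congr_deriv ?_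
        have e1 : snK κ (c t).1 ^ 2 = snSq κ H J (φ t) := by
          rw [snK_sq, snSq, ← hYφ t ht]
        have e2 : √(killSq κ τ a (c t).1) = killing κ τ a H J (φ t) := by
          rw [killing, killSq, e1, ← hYφ t ht]
        rw [e1, e2, hZ t ht, momentum, hYφ t ht]
        ring) hs hs₀
    simp only at this ⊢
    linarith

theorem exhaustion {κ τ a H : ℝ} (hH : 0 < H) (hsup : 0 < 4 * H ^ 2 + κ) {K : Set ℝ}
    {c : ℝ → ℝ × ℝ} (hK : IsOpen K) (hKc : K.OrdConnected) (hc : ContDiffOn ℝ 2 c K)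
    (hreg : ∀ s ∈ K, (c s).1 ∈ radii κ ∧ deriv c s ≠ 0)
    (hcmc : HasCMC κ τ H (K ×ˢ univ) (screwParam a c)) :
    (∃ J ∈ energyRange κ H, IsPieceOf c K (family κ τ H a J)) ∨
      (0 < κ ∧ ∃ J ∈ energyRange κ H,
        IsPieceOf (swapAxes κ c) K (family κ τ H (4 * τ / κ - a) J)) := by
  rcases K.eq_empty_or_nonempty with rfl | ⟨s₀, hs₀⟩
  · exact Or.inl ⟨0, zero_mem_energyRange hH hsup, isPieceOf_empty _ _⟩
  obtain ⟨v, X, Z, hred⟩ := exists_isReducedCurve hK hKc hc hreg hcmc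
  have hle : ∀ {a : ℝ} {c : ℝ → ℝ × ℝ} {X Z : ℝ → ℝ}, IsReducedCurve κ τ a H K c v X Z →
      Z s₀ - 2 * H * versK κ (c s₀).1 ≤ Jmax κ H := by
    intro a c X Z hred
    refine le_Jmax_of_mul_self hH hsup (versK_mem (hred.radius_mem s₀ hs₀)).1 ?_
    rw [← snK_sq, ← hred.norm_sq s₀ hs₀, sub_add_cancel]
    linarith [sq_nonneg (X s₀)]
  by_cases hJ : 0 ≤ 2 * H + κ * (Z s₀ - 2 * H * versK κ (c s₀).1)
  · exact Or.inl ⟨_, (mem_energyRange_iff hH hsup).2 ⟨hle hred, hJ⟩,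
      hred.isPieceOf hH hsup ((mem_energyRange_iff hH hsup).2 ⟨hle hred, hJ⟩) hK hKc hs₀ rfl⟩
  -- The energy falls short of `-2H/κ`. This requires `κ > 0`, and the exchange of the axes flips
  -- the sign of `2H + κJ`.
  · have hκ : 0 < κ := by
      by_contra! hκ
      have h1 := mul_le_mul_of_nonpos_left (hle hred) hκ
      have h2 := ((mem_energyRange_iff hH hsup).1 (Jmax_mem_energyRange hH hsup)).2
      linarith
    have hred' := hred.swap hκ
    have hJ' : 0 ≤ 2 * H + κ * (-Z s₀ - 2 * H * versK κ (swapAxes κ c s₀).1) := by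
      have : versK κ (swapAxes κ c s₀).1 = 2 / κ - versK κ (c s₀).1 := versK_swap hκ _
      rw [this]
      have h3 : κ * (2 / κ) = 2 := by field_simp
      nlinarith
    exact Or.inr ⟨hκ, _, (mem_energyRange_iff hH hsup).2 ⟨hle hred', hJ'⟩,
      hred'.isPieceOf hH hsup ((mem_energyRange_iff hH hsup).2 ⟨hle hred', hJ'⟩) hK hKc hs₀ rfl⟩

/-! ### Invariant surfaces and their immersions -/

theorem ProfileCurve.mem_surface_iff {γ : ProfileCurve} {a : ℝ} {x : Pt} :
    x ∈ γ.surface a ↔ ∃ t ∈ γ.dom, ∃ φ : ℝ, x = toPt (screwParam a γ.curve (t, φ)) := by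
  simp [ProfileCurve.surface, screw, toPt, screwParam, ProfileCurve.curve]

theorem toPt_screwParam_add (a : ℝ) (c : ℝ → ℝ × ℝ) (s φ ψ : ℝ) :
    toPt (screwParam a c (s, φ + ψ)) = screw a ψ (toPt (screwParam a c (s, φ))) := by
  simp [screw, toPt, screwParam, mul_add, add_assoc]

theorem contDiffOn_screwParam (a : ℝ) {c : ℝ → ℝ × ℝ} {K : Set ℝ} (hc : ContDiffOn ℝ ∞ c K) :
    ContDiffOn ℝ ∞ (screwParam a c) (K ×ˢ univ) := by
  have h : ContDiffOn ℝ ∞ (fun p : ℝ × ℝ => c p.1) (K ×ˢ univ) :=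
    hc.comp contDiff_fst.contDiffOn fun p hp => hp.1
  exact (contDiff_fst.comp_contDiffOn h).prodMk (contDiff_snd.contDiffOn.prodMk
    ((contDiff_snd.comp_contDiffOn h).add (contDiff_const.mul contDiff_snd).contDiffOn))

theorem injective_fderiv_screwParam (a : ℝ) {c : ℝ → ℝ × ℝ} {s : ℝ} (hc : DifferentiableAt ℝ c s)
    (hreg : deriv c s ≠ 0) (φ : ℝ) : Function.Injective (fderiv ℝ (screwParam a c) (s, φ)) := by
  have h := hc.hasDerivAt
  rw [(hasFDerivAt_screwParam a (hasFDerivAt_fst.comp_hasDerivAt s h)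
    (hasFDerivAt_snd.comp_hasDerivAt s h) φ).fderiv]
  rw [injective_iff_map_eq_zero]
  rintro ⟨x, y⟩ hxy
  simp only [ContinuousLinearMap.prod_apply, smul_apply, ContinuousLinearMap.coe_fst',
    ContinuousLinearMap.coe_snd', smul_eq_mul, add_apply, Prod.mk_eq_zero] at hxy
  obtain ⟨h1, rfl, h2⟩ := hxy
  simp only [mul_zero, add_zero] at h2
  have hx : x = 0 := by
    by_contra hx
    exact hreg (Prod.ext ((mul_eq_zero.1 h1).resolve_right hx)
      ((mul_eq_zero.1 h2).resolve_right hx))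
  rw [hx]; rfl

theorem dense_prod_univ {S : Set ℝ} (hS : Dense S) {T : Set (ℝ × ℝ)}
    (h : ∀ p : ℝ × ℝ, p.1 ∈ S → p ∈ T) : Dense T :=
  (hS.prod dense_univ).mono fun p hp => h p hp.1

/-- Because the angle is lifted to `ℝ`, coincidences of the surface are exactly coincidences of the
profile curve. -/
theorem screwParam_eq_iff {a : ℝ} {c : ℝ → ℝ × ℝ} {p p' : ℝ × ℝ} :
    screwParam a c p' = screwParam a c p ↔ p'.2 = p.2 ∧ c p'.1 = c p.1 := by
  simp only [screwParam, Prod.ext_iff]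
  constructor
  · rintro ⟨h1, h2, h3⟩
    rw [h2] at h3
    exact ⟨h2, h1, by linarith⟩
  · rintro ⟨h1, h2, h3⟩
    exact ⟨h2, h1, by rw [h1, h3]⟩

theorem isImmersedPlane_surface (a : ℝ) {γ : ProfileCurve} (hdom : γ.dom = univ)
    (hc : ContDiff ℝ ∞ γ.curve) (hreg : ∀ s, deriv γ.curve s ≠ 0)
    (hdense : Dense {s | ∀ s', γ.curve s' = γ.curve s → s' = s}) :
    IsImmersedPlane a (γ.surface a) := by
  refine ⟨fun p => toPt (screwParam a γ.curve p), ⟨screwParam a γ.curve, ?_, ?_, fun p => rfl, ?_⟩,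
    toPt_screwParam_add a γ.curve, ?_⟩
  · rw [← contDiffOn_univ, ← univ_prod_univ]
    exact contDiffOn_screwParam a hc.contDiffOn
  · exact fun p => injective_fderiv_screwParam a (hc.differentiable (by simp) _) (hreg _) _
  · refine dense_prod_univ hdense fun p hp p' h => ?_
    rw [screwParam_eq_iff] at h
    exact Prod.ext (hp _ h.2) h.1
  · ext x
    rw [ProfileCurve.mem_surface_iff, hdom]
    simp [eq_comm]

theorem isInvariantImmersion_rotational {γ : ProfileCurve} (hdom : γ.dom = univ)
    (hc : ContDiff ℝ ∞ γ.curve) (hreg : ∀ s, deriv γ.curve s ≠ 0)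
    (hdense : Dense {s | ∀ s', γ.curve s' = γ.curve s → s' = s}) :
    IsInvariantImmersion 0 (fun p : ℝ × ℝ => (p.1, (p.2 : Real.Angle)))
      (fun x : ℝ × Real.Angle => (γ.r x.1, x.2, γ.h x.1)) (γ.surface 0) := by
  have hF : ∀ p : ℝ × ℝ, toPt (screwParam 0 γ.curve p) = (γ.r p.1, (p.2 : Real.Angle), γ.h p.1) := by
    intro p; simp [toPt, screwParam, ProfileCurve.curve]
  refine ⟨⟨screwParam 0 γ.curve, ?_, ?_, fun p => (hF p).symm, ?_⟩, ?_, ?_⟩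
  · rw [← contDiffOn_univ, ← univ_prod_univ]
    exact contDiffOn_screwParam 0 hc.contDiffOn
  · exact fun p => injective_fderiv_screwParam 0 (hc.differentiable (by simp) _) (hreg _) _
  · refine dense_prod_univ hdense fun p hp p' h => ?_
    rw [screwParam_eq_iff] at h
    simp only [h.1, hp _ h.2]
  · intro s φ ψ
    simp [screw]
  · ext x
    rw [ProfileCurve.mem_surface_iff, hdom]
    constructor
    · rintro ⟨⟨t, θ⟩, rfl⟩
      induction θ using Real.Angle.induction_on with
      | h φ => exact ⟨t, trivial, φ, (hF (t, φ)).symm⟩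
    · rintro ⟨t, -, φ, rfl⟩
      exact ⟨(t, φ), (hF (t, φ)).symm⟩

/-- Forgetting the radius leaves the product of the strictly monotone height with the identity of
the circle, already an embedding. -/
theorem isEmbedding_rotational {α : Type*} [LinearOrder α] [TopologicalSpace α] [OrderTopology α]
    [PreconnectedSpace α] {r h : α → ℝ} (hr : Continuous r) (hh : Continuous h)
    (hmono : StrictMono h) :
    IsEmbedding (fun x : α × Real.Angle => ((r x.1, x.2, h x.1) : Pt)) := by
  have he : IsEmbedding h :=
    hmono.isEmbedding_of_ordConnected (isPreconnected_range hh).ordConnected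
  have hg : Continuous (fun x : Pt => (x.2.2, x.2.1)) := by fun_prop
  refine IsEmbedding.of_comp (g := fun x : Pt => (x.2.2, x.2.1)) ?_ hg ?_
  · fun_prop
  · exact he.prodMap IsEmbedding.id

/-! ### Closed profile curves -/

/-- Closed curves are normalized to period `2π`, so that `toReal` lets them descend to `Real.Angle`
despite its jump. -/
theorem Function.Periodic.comp_toReal {β : Type*} {f : ℝ → β} (hf : Function.Periodic f (2 * π))
    (u : ℝ) : f ((u : Real.Angle).toReal) = f u := by
  have h : (((u : Real.Angle).toReal : ℝ) : Real.Angle) = u := Real.Angle.coe_toReal _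
  obtain ⟨k, hk⟩ := Real.Angle.angle_eq_iff_two_pi_dvd_sub.1 h
  have : (u : Real.Angle).toReal = u + k * (2 * π) := by linarith
  rw [this]
  exact hf.int_mul k u

theorem Function.Periodic.continuous_comp_toReal {β : Type*} [TopologicalSpace β] {f : ℝ → β}
    (hf : Function.Periodic f (2 * π)) (hc : Continuous f) :
    Continuous fun θ : Real.Angle => f θ.toReal := by
  have hq : IsQuotientMap ((↑) : ℝ → Real.Angle) := QuotientAddGroup.isQuotientMap_mk _
  rw [hq.continuous_iff]
  have : (fun θ : Real.Angle => f θ.toReal) ∘ ((↑) : ℝ → Real.Angle) = f :=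
    funext fun u => hf.comp_toReal u
  rwa [this]

instance compactSpace_angle : CompactSpace Real.Angle :=
  haveI : Fact (0 < 2 * π) := ⟨Real.two_pi_pos⟩
  inferInstanceAs (CompactSpace (AddCircle (2 * π)))

theorem isImmersedTubularCylinder_range (a : ℝ) {c : ℝ → ℝ × ℝ}
    (hc : ContDiff ℝ ∞ c) (hreg : ∀ s, deriv c s ≠ 0)
    (hloop : ∀ s t, c s = c t ↔ (s : Real.Angle) = t) :
    IsImmersedTubularCylinder a (range fun p => toPt (screwParam a c p)) := by
  have hper : Function.Periodic c (2 * π) := fun s => (hloop _ _).2 (by simp)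
  have hF : ∀ s φ : ℝ, toPt (screwParam a c ((s : Real.Angle).toReal, φ))
      = toPt (screwParam a c (s, φ)) := by
    intro s φ
    simp only [screwParam, hper.comp_toReal]
  refine ⟨fun x => toPt (screwParam a c (x.1.toReal, x.2)),
    ⟨screwParam a c, ?_, ?_, fun p => hF _ _, ?_⟩, ?_, ?_⟩
  · rw [← contDiffOn_univ, ← univ_prod_univ]
    exact contDiffOn_screwParam a hc.contDiffOn
  · exact fun p => injective_fderiv_screwParam a (hc.differentiable (by simp) _) (hreg _) _
  · refine dense_prod_univ dense_univ fun p _ p' h => ?_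
    rw [screwParam_eq_iff, hloop] at h
    exact Prod.ext h.2 h.1
  · intro s φ ψ
    exact toPt_screwParam_add a c _ φ ψ
  · ext x
    constructor
    · rintro ⟨⟨θ, φ⟩, rfl⟩
      exact ⟨(θ.toReal, φ), rfl⟩
    · rintro ⟨⟨s, φ⟩, rfl⟩
      exact ⟨((s : Real.Angle), φ), hF s φ⟩

theorem isEmbeddedTorus_range {c : ℝ → ℝ × ℝ}
    (hc : ContDiff ℝ ∞ c) (hreg : ∀ s, deriv c s ≠ 0)
    (hloop : ∀ s t, c s = c t ↔ (s : Real.Angle) = t) :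
    IsEmbeddedTorus 0 (range fun p => toPt (screwParam 0 c p)) := by
  have hper : Function.Periodic c (2 * π) := fun s => (hloop _ _).2 (by simp)
  have hF : ∀ s φ : ℝ, toPt (screwParam 0 c (s, φ))
      = ((c (s : Real.Angle).toReal).1, (φ : Real.Angle), (c (s : Real.Angle).toReal).2) := by
    intro s φ
    simp [toPt, screwParam, hper.comp_toReal]
  have hcont := hper.continuous_comp_toReal hc.continuous
  refine ⟨fun x => ((c x.1.toReal).1, x.2, (c x.1.toReal).2),
    ⟨⟨screwParam 0 c, ?_, ?_, fun p => (hF _ _).symm, ?_⟩, ?_, ?_⟩, ?_⟩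
  · rw [← contDiffOn_univ, ← univ_prod_univ]
    exact contDiffOn_screwParam 0 hc.contDiffOn
  · exact fun p => injective_fderiv_screwParam 0 (hc.differentiable (by simp) _) (hreg _) _
  · refine dense_prod_univ dense_univ fun p _ p' h => ?_
    rw [screwParam_eq_iff, hloop] at h
    simp only [h.1, h.2]
  · intro s φ ψ
    simp [screw]
  · ext x
    constructor
    · rintro ⟨⟨θ, ψ⟩, rfl⟩
      induction ψ using Real.Angle.induction_on with
      | h φ => exact ⟨(θ.toReal, φ), by simp only [hF, Real.Angle.coe_toReal]⟩
    · rintro ⟨⟨s, φ⟩, rfl⟩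
      exact ⟨((s : Real.Angle), (φ : Real.Angle)), (hF s φ).symm⟩
  -- A continuous injection of a compact space into a Hausdorff space is an embedding.
  · refine (Continuous.isClosedEmbedding ?_ ?_).isEmbedding
    · exact (continuous_fst.comp (hcont.comp continuous_fst)).prodMk
        (continuous_snd.prodMk (continuous_snd.comp (hcont.comp continuous_fst)))
    · rintro ⟨θ, ψ⟩ ⟨θ', ψ'⟩ h
      simp only [Prod.mk.injEq] at h
      have h1 := (hloop _ _).1 (Prod.ext h.1 h.2.2)
      rw [Real.Angle.coe_toReal, Real.Angle.coe_toReal] at h1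
      exact Prod.ext h1 h.2.1

/-! ### The twice punctured sphere -/

theorem mem_twicePuncturedSphere_iff {x : EuclideanSpace ℝ (Fin 3)} :
    x ∈ twicePuncturedSphere ↔ x 0 ^ 2 + x 1 ^ 2 + x 2 ^ 2 = 1 ∧ 0 < x 0 ^ 2 + x 1 ^ 2 := by
  have hn : ‖x‖ = 1 ↔ x 0 ^ 2 + x 1 ^ 2 + x 2 ^ 2 = 1 := by
    rw [EuclideanSpace.norm_eq, Real.sqrt_eq_one, Fin.sum_univ_three]
    simp only [Real.norm_eq_abs, sq_abs]
  rw [twicePuncturedSphere, mem_ofPred_eq, hn, and_congr_right_iff]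
  intro h
  constructor
  · rintro ⟨h1, h2⟩
    by_contra hcon
    have h0 : x 0 = 0 := by nlinarith [sq_nonneg (x 0), sq_nonneg (x 1)]
    have h1' : x 1 = 0 := by nlinarith [sq_nonneg (x 0), sq_nonneg (x 1)]
    have h3 : x 2 * x 2 = 1 := by rw [h0, h1'] at h; linarith
    rcases mul_self_eq_one_iff.1 h3 with h4 | h4
    · refine h1 ?_
      ext i; fin_cases i <;> simp [h0, h1', h4]
    · refine h2 ?_
      ext i; fin_cases i <;> simp [h0, h1', h4]
  · intro hpos
    constructor <;> rintro rfl <;> simp at hpos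

/-- The point of the unit sphere with height `z` and longitude `θ`. -/
noncomputable def spherePoint (z : ℝ) (θ : Real.Angle) : EuclideanSpace ℝ (Fin 3) :=
  !₂[√(1 - z ^ 2) * θ.cos, √(1 - z ^ 2) * θ.sin, z]

/-- The longitude of a point off the vertical axis. -/
noncomputable def longitude (x : EuclideanSpace ℝ (Fin 3)) : Real.Angle :=
  (Complex.arg ((x 0 : ℂ) + (x 1 : ℂ) * Complex.I) : ℝ)

theorem continuous_spherePoint : Continuous fun x : ℝ × Real.Angle => spherePoint x.1 x.2 := by
  refine (PiLp.continuous_toLp 2 _).comp (continuous_pi fun i => ?_)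
  fin_cases i
  · exact Continuous.mul (by fun_prop) (Real.Angle.continuous_cos.comp continuous_snd)
  · exact Continuous.mul (by fun_prop) (Real.Angle.continuous_sin.comp continuous_snd)
  · exact continuous_fst

theorem one_sub_sq_pos {z : ℝ} (hz : z ∈ Ioo (-1) 1) : 0 < 1 - z ^ 2 := by
  have := mul_pos (sub_pos.2 hz.2) (neg_lt_iff_pos_add.1 hz.1)
  linarith

theorem spherePoint_mem {z : ℝ} (hz : z ∈ Ioo (-1) 1) (θ : Real.Angle) :
    spherePoint z θ ∈ twicePuncturedSphere := by
  have h1 := one_sub_sq_pos hz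
  have h2 : √(1 - z ^ 2) ^ 2 = 1 - z ^ 2 := Real.sq_sqrt h1.le
  have h3 := Real.Angle.cos_sq_add_sin_sq θ
  have h4 : (√(1 - z ^ 2) * θ.cos) ^ 2 + (√(1 - z ^ 2) * θ.sin) ^ 2 = 1 - z ^ 2 := by
    rw [mul_pow, mul_pow, ← mul_add, h3, h2, mul_one]
  rw [mem_twicePuncturedSphere_iff]
  change (√(1 - z ^ 2) * θ.cos) ^ 2 + (√(1 - z ^ 2) * θ.sin) ^ 2 + z ^ 2 = 1
    ∧ 0 < (√(1 - z ^ 2) * θ.cos) ^ 2 + (√(1 - z ^ 2) * θ.sin) ^ 2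
  rw [h4]
  exact ⟨by ring, h1⟩

theorem longitude_spherePoint {z : ℝ} (hz : z ∈ Ioo (-1) 1) (θ : Real.Angle) :
    longitude (spherePoint z θ) = θ := by
  have h1 := Real.sqrt_pos.2 (one_sub_sq_pos hz)
  have h := Complex.arg_mul_cos_add_sin_mul_I_coe_angle h1 θ
  rw [longitude]
  change ((Complex.arg ((√(1 - z ^ 2) * θ.cos : ℝ) + (√(1 - z ^ 2) * θ.sin : ℝ) * Complex.I) : ℝ) :
    Real.Angle) = θ
  convert h using 3
  push_cast; ring

theorem height_mem {x : EuclideanSpace ℝ (Fin 3)} (hx : x ∈ twicePuncturedSphere) :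
    x 2 ∈ Ioo (-1) 1 := by
  obtain ⟨h1, h2⟩ := mem_twicePuncturedSphere_iff.1 hx
  exact abs_lt.1 ((sq_lt_one_iff_abs_lt_one _).1 (by linarith))

theorem spherePoint_longitude {x : EuclideanSpace ℝ (Fin 3)} (hx : x ∈ twicePuncturedSphere) :
    spherePoint (x 2) (longitude x) = x := by
  obtain ⟨h1, h2⟩ := mem_twicePuncturedSphere_iff.1 hx
  have h3 : √(1 - x 2 ^ 2) = ‖((x 0 : ℂ) + (x 1 : ℂ) * Complex.I)‖ := by
    rw [Complex.norm_add_mul_I]; congr 1; linarith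
  ext i
  fin_cases i
  · change √(1 - x 2 ^ 2) * (longitude x).cos = x 0
    rw [longitude, Real.Angle.cos_coe, h3, Complex.norm_mul_cos_arg]; simp
  · change √(1 - x 2 ^ 2) * (longitude x).sin = x 1
    rw [longitude, Real.Angle.sin_coe, h3, Complex.norm_mul_sin_arg]; simp
  · rfl

/-- The jump of `Complex.arg` across the negative axis disappears modulo `2π`, and the poles are
excluded. -/
theorem continuousOn_longitude : ContinuousOn longitude twicePuncturedSphere := by
  intro x hx
  obtain ⟨-, h2⟩ := mem_twicePuncturedSphere_iff.1 hx
  have hne : (x 0 : ℂ) + (x 1 : ℂ) * Complex.I ≠ 0 := by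
    intro h
    have hr := congrArg Complex.re h
    have hi := congrArg Complex.im h
    simp at hr hi
    rw [hr, hi] at h2
    simp at h2
  have hc : Continuous fun x : EuclideanSpace ℝ (Fin 3) =>
      ((x 0 : ℂ) + (x 1 : ℂ) * Complex.I) := by fun_prop
  exact (ContinuousAt.comp (f := fun x : EuclideanSpace ℝ (Fin 3) =>
    ((x 0 : ℂ) + (x 1 : ℂ) * Complex.I)) (Complex.continuousAt_arg_coe_angle hne)
    hc.continuousAt).continuousWithinAt

theorem div_mem_Ioo {T : ℝ} (hT : 0 < T) (t : Ioo (-T) T) : (t : ℝ) / T ∈ Ioo (-1 : ℝ) 1 :=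
  ⟨by rw [lt_div_iff₀ hT]; linarith [t.2.1], by rw [div_lt_iff₀ hT]; linarith [t.2.2]⟩

/-- Cylindrical coordinates on the twice punctured sphere. -/
noncomputable def sphereHomeomorph {T : ℝ} (hT : 0 < T) :
    Ioo (-T) T × Real.Angle ≃ₜ twicePuncturedSphere where
  toFun x := ⟨spherePoint (x.1 / T) x.2, spherePoint_mem (div_mem_Ioo hT x.1) x.2⟩
  invFun x := ⟨⟨T * x.1 2, by nlinarith [(height_mem x.2).1], by nlinarith [(height_mem x.2).2]⟩,
    longitude x.1⟩
  left_inv x := by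
    refine Prod.ext (Subtype.ext ?_) (longitude_spherePoint (div_mem_Ioo hT x.1) x.2)
    exact mul_div_cancel₀ _ hT.ne'
  right_inv x := by
    refine Subtype.ext ?_
    simp only [mul_div_cancel_left₀ _ hT.ne']
    exact spherePoint_longitude x.2
  continuous_toFun := Continuous.subtype_mk (continuous_spherePoint.comp
    (((continuous_subtype_val.comp continuous_fst).div_const T).prodMk continuous_snd)) _
  continuous_invFun := by
    refine Continuous.prodMk (Continuous.subtype_mk (by fun_prop) _) ?_
    exact continuousOn_iff_continuous_domRestrict.1 continuousOn_longitude

/-! ### Elementary properties of the family -/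

/-- The period of the versed radius. -/
noncomputable def period (κ H : ℝ) : ℝ := 2 * π / freq κ H

theorem period_pos {κ H : ℝ} (hs : 0 < 4 * H ^ 2 + κ) : 0 < period κ H :=
  div_pos Real.two_pi_pos (freq_pos hs)

theorem freq_mul_add_period {κ H : ℝ} (hs : 0 < 4 * H ^ 2 + κ) (t : ℝ) :
    freq κ H * (t + period κ H) = freq κ H * t + 2 * π := by
  have := (freq_pos hs).ne'
  rw [period]; field_simp

theorem versSol_periodic {κ H : ℝ} (hs : 0 < 4 * H ^ 2 + κ) (J : ℝ) :
    Function.Periodic (versSol κ H J) (period κ H) := fun t => by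
  rw [versSol, freq_mul_add_period hs, Real.cos_add_two_pi, ← versSol]

theorem versSol'_periodic {κ H : ℝ} (hs : 0 < 4 * H ^ 2 + κ) (J : ℝ) :
    Function.Periodic (versSol' κ H J) (period κ H) := fun t => by
  rw [versSol', freq_mul_add_period hs, Real.sin_add_two_pi, ← versSol']

theorem versSol_neg (κ H J t : ℝ) : versSol κ H J (-t) = versSol κ H J t := by
  rw [versSol, mul_neg, Real.cos_neg, ← versSol]

theorem versSol_le {κ H : ℝ} (hs : 0 < 4 * H ^ 2 + κ) (J t : ℝ) :
    versSol κ H J t ≤ versSol κ H J 0 := by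
  have h1 := versAmp_nonneg (J := J) hs
  have h2 := Real.cos_le_one (freq κ H * t)
  simp only [versSol, mul_zero, Real.cos_zero]
  nlinarith

theorem family_r_periodic {κ H : ℝ} (hs : 0 < 4 * H ^ 2 + κ) (J τ a : ℝ) :
    Function.Periodic (family κ τ H a J).r (period κ H) := fun t => by
  simp only [family, versSol_periodic hs J t]

/-- The derivative of the height along the solution. -/
noncomputable def heightRate (κ τ a H J t : ℝ) : ℝ :=
  killing κ τ a H J t * momentum κ H J t / snSq κ H J t

/-- The rate depends on time only through `y`; therefore the periodicity and evenness of `y` give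
the translation law and oddness of `h`. -/
theorem heightRate_congr {κ τ a H J s t : ℝ} (h : versSol κ H J s = versSol κ H J t) :
    heightRate κ τ a H J s = heightRate κ τ a H J t := by
  simp only [heightRate, killing, momentum, snSq, h]

theorem mem_solDom_of_ne {κ H J : ℝ} (hJ : J ≠ 0) (t : ℝ) : t ∈ solDom κ H J := by
  rw [solDom_of_ne hJ]; trivial

theorem family_zero_h (κ τ H a J : ℝ) : (family κ τ H a J).h 0 = 0 := by simp [family]

section family

variable {κ H J : ℝ}

theorem family_h_add_period (hH : 0 < H) (hs : 0 < 4 * H ^ 2 + κ) (hJ : J ∈ energyRange κ H)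
    (hJ0 : J ≠ 0) (τ a t : ℝ) : (family κ τ H a J).h (t + period κ H)
      = (family κ τ H a J).h t + (family κ τ H a J).h (period κ H) := by
  have h := eq_of_hasDerivAt_zero ordConnected_univ (f := fun t =>
    (family κ τ H a J).h (t + period κ H) - (family κ τ H a J).h t) (fun t _ => by
      have h1 := (hasDerivAt_family_h hH hs hJ τ a (mem_solDom_of_ne hJ0 (t + period κ H)))
      have h2 := (hasDerivAt_family_h hH hs hJ τ a (mem_solDom_of_ne hJ0 t))
      refine ((h1.comp_add_const t _).sub h2).congr_deriv ?_
      exact sub_eq_zero.2 (heightRate_congr (versSol_periodic hs J t)))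
    (mem_univ t) (mem_univ 0)
  simp only [zero_add, family_zero_h, sub_zero] at h
  linarith

theorem family_h_add_int (hH : 0 < H) (hs : 0 < 4 * H ^ 2 + κ) (hJ : J ∈ energyRange κ H)
    (hJ0 : J ≠ 0) (τ a t : ℝ) (k : ℤ) : (family κ τ H a J).h (t + k * period κ H)
      = (family κ τ H a J).h t + k * (family κ τ H a J).h (period κ H) := by
  -- Subtracting the linear drift leaves a periodic function, to which integer multiples of the
  -- period apply.
  have h : Function.Periodic (fun t => (family κ τ H a J).h t
      - t / period κ H * (family κ τ H a J).h (period κ H)) (period κ H) := fun t => by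
    have := (period_pos hs).ne'
    simp only [family_h_add_period hH hs hJ hJ0 τ a t]
    field_simp; ring
  have h2 := h.int_mul k t
  have := (period_pos hs).ne'
  rw [add_div, mul_div_cancel_right₀ _ this] at h2
  linarith

theorem family_h_neg (hH : 0 < H) (hs : 0 < 4 * H ^ 2 + κ) (hJ : J ∈ energyRange κ H)
    (hJ0 : J ≠ 0) (τ a t : ℝ) : (family κ τ H a J).h (-t) = -(family κ τ H a J).h t := by
  have h := eq_of_hasDerivAt_zero ordConnected_univ (f := fun t =>
    (family κ τ H a J).h (-t) + (family κ τ H a J).h t) (fun t _ => by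
      have h1 := (hasDerivAt_family_h hH hs hJ τ a (mem_solDom_of_ne hJ0 (-t)))
      have h2 := (hasDerivAt_family_h hH hs hJ τ a (mem_solDom_of_ne hJ0 t))
      refine ((h1.comp t (hasDerivAt_neg t)).add h2).congr_deriv ?_
      have := heightRate_congr (τ := τ) (a := a) (versSol_neg κ H J t)
      simp only [heightRate] at this
      rw [this]; ring)
    (mem_univ t) (mem_univ 0)
  simp only [neg_zero, family_zero_h, add_zero] at h
  linarith

theorem versSol'_ne_or_momentum_ne (hH : 0 < H) (hs : 0 < 4 * H ^ 2 + κ)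
    (hJ : J ∈ energyRange κ H) {t : ℝ} (ht : t ∈ solDom κ H J) :
    versSol' κ H J t ≠ 0 ∨ momentum κ H J t ≠ 0 := by
  by_contra! h
  have := snSq_pos hH hs hJ ht
  rw [snSq_eq hH hs hJ t, h.1, h.2] at this
  simp at this

theorem hasDerivAt_family_curve (hH : 0 < H) (hs : 0 < 4 * H ^ 2 + κ) (hJ : J ∈ energyRange κ H)
    (τ a : ℝ) {t : ℝ} (ht : t ∈ solDom κ H J) : HasDerivAt (family κ τ H a J).curve
      (versSol' κ H J t / √(snSq κ H J t), heightRate κ τ a H J t) t :=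
  (hasDerivAt_family_r hH hs hJ τ a ht).prodMk (hasDerivAt_family_h hH hs hJ τ a ht)

theorem deriv_family_curve_ne (hH : 0 < H) (hs : 0 < 4 * H ^ 2 + κ) (hJ : J ∈ energyRange κ H)
    (τ a : ℝ) {t : ℝ} (ht : t ∈ solDom κ H J) : deriv (family κ τ H a J).curve t ≠ 0 := by
  have hD := snSq_pos hH hs hJ ht
  have hk := killing_pos hH hs hJ τ a ht
  rw [(hasDerivAt_family_curve hH hs hJ τ a ht).deriv]
  intro h
  simp only [Prod.mk_eq_zero, heightRate, div_eq_zero_iff, mul_eq_zero, hk.ne', hD.ne',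
    (Real.sqrt_pos.2 hD).ne', or_false, false_or] at h
  rcases versSol'_ne_or_momentum_ne hH hs hJ ht with h' | h'
  · exact h' h.1
  · exact h' h.2

theorem contDiffOn_family_curve (hH : 0 < H) (hs : 0 < 4 * H ^ 2 + κ) (hJ : J ∈ energyRange κ H)
    (τ a : ℝ) : ContDiffOn ℝ ∞ (family κ τ H a J).curve (solDom κ H J) :=
  (contDiffOn_family_r hH hs hJ τ a).prodMk (contDiffOn_family_h hH hs hJ τ a)

theorem contDiff_family_curve (hH : 0 < H) (hs : 0 < 4 * H ^ 2 + κ) (hJ : J ∈ energyRange κ H)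
    (hJ0 : J ≠ 0) (τ a : ℝ) : ContDiff ℝ ∞ (family κ τ H a J).curve := by
  have := contDiffOn_family_curve hH hs hJ τ a
  rwa [solDom_of_ne hJ0, contDiffOn_univ] at this

theorem strictMonoOn_family_h (hH : 0 < H) (hs : 0 < 4 * H ^ 2 + κ) (hJ : J ∈ energyRange κ H)
    (hJ0 : 0 ≤ J) (τ a : ℝ) : StrictMonoOn (family κ τ H a J).h (solDom κ H J) := by
  refine strictMonoOn_of_deriv_pos (ordConnected_solDom κ H J).convex
    (contDiffOn_family_h hH hs hJ τ a).continuousOn fun t ht => ?_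
  have ht := interior_subset ht
  rw [(hasDerivAt_family_h hH hs hJ τ a ht).deriv]
  have h1 := snSq_pos hH hs hJ ht
  have h2 := killing_pos hH hs hJ τ a ht
  have h3 := versSol_pos hH hs hJ ht
  have h4 : 0 < momentum κ H J t := by unfold momentum; positivity
  positivity

/-! ### Energies are determined by the surfaces -/

/-- Stated as an infimum because at energy zero the value at `π/ω` is only approached: that point
lies in the closure of the domain. -/
theorem isGLB_versSol (hs : 0 < 4 * H ^ 2 + κ) :
    IsGLB (versSol κ H J '' solDom κ H J) (versMean κ H J - versAmp κ H J) := by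
  have hA := versAmp_nonneg (J := J) hs
  have hf := freq_pos hs
  constructor
  · rintro _ ⟨t, -, rfl⟩
    have := Real.neg_one_le_cos (freq κ H * t)
    unfold versSol; nlinarith
  · intro b hb
    have hT : 0 < π / freq κ H := div_pos Real.pi_pos hf
    have hsub : Ico 0 (π / freq κ H) ⊆ solDom κ H J := by
      unfold solDom; split_ifs
      · exact fun t ht => ⟨by linarith [ht.1], ht.2⟩
      · exact subset_univ _
    have hval : versSol κ H J (π / freq κ H) = versMean κ H J - versAmp κ H J := by
      rw [versSol, mul_div_cancel₀ _ hf.ne', Real.cos_pi]; ring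
    rw [← hval]
    have hcl : π / freq κ H ∈ closure (Ico 0 (π / freq κ H)) := by
      rw [closure_Ico hT.ne]; exact right_mem_Icc.2 hT.le
    exact closure_minimal (s := Ico 0 (π / freq κ H)) (t := {t | b ≤ versSol κ H J t})
      (fun t ht => hb ⟨t, hsub ht, rfl⟩)
      (isClosed_le continuous_const (contDiff_versSol κ H J (n := 0)).continuous) hcl

theorem isGreatest_versSol (hs : 0 < 4 * H ^ 2 + κ) :
    IsGreatest (versSol κ H J '' solDom κ H J) (versMean κ H J + versAmp κ H J) := by
  have h0 : versSol κ H J 0 = versMean κ H J + versAmp κ H J := by simp [versSol]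
  rw [← h0]
  refine ⟨⟨0, zero_mem_solDom hs J, rfl⟩, ?_⟩
  rintro _ ⟨t, -, rfl⟩
  exact versSol_le hs J t

theorem image_versSol_eq (hH : 0 < H) (hs : 0 < 4 * H ^ 2 + κ) (hJ : J ∈ energyRange κ H)
    (τ a : ℝ) : versSol κ H J '' solDom κ H J
      = (fun x : Pt => versK κ x.1) '' (family κ τ H a J).surface a := by
  ext y
  constructor
  · rintro ⟨t, ht, rfl⟩
    exact ⟨_, ProfileCurve.mem_surface_iff.2 ⟨t, ht, 0, rfl⟩, versK_family_r hH hs hJ τ a ht⟩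
  · rintro ⟨x, hx, rfl⟩
    obtain ⟨t, ht, φ, rfl⟩ := ProfileCurve.mem_surface_iff.1 hx
    exact ⟨t, ht, (versK_family_r hH hs hJ τ a ht).symm⟩

/-- Vertical translations preserve the set of versed radii. Its infimum and maximum add up to `2M`,
and `M` is an injective affine function of `J`. -/
theorem energy_eq_of_surface_eq (hH : 0 < H) (hs : 0 < 4 * H ^ 2 + κ) {J' : ℝ}
    (hJ : J ∈ energyRange κ H) (hJ' : J' ∈ energyRange κ H) {τ a v : ℝ}
    (h : (family κ τ H a J').surface a = vertShift v '' (family κ τ H a J).surface a) :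
    J = J' := by
  have himg : versSol κ H J '' solDom κ H J = versSol κ H J' '' solDom κ H J' := by
    rw [image_versSol_eq hH hs hJ τ a, image_versSol_eq hH hs hJ' τ a, h, image_image]
    rfl
  have h1 := isGLB_versSol (J := J) hs
  have h2 := (isGreatest_versSol (J := J) hs)
  rw [himg] at h1 h2
  have e1 := h1.unique (isGLB_versSol (J := J') hs)
  have e2 := h2.unique (isGreatest_versSol (J := J') hs)
  have e3 : versMean κ H J = versMean κ H J' := by linarith
  rw [versMean, versMean, div_left_inj' hs.ne'] at e3
  have : 2 * H * J = 2 * H * J' := by linarith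
  exact mul_left_cancel₀ (by positivity) this

theorem cylindrically_bounded (hH : 0 < H) (hs : 0 < 4 * H ^ 2 + κ) (hJ : J ∈ energyRange κ H)
    (τ a : ℝ) : ∃ R ∈ radii κ, ∀ x ∈ (family κ τ H a J).surface a, x.1 ≤ R := by
  have h0 := zero_mem_solDom hs J
  refine ⟨_, family_r_mem hH hs hJ τ a h0, fun x hx => ?_⟩
  obtain ⟨t, ht, φ, rfl⟩ := ProfileCurve.mem_surface_iff.1 hx
  change (family κ τ H a J).r t ≤ _
  rw [← (strictMonoOn_versK κ).le_iff_le (family_r_mem hH hs hJ τ a ht)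
    (family_r_mem hH hs hJ τ a h0), versK_family_r hH hs hJ τ a ht,
    versK_family_r hH hs hJ τ a h0]
  exact versSol_le hs J t

/-! ### The vertical cylinder -/

theorem isVerticalCylinder_family (hH : 0 < H) (hs : 0 < 4 * H ^ 2 + κ) (τ a : ℝ) :
    IsVerticalCylinder κ a H (family κ τ H a (Jmax κ H)) := by
  have hJ := Jmax_mem_energyRange hH hs
  have hJp := Jmax_pos hH hs
  have hd : ∀ t, t ∈ solDom κ H (Jmax κ H) := mem_solDom_of_ne hJp.ne'
  have hv : ∀ t, versSol κ H (Jmax κ H) t = versMean κ H (Jmax κ H) := fun t => by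
    rw [versSol, versAmp_Jmax hH hs]; ring
  have hMp := versMean_pos hH hs hJ
  have hm : 0 < momentum κ H (Jmax κ H) 0 := momentum_zero_pos hH hs hJ
  have hr : ∀ t, (family κ τ H a (Jmax κ H)).r t = (family κ τ H a (Jmax κ H)).r 0 := fun t => by
    simp only [family, hv]
  have hmem := family_r_mem hH hs hJ τ a (hd 0)
  have hsn : snK κ ((family κ τ H a (Jmax κ H)).r 0) = momentum κ H (Jmax κ H) 0 := by
    rw [snK_family_r hH hs hJ τ a (hd 0), snSq_eq hH hs hJ]
    have : versSol' κ H (Jmax κ H) 0 = 0 := by simp [versSol']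
    rw [this, zero_pow two_ne_zero, zero_add, Real.sqrt_sq hm.le]
  have hct : ctK κ ((family κ τ H a (Jmax κ H)).r 0) = 2 * H := by
    rw [ctK, hsn, csK_eq, versK_family_r hH hs hJ τ a (hd 0), div_eq_iff hm.ne', momentum, hv]
    linear_combination -(versMean_mul (J := Jmax κ H) hs)
  have hh : ∀ t, (family κ τ H a (Jmax κ H)).h t = t * heightRate κ τ a H (Jmax κ H) 0 := by
    intro t
    have : ∀ s, heightNum κ τ a H (Jmax κ H) s / snSq κ H (Jmax κ H) s
        = heightRate κ τ a H (Jmax κ H) 0 := fun s =>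
      heightRate_congr ((hv s).trans (hv 0).symm)
    simp only [family, this, intervalIntegral.integral_const, sub_zero, smul_eq_mul]
  have hrate : heightRate κ τ a H (Jmax κ H) 0 ≠ 0 := by
    have h1 := snSq_pos hH hs hJ (hd 0)
    have h2 := killing_pos hH hs hJ τ a (hd 0)
    unfold heightRate; positivity
  have hsurj : Function.Surjective (family κ τ H a (Jmax κ H)).h := fun z =>
    ⟨z / heightRate κ τ a H (Jmax κ H) 0, by rw [hh, div_mul_cancel₀ _ hrate]⟩
  refine ⟨_, hmem, hct, fun x hx h => ctK_eq_two_mul_unique hmem hx hH hct h,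
    solDom_of_ne hJp.ne', hr, hsurj, ?_⟩
  ext ⟨x1, θ, z⟩
  rw [ProfileCurve.mem_surface_iff]
  constructor
  · rintro ⟨t, -, φ, h⟩
    rw [h]; exact hr t
  · rintro (rfl : x1 = _)
    induction θ using Real.Angle.induction_on with
    | h φ =>
      obtain ⟨t, ht⟩ := hsurj (z - a * φ)
      refine ⟨t, hd t, φ, ?_⟩
      simp [toPt, screwParam, ProfileCurve.curve, ht, hr t]

/-! ### Unduloids -/

/-- Positive energy makes `sin σ` positive, so the connected range of `σ`, which contains `π / 2`,
avoids `0` and `π`. On this interval the cosine determines `σ`, so `σ` inherits periodicity. -/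
theorem family_σ_mem_Ioo (hH : 0 < H) (hs : 0 < 4 * H ^ 2 + κ) (hJ : J ∈ energyRange κ H)
    (hJ0 : 0 < J) (τ a t : ℝ) : (family κ τ H a J).σ t ∈ Ioo 0 π := by
  have hd : ∀ t, t ∈ solDom κ H J := mem_solDom_of_ne hJ0.ne'
  have hsin : ∀ t, 0 < sin ((family κ τ H a J).σ t) := fun t => by
    have h1 := (family_angle hH hs hJ τ a (hd t)).2
    have h3 := versSol_pos hH hs hJ (hd t)
    have h4 : 0 < momentum κ H J t := by unfold momentum; positivity
    rw [← h1] at h4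
    exact pos_of_mul_pos_right h4 (Real.sqrt_nonneg _)
  have hcont : Continuous (family κ τ H a J).σ := by
    have := (contDiffOn_family_σ hH hs hJ τ a).continuousOn
    rwa [solDom_of_ne hJ0.ne', ← continuousOn_univ] at *
  have hoc : (range (family κ τ H a J).σ).OrdConnected := (isPreconnected_range hcont).ordConnected
  have h0 : (family κ τ H a J).σ 0 = π / 2 := by simp [family]
  have hpi := Real.pi_pos
  have hn0 : (0 : ℝ) ∉ range (family κ τ H a J).σ := by
    rintro ⟨t, ht⟩; have := hsin t; rw [ht] at this; simp at this
  have hn1 : π ∉ range (family κ τ H a J).σ := by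
    rintro ⟨t, ht⟩; have := hsin t; rw [ht] at this; simp at this
  constructor
  · by_contra! h
    exact hn0 (hoc.out ⟨t, rfl⟩ ⟨0, rfl⟩ ⟨h, by rw [h0]; positivity⟩)
  · by_contra! h
    exact hn1 (hoc.out ⟨0, rfl⟩ ⟨t, rfl⟩ ⟨by rw [h0]; linarith, h⟩)

theorem versSol_half_period_lt (hH : 0 < H) (hs : 0 < 4 * H ^ 2 + κ) (hJ : J ∈ energyRange κ H)
    (hJm : J < Jmax κ H) : versSol κ H J (π / freq κ H) < versSol κ H J 0 := by
  have h1 := versAmp_pos hH hs hJ hJm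
  rw [versSol, versSol, mul_div_cancel₀ _ (freq_pos hs).ne']
  simp
  linarith

theorem isUnduloidType_family (hH : 0 < H) (hs : 0 < 4 * H ^ 2 + κ) (hJ : J ∈ Ioo 0 (Jmax κ H))
    (τ a : ℝ) : IsUnduloidType a (family κ τ H a J) := by
  have hJr : J ∈ energyRange κ H := by
    have h0 := ((mem_energyRange_iff hH hs).1 (zero_mem_energyRange hH hs)).2
    have h1 := ((mem_energyRange_iff hH hs).1 (Jmax_mem_energyRange hH hs)).2
    refine (mem_energyRange_iff hH hs).2 ⟨hJ.2.le, ?_⟩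
    rcases le_or_gt 0 κ with h | h
    · have := mul_nonneg h hJ.1.le
      linarith
    · have := mul_le_mul_of_nonpos_left hJ.2.le h.le
      linarith
  have hd : ∀ t, t ∈ solDom κ H J := mem_solDom_of_ne hJ.1.ne'
  have hdom : (family κ τ H a J).dom = univ := solDom_of_ne hJ.1.ne'
  have hmono : StrictMono (family κ τ H a J).h := by
    have := strictMonoOn_family_h hH hs hJr hJ.1.le τ a
    rwa [solDom_of_ne hJ.1.ne', strictMonoOn_univ] at this
  have hc := contDiff_family_curve hH hs hJr hJ.1.ne' τ a
  have hreg := fun t => deriv_family_curve_ne hH hs hJr τ a (hd t)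
  have hdense : Dense {s | ∀ s', (family κ τ H a J).curve s' = (family κ τ H a J).curve s
      → s' = s} := by
    convert dense_univ using 1
    exact eq_univ_of_forall fun s s' h => hmono.injective (congrArg Prod.snd h)
  refine ⟨hdom, hmono, ⟨period κ H, period_pos hs, family_r_periodic hs J τ a, fun t => ?_⟩,
    ⟨π / freq κ H, fun h => ?_⟩, ?_, fun _ => isImmersedPlane_surface a hdom hc hreg hdense⟩
  · have h1 := family_σ_mem_Ioo hH hs hJr hJ.1 τ a t
    have h2 := family_σ_mem_Ioo hH hs hJr hJ.1 τ a (t + period κ H)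
    refine Real.injOn_cos ⟨h2.1.le, h2.2.le⟩ ⟨h1.1.le, h1.2.le⟩ ?_
    have e1 := (family_angle hH hs hJr τ a (hd t)).1
    have e2 := (family_angle hH hs hJr τ a (hd (t + period κ H))).1
    have e3 : snSq κ H J (t + period κ H) = snSq κ H J t := by
      rw [snSq, versSol_periodic hs J t, ← snSq]
    rw [e3, versSol'_periodic hs J t, ← e1] at e2
    exact mul_left_cancel₀ (Real.sqrt_pos.2 (snSq_pos hH hs hJr (hd t))).ne' e2
  · have h1 := versSol_half_period_lt hH hs hJr hJ.2
    rw [← versK_family_r hH hs hJr τ a (hd _), h, versK_family_r hH hs hJr τ a (hd _)] at h1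
    exact lt_irrefl _ h1
  · rintro rfl
    exact ⟨_, isInvariantImmersion_rotational hdom hc hreg hdense,
      isEmbedding_rotational (continuous_fst.comp hc.continuous)
        (continuous_snd.comp hc.continuous) hmono⟩

end family

/-! ### Spheres -/

section sphere

variable {κ H : ℝ}

/-- The derivative of the height for energy zero, extended continuously to the axis. -/
noncomputable def heightRateZero (κ τ a H t : ℝ) : ℝ :=
  killing κ τ a H 0 t * (2 * H) / (2 - κ * versSol κ H 0 t)

/-- The height for energy zero, extended continuously to the axis. -/
noncomputable def heightZero (κ τ a H t : ℝ) : ℝ := ∫ s in (0 : ℝ)..t, heightRateZero κ τ a H s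

theorem continuous_killing (κ τ a H J : ℝ) : Continuous (killing κ τ a H J) := by
  have h1 := (contDiff_versSol κ H J (n := 0)).continuous
  have h2 := (contDiff_snSq κ H J (n := 0)).continuous
  unfold killing
  fun_prop

theorem continuous_heightRateZero (hH : 0 < H) (hs : 0 < 4 * H ^ 2 + κ) (τ a : ℝ) :
    Continuous (heightRateZero κ τ a H) := by
  have h1 := (contDiff_versSol κ H 0 (n := 0)).continuous
  refine ((continuous_killing κ τ a H 0).mul continuous_const).div (by fun_prop) fun t => ?_
  exact (two_sub_versSol_pos hH hs (zero_mem_energyRange hH hs) t).ne'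

/-- At energy zero `Z = 2Hy` and `sn² = y(2 - κy)`; cancelling `y` removes the singularity on the
axis. -/
theorem heightRate_eq_heightRateZero (hH : 0 < H) (hs : 0 < 4 * H ^ 2 + κ) (τ a : ℝ) {t : ℝ}
    (ht : t ∈ solDom κ H 0) : heightRate κ τ a H 0 t = heightRateZero κ τ a H t := by
  have h1 := versSol_pos hH hs (zero_mem_energyRange hH hs) ht
  have h2 := two_sub_versSol_pos hH hs (zero_mem_energyRange hH hs) t
  rw [heightRate, heightRateZero, momentum, snSq]
  field_simp
  ring

theorem heightZero_eq (hH : 0 < H) (hs : 0 < 4 * H ^ 2 + κ) (τ a : ℝ) {t : ℝ}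
    (ht : t ∈ solDom κ H 0) : heightZero κ τ a H t = (family κ τ H a 0).h t :=
  intervalIntegral.integral_congr fun _ hs' => (heightRate_eq_heightRateZero hH hs τ a
    ((ordConnected_solDom κ H 0).uIcc_subset (zero_mem_solDom hs 0) ht hs')).symm

theorem hasDerivAt_heightZero (hH : 0 < H) (hs : 0 < 4 * H ^ 2 + κ) (τ a t : ℝ) :
    HasDerivAt (heightZero κ τ a H) (heightRateZero κ τ a H t) t :=
  hasDerivAt_primitive isOpen_univ ordConnected_univ
    (continuous_heightRateZero hH hs τ a).continuousOn trivial trivial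

theorem solDom_zero : solDom κ H 0 = Ioo (-(π / freq κ H)) (π / freq κ H) := if_pos rfl

theorem isIncomplete_family_zero (hH : 0 < H) (hs : 0 < 4 * H ^ 2 + κ) (τ a : ℝ) :
    IsIncomplete κ τ (Ioo (-(π / freq κ H)) (π / freq κ H) ×ˢ univ)
      (screwParam a (family κ τ H a 0).curve) := by
  have hJ := zero_mem_energyRange hH hs
  have hT : 0 < π / freq κ H := div_pos Real.pi_pos (freq_pos hs)
  set T := π / freq κ H with hTdef
  have hmaps : ∀ t ∈ Ioo (0 : ℝ) 1, T * t ∈ solDom κ H 0 := fun t ht => by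
    rw [solDom_zero, ← hTdef]
    constructor <;> nlinarith [ht.1, ht.2]
  have hder : ∀ t ∈ Ioo (0 : ℝ) 1, HasDerivAt
      (fun s => screwParam a (family κ τ H a 0).curve (T * s, 0))
      (versSol' κ H 0 (T * t) / √(snSq κ H 0 (T * t)) * T, 0,
        heightRateZero κ τ a H (T * t) * T) t := by
    intro t ht
    have h1 := hasDerivAt_family_r hH hs hJ τ a (hmaps t ht)
    have h2 := hasDerivAt_family_h hH hs hJ τ a (hmaps t ht)
    have h3 : HasDerivAt (fun s => T * s) T t := by simpa using (hasDerivAt_id t).const_mul T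
    have h4 := (h1.comp t h3).prodMk ((hasDerivAt_const t (0 : ℝ)).prodMk
      ((h2.comp t h3).add_const (a * 0)))
    refine h4.congr_deriv ?_
    rw [← heightRate_eq_heightRateZero hH hs τ a (hmaps t ht)]
    rfl
  -- The escaping curve is half of the profile at angle zero. Its squared speed is `T²(cos² σ +
  -- h'²)`, which stays bounded up to the axis.
  refine ⟨fun t => (T * t, 0), by fun_prop, fun t ht => ⟨solDom_zero ▸ hmaps t ht, trivial⟩, ?_, ?_⟩
  · intro C hC hcomp
    have hlim : Tendsto (fun t : ℝ => ((T * t, 0) : ℝ × ℝ)) (𝓝[<] 1) (𝓝 (T, 0)) := by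
      have : Continuous fun t : ℝ => ((T * t, 0) : ℝ × ℝ) := by fun_prop
      have h := (this.tendsto 1).mono_left (nhdsWithin_le_nhds (s := Iio 1))
      rwa [mul_one] at h
    refine hlim.eventually (hcomp.isClosed.isOpen_compl.mem_nhds fun h => ?_)
    exact lt_irrefl _ (hC h).1.2
  · have heq : EqOn (fun t => √(gE κ τ (screwParam a (family κ τ H a 0).curve (T * t, 0))
        (deriv (fun s => screwParam a (family κ τ H a 0).curve (T * s, 0)) t)
        (deriv (fun s => screwParam a (family κ τ H a 0).curve (T * s, 0)) t)))
        (fun t => T * √(cos ((family κ τ H a 0).σ (T * t)) ^ 2 + heightRateZero κ τ a H (T * t) ^ 2))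
        (Ioo 0 1) := by
      intro t ht
      have h1 := Real.sqrt_pos.2 (snSq_pos hH hs hJ (hmaps t ht))
      have h2 := (family_angle hH hs hJ τ a (hmaps t ht)).1
      simp only [(hder t ht).deriv, gE_eq, ← h2, mul_div_cancel_left₀ _ h1.ne']
      rw [← Real.sqrt_sq hT.le, ← Real.sqrt_mul (sq_nonneg T), Real.sqrt_sq hT.le]
      congr 1
      ring
    rw [MeasureTheory.integrableOn_congr_fun heq measurableSet_Ioo]
    obtain ⟨B, hB⟩ := (isCompact_Icc (a := (0 : ℝ)) (b := 1)).exists_bound_of_continuousOn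
      ((continuous_heightRateZero hH hs τ a).comp (continuous_const.mul continuous_id :
        Continuous fun t : ℝ => T * t)).continuousOn
    have hσ : ContinuousOn (fun t => (family κ τ H a 0).σ (T * t)) (Ioo 0 1) :=
      (contDiffOn_family_σ hH hs hJ τ a).continuousOn.comp (by fun_prop) hmaps
    have hr : ContinuousOn (fun t => heightRateZero κ τ a H (T * t)) (Ioo 0 1) :=
      ((continuous_heightRateZero hH hs τ a).comp (by fun_prop)).continuousOn
    have hcont : ContinuousOn (fun t => T * √(cos ((family κ τ H a 0).σ (T * t)) ^ 2
        + heightRateZero κ τ a H (T * t) ^ 2)) (Ioo 0 1) := by fun_prop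
    refine MeasureTheory.IntegrableOn.of_bound (by simp)
      (hcont.aestronglyMeasurable measurableSet_Ioo) (T * √(1 + B ^ 2)) ?_
    refine (MeasureTheory.ae_restrict_iff' measurableSet_Ioo).2
      (MeasureTheory.ae_of_all _ fun t ht => ?_)
    have hB' := hB t (Ioo_subset_Icc_self ht)
    rw [Real.norm_of_nonneg (by positivity)]
    refine mul_le_mul_of_nonneg_left (Real.sqrt_le_sqrt (add_le_add (Real.cos_sq_le_one _) ?_)) hT.le
    exact sq_le_sq' (abs_le.1 hB').1 (abs_le.1 hB').2

theorem isSphereType_family (hH : 0 < H) (hs : 0 < 4 * H ^ 2 + κ) (τ a : ℝ) :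
    IsSphereType κ τ a (family κ τ H a 0) := by
  have hJ := zero_mem_energyRange hH hs
  have hf := freq_pos hs
  have hT : 0 < π / freq κ H := div_pos Real.pi_pos hf
  have hmono := strictMonoOn_family_h hH hs hJ le_rfl τ a
  have hc := contDiffOn_family_curve hH hs hJ τ a
  have hend : versSol κ H 0 (π / freq κ H) = 0 :=
    versSol_pi_div (by rw [mul_div_cancel₀ _ hf.ne', Real.cos_pi])
  refine ⟨⟨π / freq κ H, hT, solDom_zero,
    fun t => (arcversK κ (versSol κ H 0 t), heightZero κ τ a H t), ?_, ?_, ?_, ?_, ?_, ?_⟩,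
    hmono, ?_, fun _ => ⟨π / freq κ H, screwParam a (family κ τ H a 0).curve, hT, ?_, ?_, ?_, ?_,
      ?_, isIncomplete_family_zero hH hs τ a⟩⟩
  · exact ContinuousOn.prodMk ((continuous_arcversK κ).comp
      (contDiff_versSol κ H 0 (n := 0)).continuous).continuousOn
      fun t _ => (hasDerivAt_heightZero hH hs τ a t).continuousAt.continuousWithinAt
  · have : StrictMonoOn (heightZero κ τ a H) (Icc (-(π / freq κ H)) (π / freq κ H)) := by
      refine strictMonoOn_of_deriv_pos (convex_Icc _ _) (fun t _ =>
        (hasDerivAt_heightZero hH hs τ a t).continuousAt.continuousWithinAt) fun t ht => ?_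
      rw [interior_Icc, ← solDom_zero] at ht
      rw [(hasDerivAt_heightZero hH hs τ a t).deriv]
      exact div_pos (mul_pos (killing_pos hH hs hJ τ a ht) (by positivity))
        (two_sub_versSol_pos hH hs hJ t)
    exact fun s hs' t ht h => this.injOn hs' ht (congrArg Prod.snd h)
  · intro t ht
    exact Prod.ext rfl (heightZero_eq hH hs τ a (solDom_zero ▸ ht))
  · simp only [versSol_neg, hend, arcversK_zero]
  · simp only [hend, arcversK_zero]
  · intro t ht
    exact radii_pos (family_r_mem hH hs hJ τ a (solDom_zero ▸ ht))
  · rintro rfl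
    rw [solDom_zero] at hc
    have hmono' : StrictMonoOn (family κ τ H 0 0).h (Ioo (-(π / freq κ H)) (π / freq κ H)) :=
      solDom_zero (κ := κ) (H := H) ▸ hmono
    have hcc := hc.continuousOn.domRestrict
    have : Nonempty (Ioo (-(π / freq κ H)) (π / freq κ H)) := ⟨⟨0, by linarith, hT⟩⟩
    have hpre : PreconnectedSpace (Ioo (-(π / freq κ H)) (π / freq κ H)) :=
      Subtype.preconnectedSpace isPreconnected_Ioo
    have hemb := isEmbedding_rotational (α := Ioo (-(π / freq κ H)) (π / freq κ H))
      (r := fun t => (family κ τ H 0 0).r t) (h := fun t => (family κ τ H 0 0).h t)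
      (continuous_fst.comp hcc) (continuous_snd.comp hcc) (fun s t hst => hmono' s.2 t.2 hst)
    have hrange : (family κ τ H 0 0).surface 0 = range
        (fun x : Ioo (-(π / freq κ H)) (π / freq κ H) × Real.Angle =>
          (((family κ τ H 0 0).r x.1, x.2, (family κ τ H 0 0).h x.1) : Pt)) := by
      ext x
      rw [ProfileCurve.mem_surface_iff]
      constructor
      · rintro ⟨t, ht, φ, rfl⟩
        exact ⟨(⟨t, solDom_zero (κ := κ) (H := H) ▸ ht⟩, φ),
          by simp [toPt, screwParam, ProfileCurve.curve]⟩
      · rintro ⟨⟨⟨t, ht⟩, θ⟩, rfl⟩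
        induction θ using Real.Angle.induction_on with
        | h φ => exact ⟨t, solDom_zero.symm.subset ht, φ,
            by simp [toPt, screwParam, ProfileCurve.curve]⟩
    exact ⟨(Homeomorph.setCongr hrange).trans
      (hemb.toHomeomorph.symm.trans (sphereHomeomorph hT))⟩
  · exact contDiffOn_screwParam a (solDom_zero (κ := κ) (H := H) ▸ hc)
  · rintro ⟨t, φ⟩ ⟨ht, -⟩
    have ht' : t ∈ solDom κ H 0 := solDom_zero (κ := κ) (H := H) ▸ ht
    exact injective_fderiv_screwParam a
      (hasDerivAt_family_curve hH hs hJ τ a ht').differentiableAt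
      (deriv_family_curve_ne hH hs hJ τ a ht') φ
  · rintro ⟨t, φ⟩ ⟨ht, -⟩ ⟨t', φ'⟩ ⟨ht', -⟩ h
    have ht : t ∈ solDom κ H 0 := solDom_zero (κ := κ) (H := H) ▸ ht
    have ht' : t' ∈ solDom κ H 0 := solDom_zero (κ := κ) (H := H) ▸ ht'
    obtain ⟨h1, h2⟩ := screwParam_eq_iff.1 h
    exact Prod.ext (hmono.injOn ht ht' (congrArg Prod.snd h2)) h1
  · exact fun t _ φ ψ => toPt_screwParam_add a _ t φ ψ
  · ext x
    rw [ProfileCurve.mem_surface_iff]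
    constructor
    · rintro ⟨⟨t, φ⟩, ⟨ht, -⟩, rfl⟩
      exact ⟨t, solDom_zero.symm.subset ht, φ, rfl⟩
    · rintro ⟨t, ht, φ, rfl⟩
      exact ⟨(t, φ), ⟨solDom_zero (κ := κ) (H := H) ▸ ht, trivial⟩, rfl⟩

end sphere

/-! ### Curves of negative energy -/

section negative

variable {κ H J : ℝ}

theorem strictMono_family_σ (hH : 0 < H) (hs : 0 < 4 * H ^ 2 + κ) (hJ : J ∈ energyRange κ H)
    (hJ0 : J < 0) (τ a : ℝ) : StrictMono (family κ τ H a J).σ := by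
  have hd : ∀ t, t ∈ solDom κ H J := mem_solDom_of_ne hJ0.ne
  refine strictMono_of_deriv_pos fun t => ?_
  rw [(hasDerivAt_family_σ hH hs hJ τ a (hd t)).deriv]
  have h1 := snSq_pos hH hs hJ (hd t)
  have h2 := mul_nonneg ((mem_energyRange_iff hH hs).1 hJ).2 (versSol_pos hH hs hJ (hd t)).le
  refine div_pos ?_ h1
  unfold angleNum; linarith

/-- The increment is constant, and it equals `2πk` with `k ≥ 1` because `(X, Z)` is periodic and `σ`
increases. If `k ≥ 2`, then `σ` would pass both `3π/2` and `5π/2` inside one period, but there `X`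
vanishes only at `π/ω`. -/
theorem family_σ_add_period (hH : 0 < H) (hs : 0 < 4 * H ^ 2 + κ) (hJ : J ∈ energyRange κ H)
    (hJ0 : J < 0) (τ a t : ℝ) :
    (family κ τ H a J).σ (t + period κ H) = (family κ τ H a J).σ t + 2 * π := by
  have hd : ∀ t, t ∈ solDom κ H J := mem_solDom_of_ne hJ0.ne
  have hJm : J < Jmax κ H := hJ0.trans (Jmax_pos hH hs)
  have hA := versAmp_pos hH hs hJ hJm
  have hf := freq_pos hs
  have hmono := strictMono_family_σ hH hs hJ hJ0 τ a
  set σ := (family κ τ H a J).σ with hσ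
  have hcont : Continuous σ := continuous_iff_continuousAt.2 fun t =>
    (hasDerivAt_family_σ hH hs hJ τ a (hd t)).continuousAt
  have hP := period_pos hs
  have hconst := eq_of_hasDerivAt_zero ordConnected_univ (f := fun t => σ (t + period κ H) - σ t)
    (fun t _ => by
      have h1 := (hasDerivAt_family_σ hH hs hJ τ a (hd (t + period κ H)))
      have h2 := (hasDerivAt_family_σ hH hs hJ τ a (hd t))
      refine ((h1.comp_add_const t _).sub h2).congr_deriv ?_
      simp only [angleNum, snSq, versSol_periodic hs J t, sub_self])
    (mem_univ t) (mem_univ 0)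
  simp only [zero_add] at hconst
  have h0 : σ 0 = π / 2 := by simp [hσ, family]
  have hang : ((σ (period κ H) : ℝ) : Real.Angle) = (σ 0 : ℝ) := by
    have e3 : snSq κ H J (period κ H) = snSq κ H J 0 := by
      have := versSol_periodic hs J 0
      rw [zero_add] at this
      rw [snSq, this, ← snSq]
    have e4 : versSol' κ H J (period κ H) = versSol' κ H J 0 := by
      simpa using versSol'_periodic hs J 0
    have e5 : momentum κ H J (period κ H) = momentum κ H J 0 := by
      have := versSol_periodic hs J 0
      rw [zero_add] at this
      rw [momentum, this, ← momentum]
    obtain ⟨a1, a2⟩ := family_angle hH hs hJ τ a (hd 0)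
    obtain ⟨b1, b2⟩ := family_angle hH hs hJ τ a (hd (period κ H))
    rw [e3, e4, ← a1] at b1
    rw [e3, e5, ← a2] at b2
    have hne := (Real.sqrt_pos.2 (snSq_pos hH hs hJ (hd 0))).ne'
    exact Real.Angle.cos_sin_inj (mul_left_cancel₀ hne b1) (mul_left_cancel₀ hne b2)
  obtain ⟨k, hk⟩ := Real.Angle.angle_eq_iff_two_pi_dvd_sub.1 hang
  have hpi := Real.pi_pos
  have hkpos : 0 < k := by
    have h1 : 0 < 2 * π * k := hk ▸ sub_pos.2 (hmono hP)
    exact_mod_cast pos_of_mul_pos_right h1 (by positivity)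
  have hturn : ∀ s, 0 < s → s < period κ H → cos (σ s) = 0 → freq κ H * s = π := by
    intro s hs0 hsP hcos
    have h1 := (family_angle hH hs hJ τ a (hd s)).1
    rw [← hσ, hcos, mul_zero, versSol', eq_comm, neg_eq_zero] at h1
    have h2 : sin (freq κ H * s) = 0 := (mul_eq_zero.1 h1).resolve_left (mul_pos hA hf).ne'
    have h3 : 0 < freq κ H * s := mul_pos hf hs0
    have h4 : freq κ H * s < 2 * π := by
      rw [period, lt_div_iff₀ hf] at hsP; linarith [mul_comm s (freq κ H)]
    have h5 : sin (freq κ H * s - π) = 0 := by rw [Real.sin_sub_pi, h2, neg_zero]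
    have := (Real.sin_eq_zero_iff_of_lt_of_lt (by linarith) (by linarith)).1 h5
    linarith
  have hk1 : k = 1 := by
    by_contra hne
    have hk2 : (2 : ℝ) ≤ k := by
      have : 2 ≤ k := by omega
      exact_mod_cast this
    have hσP : π / 2 + 4 * π ≤ σ (period κ H) := by nlinarith
    have hivt := intermediate_value_Ioo hP.le hcont.continuousOn
    obtain ⟨s, ⟨hs1, hs2⟩, hs3⟩ := hivt (show 3 * π / 2 ∈ Ioo (σ 0) (σ (period κ H)) from
      ⟨by linarith, by linarith⟩)
    obtain ⟨s', ⟨hs1', hs2'⟩, hs3'⟩ := hivt (show 5 * π / 2 ∈ Ioo (σ 0) (σ (period κ H)) from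
      ⟨by linarith, by linarith⟩)
    have c1 : cos (σ s) = 0 := by
      rw [hs3, Real.cos_eq_zero_iff]; exact ⟨1, by push_cast; ring⟩
    have c2 : cos (σ s') = 0 := by
      rw [hs3', Real.cos_eq_zero_iff]; exact ⟨2, by push_cast; ring⟩
    have : s = s' := mul_left_cancel₀ hf.ne'
      ((hturn s hs1 hs2 c1).trans (hturn s' hs1' hs2' c2).symm)
    rw [this, hs3'] at hs3
    linarith
  rw [hk1] at hk
  push_cast at hk
  linarith

theorem isRollingProfile_family (hH : 0 < H) (hs : 0 < 4 * H ^ 2 + κ) (hJ : J ∈ energyRange κ H)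
    (hJ0 : J < 0) (τ a : ℝ) : IsRollingProfile (family κ τ H a J) (period κ H)
      ((family κ τ H a J).h (period κ H)) := by
  have hd : ∀ t, t ∈ solDom κ H J := mem_solDom_of_ne hJ0.ne
  have hmono := strictMono_family_σ hH hs hJ hJ0 τ a
  have hstep := family_σ_add_period hH hs hJ hJ0 τ a
  refine ⟨solDom_of_ne hJ0.ne, hmono, period_pos hs, family_r_periodic hs J τ a, fun t => ?_, hstep,
    fun s t h => ?_⟩
  · rw [(hasDerivAt_family_h hH hs hJ τ a (hd t)).deriv,
      (hasDerivAt_family_h hH hs hJ τ a (hd (t + period κ H))).deriv]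
    exact heightRate_congr (versSol_periodic hs J t)
  · rw [← hstep t] at h
    rw [hmono.injective h, family_h_add_period hH hs hJ hJ0.ne τ a t]
    ring

theorem eq_of_family_r_eq (hH : 0 < H) (hs : 0 < 4 * H ^ 2 + κ) (hJ : J ∈ energyRange κ H)
    (hJ0 : J < 0) {τ a s t : ℝ} (h : (family κ τ H a J).r s = (family κ τ H a J).r t) :
    ∃ k : ℤ, s = t + k * period κ H ∨ s = -t + k * period κ H := by
  have hd : ∀ t, t ∈ solDom κ H J := mem_solDom_of_ne hJ0.ne
  have hA := versAmp_pos hH hs hJ (hJ0.trans (Jmax_pos hH hs))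
  have hf := freq_pos hs
  have h1 : versSol κ H J t = versSol κ H J s := by
    rw [← versK_family_r hH hs hJ τ a (hd s), h, versK_family_r hH hs hJ τ a (hd t)]
  have h2 : cos (freq κ H * t) = cos (freq κ H * s) := by
    simp only [versSol, add_right_inj] at h1
    exact mul_left_cancel₀ hA.ne' h1
  obtain ⟨k, hk⟩ := Real.cos_eq_cos_iff.1 h2
  refine ⟨k, hk.imp (fun hk => ?_) fun hk => ?_⟩
  · refine mul_left_cancel₀ hf.ne' ?_
    rw [hk, period]; field_simp; ring
  · refine mul_left_cancel₀ hf.ne' ?_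
    rw [hk, period]; field_simp; ring

/-- Otherwise the image of the interval under `h` is connected and countable, hence a point. Then
`Z`, and with it `Z' = 2HX`, vanishes on the interval, contradicting `X² + Z² > 0`. -/
theorem exists_not_mem_countable_preimage (hH : 0 < H) (hs : 0 < 4 * H ^ 2 + κ)
    (hJ : J ∈ energyRange κ H) (hJ0 : J < 0) (τ a : ℝ) {S : Set ℝ} (hS : S.Countable) {u v : ℝ}
    (huv : u < v) : ∃ s ∈ Ioo u v, (family κ τ H a J).h s ∉ S := by
  have hd : ∀ t, t ∈ solDom κ H J := mem_solDom_of_ne hJ0.ne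
  by_contra! hcon
  have hcont : ContinuousOn (family κ τ H a J).h (Ioo u v) := fun t _ =>
    (hasDerivAt_family_h hH hs hJ τ a (hd t)).continuousAt.continuousWithinAt
  have hpre := isPreconnected_Ioo.image _ hcont
  have hsub : ((family κ τ H a J).h '' Ioo u v).Subsingleton :=
    hS.isTotallyDisconnected _ (by rintro _ ⟨s, hs', rfl⟩; exact hcon s hs') hpre
  have hmom : ∀ t ∈ Ioo u v, momentum κ H J t = 0 := by
    intro t ht
    have hc : (family κ τ H a J).h =ᶠ[𝓝 t] fun _ => (family κ τ H a J).h t := by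
      filter_upwards [Ioo_mem_nhds ht.1 ht.2] with s hs'
      exact hsub (mem_image_of_mem _ hs') (mem_image_of_mem _ ht)
    have h1 := (hasDerivAt_family_h hH hs hJ τ a (hd t)).unique
      ((hasDerivAt_const t ((family κ τ H a J).h t)).congr_of_eventuallyEq hc)
    have h2 := snSq_pos hH hs hJ (hd t)
    have h3 := killing_pos hH hs hJ τ a (hd t)
    simpa [h2.ne', h3.ne'] using h1
  obtain ⟨t, ht⟩ := nonempty_Ioo.2 huv
  have hc : momentum κ H J =ᶠ[𝓝 t] fun _ => 0 := by
    filter_upwards [Ioo_mem_nhds ht.1 ht.2] with s hs' using hmom s hs'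
  have h1 := (hasDerivAt_momentum κ H J t).unique
    ((hasDerivAt_const t (0 : ℝ)).congr_of_eventuallyEq hc)
  have h2 : versSol' κ H J t = 0 := by simpa [hH.ne'] using h1
  rcases versSol'_ne_or_momentum_ne hH hs hJ (hd t) with h | h
  · exact h h2
  · exact h (hmom t ht)

/-- Equal radii mean `s' = s + kP` or `s' = -s + kP`. Equal heights rule out the first unless `k =
0`, and the second requires `h(s) = kΔ/2`, one of countably many values that can be avoided. -/
theorem dense_injective_family (hH : 0 < H) (hs : 0 < 4 * H ^ 2 + κ) (hJ : J ∈ energyRange κ H)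
    (hJ0 : J < 0) (τ a : ℝ) (hΔ : (family κ τ H a J).h (period κ H) ≠ 0) :
    Dense {s | ∀ s', (family κ τ H a J).curve s' = (family κ τ H a J).curve s → s' = s} := by
  rw [dense_iff_exists_between]
  intro u v huv
  obtain ⟨s, hs', hsS⟩ := exists_not_mem_countable_preimage hH hs hJ hJ0 τ a
    (countable_range fun k : ℤ => k * (family κ τ H a J).h (period κ H) / 2) huv
  refine ⟨s, fun s' h => ?_, hs'.1, hs'.2⟩
  have hh : (family κ τ H a J).h s' = (family κ τ H a J).h s := congrArg Prod.snd h
  obtain ⟨k, rfl | rfl⟩ := eq_of_family_r_eq hH hs hJ hJ0 (τ := τ) (a := a) (congrArg Prod.fst h)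
  · rw [family_h_add_int hH hs hJ hJ0.ne, add_eq_left] at hh
    rw [(mul_eq_zero.1 hh).resolve_right hΔ]; ring
  · rw [family_h_add_int hH hs hJ hJ0.ne, family_h_neg hH hs hJ hJ0.ne] at hh
    exact absurd ⟨k, by simp only []; linarith⟩ hsS

theorem hasNodoidTopology_family (hH : 0 < H) (hs : 0 < 4 * H ^ 2 + κ) (hJ : J ∈ energyRange κ H)
    (hJ0 : J < 0) (τ a : ℝ) (hΔ : (family κ τ H a J).h (period κ H) ≠ 0) :
    HasNodoidTopology a (family κ τ H a J) := by
  have hdom : (family κ τ H a J).dom = univ := solDom_of_ne hJ0.ne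
  have hc := contDiff_family_curve hH hs hJ hJ0.ne τ a
  have hreg := fun t => deriv_family_curve_ne hH hs hJ τ a (mem_solDom_of_ne hJ0.ne t)
  have hdense := dense_injective_family hH hs hJ hJ0 τ a hΔ
  refine ⟨?_, fun _ => isImmersedPlane_surface a hdom hc hreg hdense⟩
  rintro rfl
  exact ⟨_, isInvariantImmersion_rotational hdom hc hreg hdense⟩

/-! ### Tubes -/

/-- Oddness and `Δ = 0` give `h = 0` at both `0` and `P/2`. A further zero in between would yield
two critical points by Rolle, whereas `momentum` is strictly decreasing on the half period. -/
theorem family_h_ne_zero (hH : 0 < H) (hs : 0 < 4 * H ^ 2 + κ) (hJ : J ∈ energyRange κ H)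
    (hJ0 : J < 0) {τ a : ℝ} (hΔ : (family κ τ H a J).h (period κ H) = 0) {t : ℝ} (ht0 : 0 < t)
    (ht : t < period κ H / 2) : (family κ τ H a J).h t ≠ 0 := by
  have hd : ∀ t, t ∈ solDom κ H J := mem_solDom_of_ne hJ0.ne
  have hA := versAmp_pos hH hs hJ (hJ0.trans (Jmax_pos hH hs))
  have hf := freq_pos hs
  have hhalf : (family κ τ H a J).h (period κ H / 2) = 0 := by
    have h1 := family_h_add_period hH hs hJ hJ0.ne τ a (-(period κ H / 2))
    rw [family_h_neg hH hs hJ hJ0.ne, hΔ, show -(period κ H / 2) + period κ H = period κ H / 2 by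
      ring] at h1
    linarith
  have hcont : Continuous (family κ τ H a J).h := continuous_iff_continuousAt.2 fun t =>
    (hasDerivAt_family_h hH hs hJ τ a (hd t)).continuousAt
  have hanti : StrictAntiOn (momentum κ H J) (Icc 0 (period κ H / 2)) := by
    refine strictAntiOn_of_deriv_neg (convex_Icc _ _)
      (contDiff_momentum κ H J (n := 0)).continuous.continuousOn fun s hs' => ?_
    rw [interior_Icc] at hs'
    rw [(hasDerivAt_momentum κ H J s).deriv, versSol']
    have h1 : freq κ H * s < π := by
      have := hs'.2
      rw [period, div_div, lt_div_iff₀ (by positivity)] at this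
      linarith
    have h2 := Real.sin_pos_of_pos_of_lt_pi (mul_pos hf hs'.1) h1
    have : 0 < 2 * H * (versAmp κ H J * freq κ H * sin (freq κ H * s)) := by positivity
    linarith
  have hmom : ∀ s, heightRate κ τ a H J s = 0 → momentum κ H J s = 0 := by
    intro s h1
    have h2 := snSq_pos hH hs hJ (hd s)
    have h3 := killing_pos hH hs hJ τ a (hd s)
    simpa [heightRate, h2.ne', h3.ne'] using h1
  intro hzero
  obtain ⟨x, hx, hx'⟩ := exists_hasDerivAt_eq_zero ht0 hcont.continuousOn
    ((family_zero_h κ τ H a J).trans hzero.symm)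
    (fun s _ => hasDerivAt_family_h hH hs hJ τ a (hd s))
  obtain ⟨y, hy, hy'⟩ := exists_hasDerivAt_eq_zero ht hcont.continuousOn
    (hzero.trans hhalf.symm) (fun s _ => hasDerivAt_family_h hH hs hJ τ a (hd s))
  have := hanti ⟨hx.1.le, (hx.2.trans ht).le⟩ ⟨(ht0.trans hy.1).le, hy.2.le⟩ (hx.2.trans hy.1)
  rw [hmom x hx', hmom y hy'] at this
  exact lt_irrefl _ this

theorem exists_half_period_of_family_h_eq_zero (hH : 0 < H) (hs : 0 < 4 * H ^ 2 + κ)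
    (hJ : J ∈ energyRange κ H) (hJ0 : J < 0) {τ a : ℝ}
    (hΔ : (family κ τ H a J).h (period κ H) = 0) {t : ℝ} (ht : (family κ τ H a J).h t = 0) :
    ∃ k : ℤ, 2 * t = k * period κ H := by
  have hP := period_pos hs
  obtain ⟨t', ⟨h0, h1⟩, j, hj⟩ : ∃ t' ∈ Ico 0 (period κ H), ∃ j : ℤ, t = t' + j * period κ H :=
    ⟨t - ⌊t / period κ H⌋ * period κ H, ⟨sub_nonneg.2 ((le_div_iff₀ hP).1 (Int.floor_le _)), by
      have := (div_lt_iff₀ hP).1 (Int.lt_floor_add_one (t / period κ H)); linarith⟩,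
      ⌊t / period κ H⌋, by ring⟩
  rw [hj, family_h_add_int hH hs hJ hJ0.ne, hΔ, mul_zero, add_zero] at ht
  rcases h0.eq_or_lt with h0 | h0
  · exact ⟨2 * j, by rw [hj, ← h0]; push_cast; ring⟩
  rcases lt_trichotomy t' (period κ H / 2) with h | h | h
  · exact absurd ht (family_h_ne_zero hH hs hJ hJ0 hΔ h0 h)
  · exact ⟨2 * j + 1, by rw [hj, h]; push_cast; ring⟩
  -- The reflection `t' ↦ P - t'` moves the second half of the period to the first and negates the
  -- height.
  · refine absurd ?_ (family_h_ne_zero hH hs hJ hJ0 hΔ (t := -t' + period κ H) (by linarith)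
      (by linarith))
    rw [family_h_add_period hH hs hJ hJ0.ne, family_h_neg hH hs hJ hJ0.ne, hΔ, ht]; simp

theorem family_curve_eq_iff (hH : 0 < H) (hs : 0 < 4 * H ^ 2 + κ) (hJ : J ∈ energyRange κ H)
    (hJ0 : J < 0) {τ a : ℝ} (hΔ : (family κ τ H a J).h (period κ H) = 0) (s t : ℝ) :
    (family κ τ H a J).curve s = (family κ τ H a J).curve t ↔
      ∃ m : ℤ, s - t = m * period κ H := by
  constructor
  · intro h
    have hh : (family κ τ H a J).h s = (family κ τ H a J).h t := congrArg Prod.snd h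
    obtain ⟨k, rfl | rfl⟩ := eq_of_family_r_eq hH hs hJ hJ0 (τ := τ) (a := a) (congrArg Prod.fst h)
    · exact ⟨k, by ring⟩
    · rw [family_h_add_int hH hs hJ hJ0.ne, family_h_neg hH hs hJ hJ0.ne, hΔ] at hh
      -- For `s = -t + kP` equal heights mean `h(t) = -h(t)`, hence `2t = jP` and `s - t = (k -
      -- j)P`.
      obtain ⟨j, hj⟩ := exists_half_period_of_family_h_eq_zero hH hs hJ hJ0 hΔ (t := t) (by linarith)
      exact ⟨k - j, by push_cast; linarith⟩
  · rintro ⟨m, hm⟩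
    obtain rfl : s = t + m * period κ H := by linarith
    refine Prod.ext ((family_r_periodic hs J τ a).int_mul m t) ?_
    change (family κ τ H a J).h _ = (family κ τ H a J).h t
    rw [family_h_add_int hH hs hJ hJ0.ne, hΔ]; simp

theorem isTube_family (hH : 0 < H) (hs : 0 < 4 * H ^ 2 + κ) (hJ : J ∈ energyRange κ H)
    (hJ0 : J < 0) (τ a : ℝ) (hΔ : (family κ τ H a J).h (period κ H) = 0) :
    IsTube a (family κ τ H a J) (period κ H) := by
  have hf := freq_pos hs
  have hloop := family_curve_eq_iff hH hs hJ hJ0 (τ := τ) (a := a) hΔ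
  -- Rescaling by `ω` changes the period `2π/ω` to `2π`.
  set c : ℝ → ℝ × ℝ := fun u => (family κ τ H a J).curve ((freq κ H)⁻¹ * u) with hcdef
  have hc : ContDiff ℝ ∞ c :=
    (contDiff_family_curve hH hs hJ hJ0.ne τ a).comp (contDiff_const.mul contDiff_id)
  have hreg : ∀ u, deriv c u ≠ 0 := fun u => by
    have h1 := deriv_family_curve_ne hH hs hJ τ a (mem_solDom_of_ne hJ0.ne ((freq κ H)⁻¹ * u))
    have h2 : deriv c u = (freq κ H)⁻¹ • deriv (family κ τ H a J).curve ((freq κ H)⁻¹ * u) :=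
      deriv_comp_mul_left (freq κ H)⁻¹ (family κ τ H a J).curve u
    rw [h2]
    exact smul_ne_zero (inv_ne_zero hf.ne') h1
  have hcloop : ∀ s t, c s = c t ↔ (s : Real.Angle) = t := fun s t => by
    rw [hcdef, hloop, Real.Angle.angle_eq_iff_two_pi_dvd_sub]
    refine exists_congr fun m => ?_
    rw [period, ← mul_sub, inv_mul_eq_iff_eq_mul₀ hf.ne']
    rw [show freq κ H * (m * (2 * π / freq κ H)) = 2 * π * m by field_simp]
  have hsurf : ∀ b : ℝ, (family κ τ H a J).surface b = range fun p => toPt (screwParam b c p) := by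
    intro b
    ext x
    rw [ProfileCurve.mem_surface_iff]
    constructor
    · rintro ⟨t, -, φ, rfl⟩
      refine ⟨(freq κ H * t, φ), ?_⟩
      simp only [screwParam, hcdef, inv_mul_cancel_left₀ hf.ne']
    · rintro ⟨⟨u, φ⟩, rfl⟩
      exact ⟨(freq κ H)⁻¹ * u, mem_solDom_of_ne hJ0.ne _, φ, rfl⟩
  refine ⟨hloop, fun ha => ?_, fun _ => ?_⟩
  · rw [hsurf, ha]
    exact isEmbeddedTorus_range hc hreg hcloop
  · rw [hsurf]
    exact isImmersedTubularCylinder_range a hc hreg hcloop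

end negative

/-! ### The main theorem. -/

theorem theorem3p1 (κ τ H : ℝ) (hH : 0 < H) (hsuper : 0 < 4 * H ^ 2 + κ) :
    ∃ Γ : ℝ → ℝ → ProfileCurve, ∀ a : ℝ,
      -- the members of the family are invariant surfaces of mean curvature `H` and energy `J`
      (∀ J ∈ energyRange κ H, IsProfile κ τ a H J (Γ a J)) ∧
      -- the family is continuous
      ContinuousOn
        (fun x : ℝ × ℝ => ((Γ a x.1).r x.2, (Γ a x.1).h x.2, (Γ a x.1).σ x.2))
        {x : ℝ × ℝ | x.1 ∈ energyRange κ H ∧ x.2 ∈ (Γ a x.1).dom} ∧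
      -- the energy parametrizes it: different energies give different surfaces
      (∀ J ∈ energyRange κ H, ∀ J' ∈ energyRange κ H, ∀ v : ℝ,
        (Γ a J').surface a = vertShift v '' (Γ a J).surface a → J = J') ∧
      -- the family is exhaustive, for positive `κ` up to the exchange of the two axes
      (∀ (K : Set ℝ) (c : ℝ → ℝ × ℝ), IsOpen K → K.OrdConnected → ContDiffOn ℝ 2 c K →
        (∀ s ∈ K, (c s).1 ∈ radii κ ∧ deriv c s ≠ 0) →
        HasCMC κ τ H (K ×ˢ univ) (screwParam a c) →
        (∃ J ∈ energyRange κ H, IsPieceOf c K (Γ a J)) ∨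
        (0 < κ ∧ ∃ J ∈ energyRange κ H,
          IsPieceOf (swapAxes κ c) K (Γ (4 * τ / κ - a) J))) ∧
      -- all surfaces are cylindrically bounded
      (∀ J ∈ energyRange κ H, ∃ R ∈ radii κ, ∀ x ∈ (Γ a J).surface a, x.1 ≤ R) ∧
      -- the geometry depends on the energy: vertical cylinder, unduloid type, sphere type, and for
      -- negative energy nodoid type I, tube, nodoid type II by the sign of the vertical period
      IsVerticalCylinder κ a H (Γ a (Jmax κ H)) ∧
      (∀ J ∈ Ioo 0 (Jmax κ H), IsUnduloidType a (Γ a J)) ∧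
      IsSphereType κ τ a (Γ a 0) ∧
      (∀ J ∈ energyRange κ H, J < 0 → ∃ P Δ : ℝ, IsRollingProfile (Γ a J) P Δ ∧
        (0 < Δ → HasNodoidTopology a (Γ a J)) ∧
        (Δ = 0 → IsTube a (Γ a J) P) ∧
        (Δ < 0 → HasNodoidTopology a (Γ a J))) := by
  refine ⟨family κ τ H, fun a => ⟨fun J hJ => isProfile_family hH hsuper hJ,
    continuousOn_family κ τ a H hH hsuper,
    fun J hJ J' hJ' v h => energy_eq_of_surface_eq hH hsuper hJ hJ' h,
    fun K c hK hKc hc hreg hcmc => exhaustion hH hsuper hK hKc hc hreg hcmc,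
    fun J hJ => cylindrically_bounded hH hsuper hJ τ a,
    isVerticalCylinder_family hH hsuper τ a,
    fun J hJ => isUnduloidType_family hH hsuper hJ τ a,
    isSphereType_family hH hsuper τ a,
    fun J hJ hJ0 => ⟨period κ H, (family κ τ H a J).h (period κ H),
      isRollingProfile_family hH hsuper hJ hJ0 τ a,
      fun h => hasNodoidTopology_family hH hsuper hJ hJ0 τ a h.ne',
      fun h => isTube_family hH hsuper hJ hJ0 τ a h,
      fun h => hasNodoidTopology_family hH hsuper hJ hJ0 τ a h.ne⟩⟩⟩
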